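/- Let $\Lambda$ be a countable additive abelian semigroup satisfying the finiteness condition: every $\lambda\in\Lambda$ can be written as a sum of (one or more) elements of $\Lambda$ in only finitely many ways (up to order). Put $\bar\Lambda=\Lambda\sqcup\{0\}$, and fix a homomorphism $\kappa:\Lambda\to\{\pm1\}$, extended by $\kappa(0)=1$; let $\Lambda_\pm=\{\lambda\in\Lambda\mid\kappa(\lambda)=\pm1\}$. Let $\mathbb Q[[\bar\Lambda]]$ be the algebra of all formal series $\sum_{\lambda\in\bar\Lambda}f_\lambda e^\lambda$, $f_\lambda\in\mathbb Q$, with $e^\lambda e^\mu=e^{\lambda+\mu}$, and $\mathbb Q[[\Lambda]]$ the subspace $f_0=0$. With $E^\lambda=\kappa(\lambda)e^\lambda$, let $\big(\sum_\lambda f_\lambda E^\lambda\big)^{[m]}=\sum_\lambda f_\lambda E^{m\lambda}$ for $m\ge1$. For a prime $p$ and $n\ge 1$, let $1_p(n)=1$ if $p\nmid n$ and $1_p(n)=1-p$ if $p\mid n$; let $\mu_p(n)=\mu(n)$ if $p\nmid n$, and $\mu_p(n)=\mu(m)(p^s-p^{s-1})$ if $n=mp^s$ with $s\ge1$, $p\nmid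 m$, where $\mu$ is the Möbius function. Define $$\mathcal E_p:\mathbb Q[[\Lambda]]\to1+\mathbb Q[[\Lambda]],\quad \mathcal E_p(f)=\exp\Big(\sum_{m\ge1}\frac{1_p(m)}{m}f^{[m]}\Big),\qquad \mathcal L_p:1+\mathbb Q[[\Lambda]]\to\mathbb Q[[\Lambda]],\quad \mathcal L_p(f)=\sum_{n\ge1}\frac{\mu_p(n)}{n}\ln f^{[n]}.$$ Let $F$ be a field of characteristic $p>0$, $G$ an abelian group and $\gamma:G\times G\to F^\times$ a bicharacter with $\gamma(g,h)\gamma(h,g)=1$ such that $G=G_+$, i.e. $\gamma(g,g)=1$ for all $g\in G$. A $(G,\gamma)$-color Lie $p$-algebra is a $G$-graded space $L=\bigoplus_{g}L_g$ over $F$ with a bilinear bracket satisfying $[L_g,L_h]\subseteq L_{g+h}$ and, for $x\in L_g$, $y\in L_h$, $z\in L$, $[x,y]=-\gamma(g,h)[y,x]$, $[x,x]=0$ and $[x,[y,z]]=[[x,y],z]+\gamma(g,h)[y,[x,z]]$, and with maps $x\mapsto x^{[p]}$, $L_g\to L_{pg}$, such that for $x,y\in L_g$, $a\in F$, $z\in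 L$: $(ax)^{[p]}=a^px^{[p]}$, $[x^{[p]},z]=(\operatorname{ad}x)^p(z)$ and $(x+y)^{[p]}=x^{[p]}+y^{[p]}+\sum_{i=1}^{p-1}s_i(x,y)$, where $i\,s_i(x,y)$ is the coefficient of $t^{i-1}$ in $(\operatorname{ad}(tx+y))^{p-1}(x)$. It is $\Lambda$-graded if moreover $L=\bigoplus_{\lambda\in\Lambda}L_\lambda$ with $[L_\lambda,L_\mu]\subseteq L_{\lambda+\mu}$, $L_g=\bigoplus_{\lambda\in\Lambda_+}(L_\lambda\cap L_g)$ and $(L_\lambda\cap L_g)^{[p]}\subseteq L_{p\lambda}$. Its restricted enveloping algebra $u(L)$ is the quotient of the tensor algebra of $L$ by the relations $xy-\gamma(g,h)yx=[x,y]$ ($x\in L_g$, $y\in L_h$) and $x^p=x^{[p]}$ ($x\in L_g$); for $\lambda\in\bar\Lambda$ let $u(L)_\lambda$ be the span of all products $x_1\cdots x_k$, $k\ge0$, with $x_i\in L_{\lambda_i}$, $\lambda_1+\dots+\lambda_k=\lambda$. **Theorem.** Let $L=\bigoplus_{\lambda\in\Lambda}L_\lambda$ be a $\Lambda$-graded color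 Lie $p$-algebra ($G=G_+$) with $\dim L_\lambda<\infty$ for all $\lambda\in\Lambda$. Then $u(L)=\bigoplus_{\lambda\in\bar\Lambda}u(L)_\lambda$ with all $u(L)_\lambda$ finite-dimensional, and the characters $\operatorname{ch}_\Lambda L=\sum_{\lambda\in\Lambda}(\dim L_\lambda)e^\lambda$ and $\operatorname{ch}_{\bar\Lambda}u(L)=\sum_{\lambda\in\bar\Lambda}(\dim u(L)_\lambda)e^\lambda$ satisfy 1. $\operatorname{ch}_{\bar\Lambda}u(L)=\mathcal E_p(\operatorname{ch}_\Lambda L)$; 2. $\operatorname{ch}_\Lambda L=\mathcal L_p(\operatorname{ch}_{\bar\Lambda}u(L))$. -/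

import Mathlib

namespace ColorLie

noncomputable section

/-! ### Gradings -/

open Classical in
/-- The family `B` of subspaces is a grading of the vector space `V`: `V` is the direct sum of
the subspaces `B i`. -/
def IsGrading {ι F V : Type*} [Field F] [AddCommGroup V] [Module F V]
    (B : ι → Submodule F V) : Prop :=
  DirectSum.IsInternal B

/-! ### Color Lie superalgebras and color Lie p-superalgebras -/

/-- A skew-symmetric bicharacter (commutation factor) `γ : G × G → Fˣ`. -/
structure CommutationFactor (F G : Type*) [Field F] [AddCommGroup G] where
  toFun : G → G → Fˣ
  map_add_left : ∀ f g h, toFun (f + g) h = toFun f h * toFun g h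
  map_add_right : ∀ f g h, toFun f (g + h) = toFun f g * toFun f h
  skew : ∀ g h, toFun g h * toFun h g = 1

/-- `G₊ = {g | γ(g, g) = 1}`; its complement `G₋` is `{g | γ(g, g) = -1}` when `-1 ≠ 1`,
and it is empty when `-1 = 1`. -/
def CommutationFactor.pos {F G : Type*} [Field F] [AddCommGroup G]
    (γ : CommutationFactor F G) : Set G :=
  {g | γ.toFun g g = 1}

open Classical in
/-- The sign `v : G → {±1}`, equal to `1` on `G₊` and to `-1` on `G₋`. -/
def CommutationFactor.sign {F G : Type*} [Field F] [AddCommGroup G]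
    (γ : CommutationFactor F G) (g : G) : ℤˣ :=
  if g ∈ γ.pos then 1 else -1

/-- A structure of `(G, γ)`-color Lie superalgebra on the vector space `L`. The identities
`bracket_self` and `bracket_bracket_self` follow from the other ones in characteristic different
from `2`, respectively different from `3`; in these two characteristics they are part of the
usual definition. -/
structure ColorLieSuperalgebra (F : Type*) {G : Type*} (L : Type*) [Field F] [AddCommGroup G]
    [AddCommGroup L] [Module F L] (γ : CommutationFactor F G) where
  /-- The color Lie bracket. -/
  bracket : L →ₗ[F] L →ₗ[F] L
  /-- The homogeneous component `L_g`. -/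
  comp : G → Submodule F L
  isGrading : IsGrading comp
  bracket_mem : ∀ {g h : G} {x y : L}, x ∈ comp g → y ∈ comp h → bracket x y ∈ comp (g + h)
  bracket_skew : ∀ {g h : G} {x y : L}, x ∈ comp g → y ∈ comp h →
    bracket x y = -((γ.toFun g h : F) • bracket y x)
  jacobi : ∀ {g h : G} {x y : L} (z : L), x ∈ comp g → y ∈ comp h →
    bracket x (bracket y z) =
      bracket (bracket x y) z + (γ.toFun g h : F) • bracket y (bracket x z)
  bracket_self : ∀ {g : G} {x : L}, g ∈ γ.pos → x ∈ comp g → bracket x x = 0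
  bracket_bracket_self : ∀ {g : G} {x : L}, g ∉ γ.pos → x ∈ comp g →
    bracket x (bracket x x) = 0

/-- Jacobson's element `s_i(x, y)`: `i s_i(x, y)` is the coefficient of `t ^ (i - 1)` in
`(ad (t x + y)) ^ (p - 1) (x)`. -/
def jacobsonTerm {F L : Type*} [Field F] [AddCommGroup L] [Module F L] (p : ℕ)
    (ad : L →ₗ[F] Module.End F L) (i : ℕ) (x y : L) : L :=
  (i : F)⁻¹ • (((Polynomial.X * Polynomial.C (ad x) + Polynomial.C (ad y) :
    Polynomial (Module.End F L)) ^ (p - 1)).coeff (i - 1)) x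

/-- A structure of `(G, γ)`-color Lie p-superalgebra on `L`. The p-map is defined on the
homogeneous elements of degree in `G₊`; the values of the function `pmap` at other elements are
immaterial. -/
structure ColorLiePSuperalgebra (p : ℕ) (F : Type*) {G : Type*} (L : Type*) [Field F]
    [AddCommGroup G] [AddCommGroup L] [Module F L] (γ : CommutationFactor F G) extends
    ColorLieSuperalgebra F L γ where
  /-- The p-map `x ↦ x^[p]`. -/
  pmap : L → L
  pmap_mem : ∀ {g : G} {x : L}, g ∈ γ.pos → x ∈ comp g → pmap x ∈ comp (p • g)
  pmap_smul : ∀ {g : G} {x : L} (a : F), g ∈ γ.pos → x ∈ comp g →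
    pmap (a • x) = a ^ p • pmap x
  bracket_pmap : ∀ {g : G} {x : L} (z : L), g ∈ γ.pos → x ∈ comp g →
    bracket (pmap x) z = ((bracket x : Module.End F L) ^ p) z
  pmap_add : ∀ {g : G} {x y : L}, g ∈ γ.pos → x ∈ comp g → y ∈ comp g →
    pmap (x + y) = pmap x + pmap y + ∑ i ∈ Finset.Icc 1 (p - 1), jacobsonTerm p bracket i x y

section Enveloping

variable {p : ℕ} {F G L : Type*} [Field F] [AddCommGroup G] [AddCommGroup L] [Module F L]
  {γ : CommutationFactor F G}

/-- The defining relations of the restricted enveloping algebra, in the tensor algebra of `L`. -/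
inductive ColorLiePSuperalgebra.Rel (A : ColorLiePSuperalgebra p F L γ) :
    TensorAlgebra F L → TensorAlgebra F L → Prop
  | bracket {g h : G} {x y : L} (hx : x ∈ A.comp g) (hy : y ∈ A.comp h) :
      Rel A (TensorAlgebra.ι F x * TensorAlgebra.ι F y -
          (γ.toFun g h : F) • (TensorAlgebra.ι F y * TensorAlgebra.ι F x))
        (TensorAlgebra.ι F (A.bracket x y))
  | pmap {g : G} {x : L} (hg : g ∈ γ.pos) (hx : x ∈ A.comp g) :
      Rel A (TensorAlgebra.ι F x ^ p) (TensorAlgebra.ι F (A.pmap x))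

/-- The restricted enveloping algebra `u(L)`. -/
abbrev ColorLiePSuperalgebra.RestrictedEnveloping (A : ColorLiePSuperalgebra p F L γ) :=
  RingQuot A.Rel

/-- The canonical map `L → u(L)`. -/
def ColorLiePSuperalgebra.ι (A : ColorLiePSuperalgebra p F L γ) :
    L →ₗ[F] A.RestrictedEnveloping :=
  (RingQuot.mkAlgHom F A.Rel).toLinearMap ∘ₗ TensorAlgebra.ι F

variable {Λ : Type*} [AddCommSemigroup Λ]

/-- The family `B` of subspaces `L_l`, `l ∈ Λ`, makes `L` a `Λ`-graded color Lie p-superalgebra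
with respect to the homomorphism `κ : Λ → {±1}`. -/
structure ColorLiePSuperalgebra.IsSemigroupGraded (A : ColorLiePSuperalgebra p F L γ)
    (κ : Λ →ₙ+ Additive ℤˣ) (B : Λ → Submodule F L) : Prop where
  isGrading : IsGrading B
  bracket_mem : ∀ {l m : Λ} {x y : L}, x ∈ B l → y ∈ B m → A.bracket x y ∈ B (l + m)
  /-- `L_g` is the sum of the subspaces `L_l ∩ L_g` over all `l` of the same sign as `g`. -/
  compatible : ∀ g : G, A.comp g = ⨆ l : {l : Λ // (κ l).toMul = γ.sign g}, B l ⊓ A.comp g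
  /-- `x^[p] ∈ L_{pl}` for `x ∈ L_l ∩ L_g`, `g ∈ G₊`; here `m = pl`. -/
  pmap_mem : ∀ {g : G} {l m : Λ} {x : L}, g ∈ γ.pos → x ∈ A.comp g → x ∈ B l →
    (m : WithZero Λ) = p • (l : WithZero Λ) → A.pmap x ∈ B m

/-- The component of degree `l` of `u(L)` in the grading by `Λ ∪ {0}` induced by a grading of `L`
by `Λ`: it is spanned by the products `x₁ ⋯ x_k` (`k ≥ 0`) with `x_i ∈ L_{l_i}` and
`l₁ + ⋯ + l_k = l`. -/
def ColorLiePSuperalgebra.envelopingComp (A : ColorLiePSuperalgebra p F L γ)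
    (B : Λ → Submodule F L) (l : WithZero Λ) : Submodule F A.RestrictedEnveloping :=
  Submodule.span F {z | ∃ w : List (Λ × L), (∀ q ∈ w, q.2 ∈ B q.1) ∧
    (w.map fun q => (q.1 : WithZero Λ)).sum = l ∧ z = (w.map fun q => A.ι q.2).prod}

end Enveloping

/-! ### Formal series

`Λ ∪ {0}` is `WithZero Λ`, and `ℚ[[Λ ∪ {0}]]` consists of all functions `WithZero Λ → ℚ`, the
function `f` standing for the series `∑ f(l) e^l`. The subspace `ℚ[[Λ]]` is given by `f 0 = 0`. All
sums below are coefficientwise; under the finiteness condition each of them has only finitely many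
nonzero terms, for `f` in `ℚ[[Λ]]` in the case of `expSeries` and `Ep`, and in `1 + ℚ[[Λ]]` in the
case of `lnSeries` and `Lp`. -/

section Series

variable {Λ : Type*} [AddCommSemigroup Λ]

/-- Every element of `Λ` is a sum of elements of `Λ` in only finitely many ways. -/
def FinitenessCondition (Λ : Type*) [AddCommSemigroup Λ] : Prop :=
  ∀ l : Λ, {s : Multiset Λ | (s.map (WithZero.coe : Λ → WithZero Λ)).sum = (l : WithZero Λ)}.Finite

/-- The character `∑ dim(U_l) e^l` of a space graded by `Λ ∪ {0}`. -/
def character {F U : Type*} [Field F] [AddCommGroup U] [Module F U]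
    (B : WithZero Λ → Submodule F U) : WithZero Λ → ℚ :=
  fun l => (Module.finrank F (B l) : ℚ)

/-- The character of a space graded by `Λ`, as a series without constant term. -/
def characterNoConst {F U : Type*} [Field F] [AddCommGroup U] [Module F U]
    (B : Λ → Submodule F U) : WithZero Λ → ℚ :=
  WithZero.recZeroCoe 0 fun l => (Module.finrank F (B l) : ℚ)

/-- The series `1 = e^0`. -/
def oneSeries : WithZero Λ → ℚ :=
  WithZero.recZeroCoe 1 fun _ => 0

/-- The product of series, determined by `e^a e^b = e^(a + b)`. -/
def mulSeries (f g : WithZero Λ → ℚ) : WithZero Λ → ℚ :=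
  fun l => ∑ᶠ (q : WithZero Λ × WithZero Λ) (_ : q.1 + q.2 = l), f q.1 * g q.2

/-- Powers of a series. -/
def powSeries (f : WithZero Λ → ℚ) : ℕ → WithZero Λ → ℚ
  | 0 => oneSeries
  | k + 1 => mulSeries (powSeries f k) f

/-- `exp f = ∑_{k ≥ 0} f^k / k!`. -/
def expSeries (f : WithZero Λ → ℚ) : WithZero Λ → ℚ :=
  fun l => ∑ᶠ k : ℕ, powSeries f k l / (k.factorial : ℚ)

/-- `ln f = ∑_{k ≥ 1} (-1)^(k + 1) (f - 1)^k / k`. -/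
def lnSeries (f : WithZero Λ → ℚ) : WithZero Λ → ℚ :=
  fun l => ∑ᶠ (k : ℕ) (_ : 1 ≤ k),
    (-1 : ℚ) ^ (k + 1) * powSeries (fun a => f a - oneSeries a) k l / (k : ℚ)

/-- The sign `κ(l)` as a rational number, with `κ(0) = 1`. -/
def signOf (κ : Λ →ₙ+ Additive ℤˣ) : WithZero Λ → ℚ :=
  WithZero.recZeroCoe 1 fun l => (((κ l).toMul : ℤ) : ℚ)

/-- The twisted dilation `∑ f_l E^l ↦ ∑ f_l E^(ml)`, where `E^l = κ(l) e^l`. -/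
def dilation (κ : Λ →ₙ+ Additive ℤˣ) (m : ℕ) (f : WithZero Λ → ℚ) : WithZero Λ → ℚ :=
  fun l => signOf κ l * ∑ᶠ (a : WithZero Λ) (_ : m • a = l), signOf κ a * f a

/-- `1_p(n)` is `1` if `p` does not divide `n`, and `1 - p` otherwise. -/
def oneP (p n : ℕ) : ℤ :=
  if p ∣ n then 1 - (p : ℤ) else 1

/-- `μ_p(n)` is `μ(n)` if `p` does not divide `n`, and `μ(m) (p^s - p^(s-1))` if `n = m p^s` with
`s ≥ 1` and `m` prime to `p`. -/
def moebiusP (p n : ℕ) : ℤ :=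
  if p ∣ n then
    ArithmeticFunction.moebius (n / p ^ padicValNat p n) *
      ((p : ℤ) ^ padicValNat p n - (p : ℤ) ^ (padicValNat p n - 1))
  else ArithmeticFunction.moebius n

/-- `ℰ_p(f) = exp (∑_{m ≥ 1} 1_p(m) f^[m] / m)`. -/
def Ep (p : ℕ) (κ : Λ →ₙ+ Additive ℤˣ) (f : WithZero Λ → ℚ) : WithZero Λ → ℚ :=
  expSeries fun l => ∑ᶠ (m : ℕ) (_ : 1 ≤ m), (oneP p m : ℚ) / (m : ℚ) * dilation κ m f l

/-- `ℒ_p(f) = ∑_{n ≥ 1} μ_p(n) ln (f^[n]) / n`. -/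
def Lp (p : ℕ) (κ : Λ →ₙ+ Additive ℤˣ) (f : WithZero Λ → ℚ) : WithZero Λ → ℚ :=
  fun l => ∑ᶠ (n : ℕ) (_ : 1 ≤ n), (moebiusP p n : ℚ) / (n : ℚ) * lnSeries (dilation κ n f) l

end Series

end

end ColorLie

/-! Choose a basis of `L` that is homogeneous for both gradings, with degrees `λ_i`, and well-order
it. By the Poincaré–Birkhoff–Witt theorem the ordered monomials with all exponents below `p` form a
basis of `u(L)`, so `ch u(L) = ∏ (1 + e^{λ_i} + ⋯ + e^{(p-1)λ_i})`. Each factor is `(1 - e^{pλ}) /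
(1 - e^λ)`, whose logarithm is `∑ 1_p(m) e^{mλ} / m` (`exp_oneP`); the product of the factors is the
exponential of the sum of these series (`Ep_apply_eq_card`). Because `G = G_+`, only degrees with `κ
= 1` occur, and the twisted dilation is just `e^λ ↦ e^{mλ}` on the characters involved.

For the inverse formula, dilations are multiplicative and hence commute with `ln`, so `ℒ_p(ℰ_p(f))`
is the sum of `μ_p(n) 1_p(m) / (nm) f^{[nm]}` over all `n`, `m`. As `μ_p` is the Dirichlet inverse
of `1_p` (`sum_moebiusP_mul_oneP`), only `f^{[1]} = f` survives (`Lp_Ep`).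

The PBW theorem comes from Bergman's diamond lemma (`exists_normalForm`) with the shortlex order on
words. Three kinds of overlap need an argument: `x_k x_j x_i` resolves by the Jacobi identity,
`x_i^{p+n}` because `x_i^{[p]}` commutes with `x_i`, and `x_i^p x_j`, `x_j x_i^p` because the inner
binomial coefficients of order `p` vanish and `ad(x^{[p]}) = (ad x)^p`. The rules mention basis
elements only; Jacobson's formula (`add_pow_char_eq_jacobson`) extends the `p`-map relation to all
homogeneous elements.

Series identities are checked one coefficient `l` at a time, in the quotient of the monoid algebra
that remembers only the summands of `l`. The finiteness condition makes series without constant term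
nilpotent there, so `exp` and `ln` become finite sums. -/

namespace ColorLie

open Module

/-! ### The diamond lemma for rewriting systems on words. -/

section Rewriting

variable {k T X M : Type*} [Field k] [Ring T] [Algebra k T]

/-- The set of the elements `u (w - f) v` for all rewriting rules `w → f` and words `u`, `v` such
that the word `u w v` has the property `P`. -/
def ruleElements (B : List X → T) (R : List X → T → Prop) (P : List X → Prop) : Set T :=
  {t | ∃ u w f v, R w f ∧ P (u ++ w ++ v) ∧ t = B u * (B w - f) * B v}

/-- A word is irreducible if it contains no left-hand side of a rule. -/
def IsIrreducible (R : List X → T → Prop) (w : List X) : Prop :=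
  ∀ u w' f v, R w' f → w ≠ u ++ w' ++ v

open Classical in
/-- One step of reduction, at an arbitrarily chosen place. -/
noncomputable def reduceOnce (B : List X → T) (R : List X → T → Prop) (w : List X) : T :=
  if h : ∃ q : List X × List X × T × List X, R q.2.1 q.2.2.1 ∧ w = q.1 ++ q.2.1 ++ q.2.2.2 then
    B h.choose.1 * h.choose.2.2.1 * B h.choose.2.2.2
  else B w

theorem reduceOnce_spec (B : List X → T) (R : List X → T → Prop) (w : List X)
    (hw : ¬ IsIrreducible R w) :
    ∃ u w' f v, R w' f ∧ w = u ++ w' ++ v ∧ reduceOnce B R w = B u * f * B v := by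
  have h : ∃ q : List X × List X × T × List X,
      R q.2.1 q.2.2.1 ∧ w = q.1 ++ q.2.1 ++ q.2.2.2 := by
    simp only [IsIrreducible, not_forall] at hw
    obtain ⟨u, w', f, v, hR, h⟩ := hw
    exact ⟨(u, w', f, v), hR, not_not.mp h⟩
  refine ⟨_, _, _, _, h.choose_spec.1, h.choose_spec.2, ?_⟩
  rw [reduceOnce, dif_pos h]

open Classical in
/-- The normal form of a word. -/
noncomputable def normalForm (B : Basis (List X) k T) (R : List X → T → Prop)
    {lt : List X → List X → Prop} (wf : WellFounded lt) : List X → T :=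
  wf.fix fun w ih =>
    if IsIrreducible R w then B w
    else (B.repr (reduceOnce B R w)).sum fun w' c => if h : lt w' w then c • ih w' h else 0

open Classical in
theorem normalForm_eq (B : Basis (List X) k T) (R : List X → T → Prop)
    {lt : List X → List X → Prop} (wf : WellFounded lt) (w : List X) :
    normalForm B R wf w = if IsIrreducible R w then B w
    else (B.repr (reduceOnce B R w)).sum fun w' c =>
      if lt w' w then c • normalForm B R wf w' else 0 := by
  rw [normalForm, wf.fix_eq]
  rfl

/-- Bergman's diamond lemma: if all ambiguities of a rewriting system are resolvable, then there is
a projection onto the span of the irreducible words which vanishes on all relations. -/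
theorem exists_normalForm (B : Basis (List X) k T) (R : List X → T → Prop)
    {lt : List X → List X → Prop} (wf : WellFounded lt)
    (compat : ∀ u w f v, R w f → B u * f * B v ∈
      Submodule.span k (B '' {w' | lt w' (u ++ w ++ v)}))
    (confl : ∀ u w f v u' w' f' v', R w f → R w' f' → u ++ w ++ v = u' ++ w' ++ v' →
      B u * f * B v - B u' * f' * B v' ∈
        Submodule.span k (ruleElements B R fun x => lt x (u ++ w ++ v)))
    (mul : ∀ u v, B (u ++ v) = B u * B v) :
    ∃ N : T →ₗ[k] T, (∀ w, IsIrreducible R w → N (B w) = B w) ∧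
      ∀ t ∈ Submodule.span k (ruleElements B R fun _ => True), N t = 0 := by
  classical
  set N : T →ₗ[k] T := B.constr k (normalForm B R wf) with hN
  have hNB : ∀ w, N (B w) = normalForm B R wf w := fun w => B.constr_basis k _ w
  have hred : ∀ w, ¬ IsIrreducible R w → N (reduceOnce B R w) = N (B w) := by
    intro w hw
    rw [hNB, normalForm_eq, if_neg hw, hN, Basis.constr_apply]
    refine Finset.sum_congr rfl fun w' hw' => ?_
    obtain ⟨u, w₁, f, v, hR, rfl, h⟩ := reduceOnce_spec B R w hw
    -- By `compat` the reduct involves only smaller words, so the `if` in the recursion never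
    -- discards a term.
    have := compat u w₁ f v hR
    rw [← h, Basis.mem_span_image] at this
    exact (if_pos (this hw')).symm
  -- Independence of the chosen place of reduction: two reducts of `w` differ by relations at
  -- smaller words, which `N` kills by induction.
  have key : ∀ w, ∀ u w' f v, R w' f → w = u ++ w' ++ v → N (B u * f * B v) = N (B w) := by
    intro w
    induction w using wf.induction with
    | _ w ih =>
    intro u w' f v hR hw
    have hirr : ¬ IsIrreducible R w := fun h => h u w' f v hR hw
    obtain ⟨u₀, w₀, f₀, v₀, hR₀, hw₀, h₀⟩ := reduceOnce_spec B R w hirr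
    rw [← hred w hirr, h₀, ← sub_eq_zero, ← map_sub]
    have hmem := confl u w' f v u₀ w₀ f₀ v₀ hR hR₀ (hw.symm.trans hw₀)
    rw [← hw] at hmem
    refine (Submodule.span_le (p := LinearMap.ker N)).mpr ?_ hmem
    rintro _ ⟨u₁, w₁, f₁, v₁, hR₁, hlt, rfl⟩
    have := ih _ hlt u₁ w₁ f₁ v₁ hR₁ rfl
    simp only [SetLike.mem_coe, LinearMap.mem_ker, mul_sub, sub_mul, map_sub, this, ← mul, sub_self]
  refine ⟨N, fun w hw => by rw [hNB, normalForm_eq, if_pos hw], fun t ht => ?_⟩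
  refine (Submodule.span_le (p := LinearMap.ker N)).mpr ?_ ht
  rintro _ ⟨u₁, w₁, f₁, v₁, hR₁, -, rfl⟩
  have := key _ u₁ w₁ f₁ v₁ hR₁ rfl
  simp only [SetLike.mem_coe, LinearMap.mem_ker, mul_sub, sub_mul, map_sub, this, ← mul, sub_self]

/-- Modulo the relations, every word is a combination of irreducible words of the same degree. -/
theorem mem_span_irreducible {U : Type*} [AddCommGroup U] [Module k U] (B : List X → T)
    (R : List X → T → Prop) {lt : List X → List X → Prop} (wf : WellFounded lt) (d : List X → M)
    (compat : ∀ u w f v, R w f → B u * f * B v ∈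
      Submodule.span k (B '' {w' | lt w' (u ++ w ++ v) ∧ d w' = d (u ++ w ++ v)}))
    (π : T →ₗ[k] U)
    (hπ : ∀ u w f v, R w f → π (B (u ++ w ++ v)) = π (B u * f * B v)) (w : List X) :
    π (B w) ∈ Submodule.span k ((fun w => π (B w)) '' {w' | IsIrreducible R w' ∧ d w' = d w}) := by
  induction w using wf.induction with
  | _ w ih =>
  by_cases hw : IsIrreducible R w
  · exact Submodule.subset_span ⟨w, ⟨hw, rfl⟩, rfl⟩
  obtain ⟨u, w', f, v, hR, rfl, -⟩ := reduceOnce_spec B R w hw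
  rw [hπ u w' f v hR]
  suffices h : Submodule.span k (B '' {x | lt x (u ++ w' ++ v) ∧ d x = d (u ++ w' ++ v)}) ≤
      Submodule.comap π (Submodule.span k
        ((fun w => π (B w)) '' {x | IsIrreducible R x ∧ d x = d (u ++ w' ++ v)})) from
    h (compat u w' f v hR)
  refine Submodule.span_le.mpr ?_
  rintro _ ⟨w₁, ⟨hlt, hd⟩, rfl⟩
  have := ih w₁ hlt
  rw [hd] at this
  exact this

end Rewriting

end ColorLie

namespace ColorLie

open Module

/-! ### Gradings and homogeneous bases. -/

section Gradings

variable {F V ι W : Type*} [Field F] [AddCommGroup V] [Module F V]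

theorem isGrading_iff (B : ι → Submodule F V) :
    IsGrading B ↔ iSupIndep B ∧ iSup B = ⊤ := by
  classical
  unfold IsGrading
  exact DirectSum.isInternal_submodule_iff_iSupIndep_and_iSup_eq_top B

/-- A family of subspaces of the components of a grading whose sum is everything
consists of the components themselves. -/
theorem IsGrading.eq_of_le {B C : ι → Submodule F V} (hB : IsGrading B) (hle : ∀ i, C i ≤ B i)
    (htop : iSup C = ⊤) (i : ι) : B i = C i := by
  obtain ⟨hind, -⟩ := (isGrading_iff B).mp hB
  have h1 : C i ⊔ ⨆ (j) (_ : j ≠ i), C j = ⊤ := by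
    rw [← htop]
    refine le_antisymm (sup_le (le_iSup _ _) (iSup₂_le fun j _ => le_iSup _ _)) (iSup_le fun j => ?_)
    by_cases h : j = i
    · subst h
      exact le_sup_left
    · exact le_sup_of_le_right (le_iSup₂_of_le j h le_rfl)
  have h2 : (⨆ (j) (_ : j ≠ i), C j) ⊓ B i = ⊥ := by
    have := (hind i).symm.mono_left (iSup₂_mono fun j (_ : j ≠ i) => hle j)
    exact this.eq_bot
  -- Modular law: intersecting `C i ⊔ ⨆_{j ≠ i} C j = ⊤` with `B i` leaves `C i`, since the other
  -- summands meet `B i` trivially.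
  have h3 := sup_inf_assoc_of_le (⨆ (j) (_ : j ≠ i), C j) (hle i)
  rwa [h1, h2, top_inf_eq, sup_bot_eq] at h3

/-- The components of a grading are spanned by the homogeneous elements of a basis. -/
theorem IsGrading.eq_span {B : ι → Submodule F V} (hB : IsGrading B) (b : Basis W F V) (d : W → ι)
    (hb : ∀ w, b w ∈ B (d w)) (i : ι) : B i = Submodule.span F (b '' {w | d w = i}) := by
  refine hB.eq_of_le (C := fun i => Submodule.span F (b '' {w | d w = i})) (fun i => ?_) ?_ i
  · rw [Submodule.span_le]
    rintro _ ⟨w, rfl, rfl⟩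
    exact hb w
  · rw [eq_top_iff, ← b.span_eq, Submodule.span_le]
    rintro _ ⟨w, rfl⟩
    exact Submodule.mem_iSup_of_mem (d w) (Submodule.subset_span ⟨w, rfl, rfl⟩)

/-- A degree function on a basis defines a grading. -/
theorem isGrading_span (b : Basis W F V) (d : W → ι) :
    IsGrading fun i => Submodule.span F (b '' {w | d w = i}) := by
  rw [isGrading_iff]
  constructor
  · intro i
    refine (b.linearIndependent.disjoint_span_image (s := {w | d w = i}) (t := {w | d w ≠ i})
      (Set.disjoint_left.mpr fun w h h' => h' h)).mono_right (iSup₂_le fun j hj => ?_)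
    exact Submodule.span_mono (Set.image_mono fun w (hw : d w = j) (h : d w = i) => hj (hw ▸ h))
  · rw [eq_top_iff, ← b.span_eq, Submodule.span_le]
    rintro _ ⟨w, rfl⟩
    exact Submodule.mem_iSup_of_mem (d w) (Submodule.subset_span ⟨w, rfl, rfl⟩)

theorem finrank_span_image (b : Basis W F V) (s : Set W) :
    finrank F (Submodule.span F (b '' s)) = Nat.card s := by
  have h : LinearIndependent F (fun w : s => b w) := b.linearIndependent.comp _ Subtype.val_injective
  have := finrank_eq_nat_card_basis (Basis.span h)
  rwa [show Set.range (fun w : s => b w) = b '' s by rw [Set.image_eq_range]] at this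

end Gradings

/-! ### The shortlex order is compatible with concatenation. -/

section Shortlex

variable {X : Type*} {r : X → X → Prop}

/-- Equal lengths exclude a proper prefix `s` of `t`, for which appending a common suffix could
reverse the order. -/
theorem lex_append_right {s t : List X} (h : List.Lex r s t) (hl : s.length = t.length)
    (v : List X) : List.Lex r (s ++ v) (t ++ v) := by
  induction h with
  | nil => simp at hl
  | cons _ ih => exact List.Lex.cons (ih (by simpa using hl))
  | rel h => exact List.Lex.rel h

theorem shortlex_append_right {s t : List X} (h : List.Shortlex r s t) (v : List X) :
    List.Shortlex r (s ++ v) (t ++ v) := by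
  rcases List.shortlex_def.mp h with h | ⟨h, h'⟩
  · exact List.Shortlex.of_length_lt (by simpa using h)
  · exact List.Shortlex.of_lex (by simpa using h) (lex_append_right h' h v)

theorem shortlex_append {s t : List X} (h : List.Shortlex r s t) (u v : List X) :
    List.Shortlex r (u ++ s ++ v) (u ++ t ++ v) :=
  shortlex_append_right (h.append_left u) v

end Shortlex

/-! ### Moving a letter past a power, modulo smaller terms. -/

section Telescoping

variable {F T : Type*} [Field F] [AddCommGroup T] [Module F T]

open Finset in
/-- Expansion of `X ^ (m + 1)` applied to an element `y 0` if `X` acts on each `y k` as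
`c • Y + D` modulo small terms, where `D (y k) = y (k + 1)`. -/
theorem pow_apply_sub_sum_mem {X Y : Module.End F T} (hXY : Commute X Y) (y : ℕ → T) (c : F)
    (K : ℕ → Submodule F T) (hX : ∀ m, ∀ t ∈ K m, X t ∈ K (m + 1))
    (hz : ∀ m k, k ≤ m + 1 →
      (Y ^ (m + 1 - k)) (X (y k) - c • Y (y k) - y (k + 1)) ∈ K (m + 1)) (m : ℕ) :
    (X ^ m) (c • Y (y 0) + y 1) - ∑ q ∈ antidiagonal (m + 1),
      (m + 1).choose q.1 • (c ^ q.2 • (Y ^ q.2) (y q.1)) ∈ K m := by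
  induction m with
  | zero =>
    simp [Nat.antidiagonal_succ, add_comm]
  | succ m ih =>
    have h1 := hX m _ ih
    -- The total error of replacing each `X (y k)` by `c • Y (y k) + y (k + 1)`; after this
    -- replacement the sums for consecutive exponents match by Pascal's rule.
    have h2 : ∑ q ∈ antidiagonal (m + 1), (m + 1).choose q.1 •
        (c ^ q.2 • (Y ^ q.2) (X (y q.1) - c • Y (y q.1) - y (q.1 + 1))) ∈ K (m + 1) := by
      refine Submodule.sum_mem _ fun q hq => ?_
      rw [HasAntidiagonal.mem_antidiagonal] at hq
      refine Submodule.smul_of_tower_mem _ _ (Submodule.smul_mem _ _ ?_)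
      have := hz m q.1 (by omega)
      rwa [show m + 1 - q.1 = q.2 by omega] at this
    have h3 := add_mem h1 h2
    convert h3 using 1
    rw [map_sub, map_sum, ← Module.End.mul_apply, ← pow_succ', sub_add, ← sum_sub_distrib]
    congr 1
    rw [sum_antidiagonal_choose_succ_nsmul (fun a b => c ^ b • (Y ^ b) (y a)), ← sum_add_distrib]
    refine sum_congr rfl fun q hq => ?_
    have hc : X ((Y ^ q.2) (y q.1)) = (Y ^ q.2) (X (y q.1)) :=
      LinearMap.congr_fun (hXY.pow_right q.2).eq (y q.1)
    have hch : (m + 1).choose q.2 = (m + 1).choose q.1 := by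
      rw [HasAntidiagonal.mem_antidiagonal] at hq
      exact Nat.choose_symm_of_eq_add (by omega)
    have hY : (Y ^ q.2) (Y (y q.1)) = (Y ^ (q.2 + 1)) (y q.1) := by
      rw [pow_succ, Module.End.mul_apply]
    simp only [map_nsmul, map_smul, hc, hch, map_sub, hY]
    rw [← nsmul_add, ← nsmul_sub]
    congr 1
    rw [pow_succ, mul_smul]
    simp only [smul_sub]
    abel

-- The inner binomial coefficients are divisible by `p`. For the expansion above this leaves one
-- fully transported term and one `p`-fold commutator.
open Finset in
theorem sum_antidiagonal_char (p : ℕ) [hp : Fact p.Prime] [CharP F p] (f : ℕ → ℕ → T) :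
    ∑ q ∈ antidiagonal p, p.choose q.1 • f q.1 q.2 = f 0 p + f p 0 := by
  have hpos := hp.out.pos
  rw [← sum_subset (s₁ := {(0, p), (p, 0)})]
  · rw [sum_pair (by simp [hpos.ne])]
    simp
  · intro q hq
    simp only [mem_insert, mem_singleton] at hq
    rcases hq with rfl | rfl <;> simp
  · intro q hq hq'
    rw [HasAntidiagonal.mem_antidiagonal] at hq
    have h1 : q.1 ≠ 0 := fun h => hq' (by
      rw [show q = (0, p) from Prod.ext h (by simp; omega)]
      simp)
    have h2 : q.1 ≠ p := fun h => hq' (by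
      rw [show q = (p, 0) from Prod.ext h (by simp; omega)]
      simp)
    rw [← Nat.cast_smul_eq_nsmul F, (CharP.cast_eq_zero_iff F p _).mpr
      (hp.out.dvd_choose_self h1 (by omega)), zero_smul]

end Telescoping

end ColorLie

namespace ColorLie

open Module

/-- A basis of `L` consisting of elements which are homogeneous with respect to both gradings. -/
structure AdaptedBasis {p : ℕ} {F G L Λ : Type*} [Field F] [AddCommGroup G] [AddCommGroup L]
    [Module F L] {γ : CommutationFactor F G} (A : ColorLiePSuperalgebra p F L γ)
    (B : Λ → Submodule F L) (I : Type*) where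
  basis : Basis I F L
  colorDeg : I → G
  deg : I → Λ
  mem_comp : ∀ i, basis i ∈ A.comp (colorDeg i)
  mem_deg : ∀ i, basis i ∈ B (deg i)

/-! ### Words as a basis of the tensor algebra. -/

section Words

variable {F L I : Type*} [Field F] [AddCommGroup L] [Module F L]

/-- The basis of the tensor algebra consisting of the words in the elements of a basis. -/
noncomputable def wordBasis (b : Basis I F L) : Basis (List I) F (TensorAlgebra F L) :=
  b.tensorAlgebra.reindex FreeMonoid.toList

theorem wordBasis_apply (b : Basis I F L) (w : List I) :
    wordBasis b w = (w.map fun i => TensorAlgebra.ι F (b i)).prod := by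
  simp only [wordBasis, Basis.reindex_apply, Basis.tensorAlgebra, Basis.map_apply]
  have h : FreeAlgebra.basisFreeMonoid F I (FreeMonoid.toList.symm w) =
      FreeMonoid.lift (FreeAlgebra.ι F) (FreeMonoid.ofList w) := by
    simp [FreeAlgebra.basisFreeMonoid, FreeAlgebra.equivMonoidAlgebraFreeMonoid]
  rw [h, FreeMonoid.lift_ofList]
  simp [map_list_prod, Function.comp_def]

theorem wordBasis_append (b : Basis I F L) (u v : List I) :
    wordBasis b (u ++ v) = wordBasis b u * wordBasis b v := by
  simp [wordBasis_apply]

@[simp]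
theorem wordBasis_nil (b : Basis I F L) : wordBasis b [] = 1 := by
  simp [wordBasis_apply]

theorem wordBasis_cons (b : Basis I F L) (i : I) (v : List I) :
    wordBasis b (i :: v) = TensorAlgebra.ι F (b i) * wordBasis b v := by
  simp [wordBasis_apply]

theorem wordBasis_singleton (b : Basis I F L) (i : I) :
    wordBasis b [i] = TensorAlgebra.ι F (b i) := by
  simp [wordBasis_apply]

theorem wordBasis_replicate (b : Basis I F L) (n : ℕ) (i : I) :
    wordBasis b (List.replicate n i) = TensorAlgebra.ι F (b i) ^ n := by
  simp [wordBasis_apply]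

/-- Inserting a combination of letters into a word. -/
theorem wordBasis_mul_ι_mul_mem (b : Basis I F L) (s : Set I) {x : L}
    (hx : x ∈ Submodule.span F (b '' s)) (u v : List I) :
    wordBasis b u * TensorAlgebra.ι F x * wordBasis b v ∈
      Submodule.span F (wordBasis b '' {w | ∃ k ∈ s, w = u ++ [k] ++ v}) := by
  induction hx using Submodule.span_induction with
  | mem x hx =>
    obtain ⟨k, hk, rfl⟩ := hx
    refine Submodule.subset_span ⟨u ++ [k] ++ v, ⟨k, hk, rfl⟩, ?_⟩
    rw [wordBasis_append, wordBasis_append, wordBasis_singleton]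
  | zero => simp
  | add x y _ _ hx hy =>
    rw [map_add, mul_add, add_mul]
    exact add_mem hx hy
  | smul c x _ hx =>
    rw [map_smul, mul_smul_comm, smul_mul_assoc]
    exact Submodule.smul_mem _ _ hx

end Words

/-! ### Spans of relations located at restricted sets of words. -/

section Relations

variable {F L I : Type*} [Field F] [AddCommGroup L] [Module F L]
  {b : Basis I F L} {R : List I → TensorAlgebra F L → Prop} {P Q : List I → Prop}

/-- The span of the relations `u (w - f) v` over all rules `w → f` such that `u w v` has the
property `P`. -/
def relationSpan (b : Basis I F L) (R : List I → TensorAlgebra F L → Prop) (P : List I → Prop) :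
    Submodule F (TensorAlgebra F L) :=
  Submodule.span F (ruleElements (wordBasis b) R P)

theorem rule_mem_relationSpan {w : List I} {f : TensorAlgebra F L} (h : R w f) (hP : P w) :
    wordBasis b w - f ∈ relationSpan b R P :=
  Submodule.subset_span ⟨[], w, f, [], h, by simpa using hP, by simp⟩

theorem word_mul_mem_relationSpan {t : TensorAlgebra F L} (ht : t ∈ relationSpan b R P)
    (u : List I) (h : ∀ w, P w → Q (u ++ w)) : wordBasis b u * t ∈ relationSpan b R Q := by
  refine (Submodule.span_le (p := (relationSpan b R Q).comap (LinearMap.mulLeft F _))).mpr ?_ ht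
  rintro _ ⟨u₁, w, f, v, hR, hP, rfl⟩
  refine Submodule.subset_span ⟨u ++ u₁, w, f, v, hR, by simpa using h _ hP, ?_⟩
  simp [wordBasis_append, mul_assoc]

theorem mul_word_mem_relationSpan {t : TensorAlgebra F L} (ht : t ∈ relationSpan b R P)
    (v : List I) (h : ∀ w, P w → Q (w ++ v)) : t * wordBasis b v ∈ relationSpan b R Q := by
  refine (Submodule.span_le (p := (relationSpan b R Q).comap (LinearMap.mulRight F _))).mpr ?_ ht
  rintro _ ⟨u, w, f, v₁, hR, hP, rfl⟩
  refine Submodule.subset_span ⟨u, w, f, v₁ ++ v, hR, by simpa using h _ hP, ?_⟩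
  simp [wordBasis_append, mul_assoc]

theorem relationSpan_mono (h : ∀ w, P w → Q w) : relationSpan b R P ≤ relationSpan b R Q := by
  refine Submodule.span_mono ?_
  rintro _ ⟨u, w, f, v, hR, hP, rfl⟩
  exact ⟨u, w, f, v, hR, h _ hP, rfl⟩

end Relations

/-! ### The rewriting rules of the restricted enveloping algebra. -/

section Enveloping

variable {p : ℕ} {F G L Λ I : Type*} [Field F] [AddCommGroup G]
  [AddCommGroup L] [Module F L] {γ : CommutationFactor F G}
  {A : ColorLiePSuperalgebra p F L γ} {B : Λ → Submodule F L} [LinearOrder I]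

local notation "τ" => TensorAlgebra.ι F

/-- The rewriting rules `x_j x_i → γ x_i x_j + [x_j, x_i]` (`i < j`) and `x_i ^ p → x_i^[p]`. -/
inductive EnvelopingRule (b : AdaptedBasis A B I) : List I → TensorAlgebra F L → Prop
  | swap {i j : I} (h : i < j) : EnvelopingRule b [j, i]
      ((γ.toFun (b.colorDeg j) (b.colorDeg i) : F) • (τ (b.basis i) * τ (b.basis j)) +
        τ (A.bracket (b.basis j) (b.basis i)))
  | pow (i : I) : EnvelopingRule b (List.replicate p i) (τ (A.pmap (b.basis i)))

/-- The relations at words which are smaller than `w`. -/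
noncomputable def smallRelations (b : AdaptedBasis A B I) (w : List I) :
    Submodule F (TensorAlgebra F L) :=
  relationSpan b.basis (EnvelopingRule b) fun w' => List.Shortlex (· < ·) w' w

/-- The relations at words of length at most `n`. -/
noncomputable def shortRelations (b : AdaptedBasis A B I) (n : ℕ) :
    Submodule F (TensorAlgebra F L) :=
  relationSpan b.basis (EnvelopingRule b) fun w' => w'.length ≤ n

/-- Shortlex compares lengths first, so for terms that have lost a letter only the length needs to
be tracked. -/
theorem shortRelations_le (b : AdaptedBasis A B I) {n : ℕ} {w : List I} (h : n < w.length) :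
    shortRelations b n ≤ smallRelations b w :=
  relationSpan_mono fun _ hw => List.Shortlex.of_length_lt (hw.trans_lt h)

theorem word_mul_mem_shortRelations (b : AdaptedBasis A B I) {n m : ℕ} {t : TensorAlgebra F L}
    (ht : t ∈ shortRelations b n) (u : List I) (h : u.length + n ≤ m) :
    wordBasis b.basis u * t ∈ shortRelations b m :=
  word_mul_mem_relationSpan ht u fun w hw => by
    rw [List.length_append]
    omega

theorem mul_word_mem_shortRelations (b : AdaptedBasis A B I) {n m : ℕ} {t : TensorAlgebra F L}
    (ht : t ∈ shortRelations b n) (v : List I) (h : n + v.length ≤ m) :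
    t * wordBasis b.basis v ∈ shortRelations b m :=
  mul_word_mem_relationSpan ht v fun w hw => by
    rw [List.length_append]
    omega

theorem word_mul_mem_smallRelations (b : AdaptedBasis A B I) {w : List I} {t : TensorAlgebra F L}
    (ht : t ∈ smallRelations b w) (u : List I) :
    wordBasis b.basis u * t ∈ smallRelations b (u ++ w) :=
  word_mul_mem_relationSpan ht u fun _ hw => hw.append_left u

theorem mul_word_mem_smallRelations (b : AdaptedBasis A B I) {w : List I} {t : TensorAlgebra F L}
    (ht : t ∈ smallRelations b w) (v : List I) :
    t * wordBasis b.basis v ∈ smallRelations b (w ++ v) :=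
  mul_word_mem_relationSpan ht v fun _ hw => shortlex_append_right hw v

theorem swap_mem_smallRelations (b : AdaptedBasis A B I) {i j : I} (h : i < j) (u v : List I)
    {w : List I} (hw : List.Shortlex (· < ·) (u ++ [j, i] ++ v) w) :
    wordBasis b.basis u * (τ (b.basis j) * τ (b.basis i) -
      (γ.toFun (b.colorDeg j) (b.colorDeg i) : F) • (τ (b.basis i) * τ (b.basis j)) -
        τ (A.bracket (b.basis j) (b.basis i))) * wordBasis b.basis v ∈ smallRelations b w := by
  refine Submodule.subset_span ⟨u, [j, i], _, v, EnvelopingRule.swap h, hw, ?_⟩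
  simp [wordBasis_apply, sub_sub]

theorem pow_mem_smallRelations (b : AdaptedBasis A B I) (i : I) (u v : List I)
    {w : List I} (hw : List.Shortlex (· < ·) (u ++ List.replicate p i ++ v) w) :
    wordBasis b.basis u * (τ (b.basis i) ^ p - τ (A.pmap (b.basis i))) * wordBasis b.basis v ∈
      smallRelations b w := by
  refine Submodule.subset_span ⟨u, List.replicate p i, _, v, EnvelopingRule.pow i, hw, ?_⟩
  rw [wordBasis_replicate]

theorem CommutationFactor.mul_skew (γ : CommutationFactor F G) (g h : G) :
    (γ.toFun g h : F) * γ.toFun h g = 1 := by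
  rw [← Units.val_mul, γ.skew, Units.val_one]

theorem CommutationFactor.self_eq_one (hG : γ.pos = Set.univ) (g : G) : γ.toFun g g = 1 := by
  have : g ∈ γ.pos := hG ▸ Set.mem_univ g
  exact this

theorem CommutationFactor.map_nsmul_right (γ : CommutationFactor F G) (g h : G) (n : ℕ) :
    γ.toFun g (n • h) = γ.toFun g h ^ n := by
  induction n with
  | zero =>
    have := γ.map_add_right g 0 0
    simpa using this
  | succ n ih => rw [succ_nsmul, γ.map_add_right, ih, pow_succ]

theorem CommutationFactor.map_nsmul_left (γ : CommutationFactor F G) (g h : G) (n : ℕ) :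
    γ.toFun (n • g) h = γ.toFun g h ^ n := by
  induction n with
  | zero =>
    have := γ.map_add_left 0 0 h
    simpa using this
  | succ n ih => rw [succ_nsmul, γ.map_add_left, ih, pow_succ]

/-- The commutation relations of arbitrary homogeneous elements are consequences of the rules of
length two. -/
theorem commutation_mem_shortRelations (hG : γ.pos = Set.univ) (b : AdaptedBasis A B I) {g h : G}
    {x y : L} (hx : x ∈ A.comp g) (hy : y ∈ A.comp h) :
    τ x * τ y - (γ.toFun g h : F) • (τ y * τ x) - τ (A.bracket x y) ∈ shortRelations b 2 := by
  rw [A.isGrading.eq_span b.basis b.colorDeg b.mem_comp] at hx hy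
  induction hx using Submodule.span_induction with
  | zero => simp
  | add x x' _ _ hx hx' =>
    convert add_mem hx hx' using 1
    simp only [map_add, LinearMap.add_apply, add_mul, mul_add, smul_add]
    abel
  | smul c x _ hx =>
    convert Submodule.smul_mem _ c hx using 1
    simp only [map_smul, LinearMap.smul_apply, smul_mul_assoc, mul_smul_comm, smul_sub]
    rw [smul_comm c]
  | mem x hx =>
    obtain ⟨i, hi, rfl⟩ := hx
    induction hy using Submodule.span_induction with
    | zero => simp
    | add y y' _ _ hy hy' =>
      convert add_mem hy hy' using 1
      simp only [map_add, add_mul, mul_add, smul_add]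
      abel
    | smul c y _ hy =>
      convert Submodule.smul_mem _ c hy using 1
      simp only [map_smul, smul_mul_assoc, mul_smul_comm, smul_sub]
      rw [smul_comm c]
    | mem y hy =>
      obtain ⟨j, hj, rfl⟩ := hy
      have hi' : b.colorDeg i = g := hi
      have hj' : b.colorDeg j = h := hj
      subst hi' hj'
      have key : ∀ {i j : I}, i < j → τ (b.basis j) * τ (b.basis i) -
          (γ.toFun (b.colorDeg j) (b.colorDeg i) : F) • (τ (b.basis i) * τ (b.basis j)) -
          τ (A.bracket (b.basis j) (b.basis i)) ∈ shortRelations b 2 := by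
        intro i j hij
        refine Submodule.subset_span ⟨[], [j, i], _, [], EnvelopingRule.swap hij, by simp, ?_⟩
        simp [wordBasis_apply, sub_sub]
      -- For `i < j` the rule for `x_j x_i` is rescaled by `-γ(i, j)`; for `i = j` the relation is
      -- trivial, as `γ(g, g) = 1` and `[x, x] = 0`.
      rcases lt_trichotomy i j with hij | rfl | hij
      · convert Submodule.smul_mem _ (-(γ.toFun (b.colorDeg i) (b.colorDeg j) : F)) (key hij) using 1
        rw [A.bracket_skew (b.mem_comp i) (b.mem_comp j)]
        simp only [map_neg, map_smul, smul_sub, smul_smul, neg_mul, γ.mul_skew, neg_smul, one_smul]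
        abel
      · rw [A.bracket_self (hG ▸ Set.mem_univ _) (b.mem_comp i), CommutationFactor.self_eq_one hG]
        simp
      · exact key hij

end Enveloping

end ColorLie

namespace ColorLie

open Module

/-! ### Resolution of the overlaps. -/

section Ambiguities

variable {p : ℕ} {F G L Λ I : Type*} [Field F] [AddCommGroup G]
  [AddCommGroup L] [Module F L] {γ : CommutationFactor F G}
  {A : ColorLiePSuperalgebra p F L γ} {B : Λ → Submodule F L} [LinearOrder I]

local notation "τ" => TensorAlgebra.ι F

/-- Both ways of sorting `x_k x_j x_i` lead to the same ordered cubic word (`m1` to `m4`). The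
remaining products of a letter and a bracket cancel after commuting them (`s1` to `s3`), and the
leftover linear terms cancel by the Jacobi identity. -/
theorem swap_swap_mem (hG : γ.pos = Set.univ) (b : AdaptedBasis A B I) {i j k : I} (hij : i < j)
    (hjk : j < k) :
    ((γ.toFun (b.colorDeg k) (b.colorDeg j) : F) • (τ (b.basis j) * τ (b.basis k)) +
        τ (A.bracket (b.basis k) (b.basis j))) * τ (b.basis i) -
      τ (b.basis k) * ((γ.toFun (b.colorDeg j) (b.colorDeg i) : F) •
        (τ (b.basis i) * τ (b.basis j)) + τ (A.bracket (b.basis j) (b.basis i))) ∈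
      smallRelations b [k, j, i] := by
  have hle : shortRelations b 2 ≤ smallRelations b [k, j, i] := shortRelations_le b (by simp)
  have m1 := swap_mem_smallRelations b (hij.trans hjk) [j] [] (w := [k, j, i])
    (.of_lex rfl (.rel hjk))
  have m2 := swap_mem_smallRelations b hij [] [k] (w := [k, j, i])
    (.of_lex rfl (.rel hjk))
  have m3 := swap_mem_smallRelations b (hij.trans hjk) [] [j] (w := [k, j, i])
    (.of_lex rfl (.cons (.rel hij)))
  have m4 := swap_mem_smallRelations b hjk [i] [] (w := [k, j, i])
    (.of_lex rfl (.rel (hij.trans hjk)))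
  have s1 := hle (commutation_mem_shortRelations hG b
    (A.bracket_mem (b.mem_comp k) (b.mem_comp j)) (b.mem_comp i))
  have s2 := hle (commutation_mem_shortRelations hG b (b.mem_comp k)
    (A.bracket_mem (b.mem_comp j) (b.mem_comp i)))
  have s3 := Submodule.smul_mem _ (γ.toFun (b.colorDeg k) (b.colorDeg j) : F)
    (hle (commutation_mem_shortRelations hG b (b.mem_comp j)
      (A.bracket_mem (b.mem_comp k) (b.mem_comp i))))
  have hJ := congrArg τ (A.jacobi (b.basis i) (b.mem_comp k) (b.mem_comp j))
  rw [γ.map_add_left, Units.val_mul] at s1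
  rw [γ.map_add_right, Units.val_mul] at s2
  rw [γ.map_add_right, Units.val_mul, smul_sub, smul_sub, smul_smul, ← mul_assoc, γ.mul_skew,
    one_mul] at s3
  rw [map_add, map_smul] at hJ
  rw [hJ] at s2
  generalize (γ.toFun (b.colorDeg k) (b.colorDeg j) : F) = c₁ at *
  generalize (γ.toFun (b.colorDeg k) (b.colorDeg i) : F) = c₂ at *
  generalize (γ.toFun (b.colorDeg j) (b.colorDeg i) : F) = c₃ at *
  have := add_mem (sub_mem (add_mem (sub_mem (sub_mem (add_mem (Submodule.smul_mem _ c₁ m1)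
    (Submodule.smul_mem _ (c₁ * c₂) m2)) (Submodule.smul_mem _ c₃ m3))
    (Submodule.smul_mem _ (c₃ * c₂) m4)) s1) s2) s3
  convert this using 1
  simp only [wordBasis_singleton, wordBasis_nil, mul_one, one_mul, mul_sub, sub_mul, mul_add,
    add_mul, smul_mul_assoc, mul_smul_comm, mul_assoc]
  module

theorem iterate_bracket_mem {g h : G} {x y : L} (hx : x ∈ A.comp g) (hy : y ∈ A.comp h) (n : ℕ) :
    ((A.bracket x : Module.End F L) ^ n) y ∈ A.comp (n • g + h) := by
  induction n with
  | zero => simpa using hy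
  | succ n ih =>
    rw [pow_succ', Module.End.mul_apply]
    convert A.bracket_mem hx ih using 2
    rw [succ_nsmul]
    abel

variable [hp : Fact p.Prime]

/-- Two copies of the rule `x^p → x^{[p]}` overlapping in `x^{p+n}` ask that `x^{[p]}` commute with
`x^n`. It commutes with `x`, since `γ(pg, g) = 1` and `(ad x)^p x = 0`. -/
theorem pow_pow_mem (hG : γ.pos = Set.univ) (b : AdaptedBasis A B I) (i : I) (n : ℕ) :
    τ (A.pmap (b.basis i)) * τ (b.basis i) ^ n - τ (b.basis i) ^ n * τ (A.pmap (b.basis i)) ∈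
      smallRelations b (List.replicate (p + n) i) := by
  have hp1 := hp.out.one_lt
  refine shortRelations_le b (n := n + 1) (by simp; omega) ?_
  induction n with
  | zero => simp
  | succ n ih =>
    have h1 := mul_word_mem_shortRelations b ih [i] (m := n + 1 + 1) (by simp)
    have h2 := commutation_mem_shortRelations hG b
      (A.pmap_mem (hG ▸ Set.mem_univ _) (b.mem_comp i)) (b.mem_comp i)
    have h3 : ((A.bracket (b.basis i) : Module.End F L) ^ p) (b.basis i) = 0 := by
      obtain ⟨q, hq⟩ : ∃ q, p = q + 1 := ⟨p - 1, by omega⟩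
      simp only [hq, pow_succ, Module.End.mul_apply,
        A.bracket_self (hG ▸ Set.mem_univ _) (b.mem_comp i), map_zero]
    rw [A.bracket_pmap _ (hG ▸ Set.mem_univ _) (b.mem_comp i), h3, γ.map_nsmul_left,
      CommutationFactor.self_eq_one hG, one_pow, Units.val_one, one_smul, map_zero, sub_zero] at h2
    have h4 := word_mul_mem_shortRelations b h2 (List.replicate n i) (m := n + 1 + 1) (by simp)
    convert add_mem h1 h4 using 1
    rw [wordBasis_singleton, wordBasis_replicate, pow_succ]
    simp only [mul_sub, sub_mul, mul_assoc]
    abel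

variable [CharP F p]

/-- Let `y_k = (ad x_i)^k x_j`. Left multiplication by `x_i` acts on `y_k` as `c` times right
multiplication plus `y_k ↦ y_{k+1}`, with the same `c` for every `k` because `γ(g_i, g_i) = 1`. In
characteristic `p` the `p`-th iterate gives `c^p x_j x_i^p + y_p`, which is also what commuting
`x_i^{[p]}` past `x_j` gives. -/
theorem pow_swap_mem (hG : γ.pos = Set.univ) (b : AdaptedBasis A B I) {i j : I} (hji : j < i) :
    τ (A.pmap (b.basis i)) * τ (b.basis j) - τ (b.basis i) ^ (p - 1) *
      ((γ.toFun (b.colorDeg i) (b.colorDeg j) : F) • (τ (b.basis j) * τ (b.basis i)) +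
        τ (A.bracket (b.basis i) (b.basis j))) ∈
      smallRelations b (List.replicate p i ++ [j]) := by
  have hp1 := hp.out.one_lt
  set c : F := (γ.toFun (b.colorDeg i) (b.colorDeg j) : F) with hc
  set y : ℕ → TensorAlgebra F L :=
    fun n => τ (((A.bracket (b.basis i) : Module.End F L) ^ n) (b.basis j)) with hy
  have key := pow_apply_sub_sum_mem (F := F) (X := LinearMap.mulLeft F (τ (b.basis i)))
    (Y := LinearMap.mulRight F (τ (b.basis i))) (LinearMap.commute_mulLeft_right _ _) y c
    (fun m => smallRelations b (List.replicate (m + 1) i ++ [j])) (fun m t ht => by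
      have := word_mul_mem_smallRelations b ht [i]
      rwa [wordBasis_singleton] at this) (fun m k hk => by
      rw [LinearMap.pow_mulRight, LinearMap.mulRight_apply, LinearMap.mulLeft_apply,
        LinearMap.mulRight_apply, ← wordBasis_replicate]
      -- For `k = 0` the word has full length and is only lexicographically smaller; for `k > 0` the
      -- bracket has absorbed letters and the relation lives at shorter words.
      rcases k with _ | k
      · have := swap_mem_smallRelations b hji [] (List.replicate (m + 1) i)
          (w := List.replicate (m + 1 + 1) i ++ [j])
          (.of_lex (by simp) (.cons (.rel hji)))
        simpa [hy] using this
      · have hmem := commutation_mem_shortRelations hG b (b.mem_comp i)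
          (iterate_bracket_mem (b.mem_comp i) (b.mem_comp j) (k + 1))
        rw [γ.map_add_right, γ.map_nsmul_right, CommutationFactor.self_eq_one hG, one_pow, one_mul,
          ← Module.End.mul_apply, ← pow_succ'] at hmem
        refine shortRelations_le b (n := m + 2) (by simp)
          (mul_word_mem_shortRelations b hmem _ (by simp; omega))) (p - 1)
  rw [Nat.sub_add_cancel hp1.le, sum_antidiagonal_char (F := F) p
    (fun k n => c ^ n • (LinearMap.mulRight F (τ (b.basis i)) ^ n) (y k))] at key
  have h1 : τ (A.pmap (b.basis i)) * τ (b.basis j) - c ^ p • (τ (b.basis j) *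
      τ (A.pmap (b.basis i))) - y p ∈ smallRelations b (List.replicate p i ++ [j]) := by
    have := commutation_mem_shortRelations hG b
      (A.pmap_mem (hG ▸ Set.mem_univ _) (b.mem_comp i)) (b.mem_comp j)
    rw [A.bracket_pmap _ (hG ▸ Set.mem_univ _) (b.mem_comp i), γ.map_nsmul_left,
      Units.val_pow_eq_pow_val] at this
    exact shortRelations_le b (by simp; omega) this
  have h2 := pow_mem_smallRelations b i [j] [] (w := List.replicate p i ++ [j])
    (.of_lex (by simp) (by
      obtain ⟨q, rfl⟩ : ∃ q, p = q + 1 := ⟨p - 1, by omega⟩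
      exact .rel hji))
  convert sub_mem (sub_mem h1 (Submodule.smul_mem _ (c ^ p) h2)) key using 1
  simp only [LinearMap.pow_mulRight, LinearMap.pow_mulLeft, LinearMap.mulRight_apply,
    LinearMap.mulLeft_apply, wordBasis_singleton, wordBasis_nil, mul_one, hy, pow_zero,
    Module.End.one_apply, pow_one, one_smul, mul_sub, smul_sub]
  abel

/-- The mirror image of the previous overlap, with left and right multiplication exchanged. -/
theorem swap_pow_mem (hG : γ.pos = Set.univ) (b : AdaptedBasis A B I) {i j : I} (hij : i < j) :
    τ (b.basis j) * τ (A.pmap (b.basis i)) -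
      ((γ.toFun (b.colorDeg j) (b.colorDeg i) : F) • (τ (b.basis i) * τ (b.basis j)) +
        τ (A.bracket (b.basis j) (b.basis i))) * τ (b.basis i) ^ (p - 1) ∈
      smallRelations b ([j] ++ List.replicate p i) := by
  have hp1 := hp.out.one_lt
  set c : F := (γ.toFun (b.colorDeg j) (b.colorDeg i) : F) with hc
  -- `z n` is the iterated right bracket `[⋯[x_j, x_i], ⋯, x_i]`; each passage from a right to a
  -- left bracket costs a factor `-c`.
  set z : ℕ → L :=
    fun n => (-c) ^ n • ((A.bracket (b.basis i) : Module.End F L) ^ n) (b.basis j) with hz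
  have hzmem : ∀ n : ℕ, z n ∈ A.comp (n • b.colorDeg i + b.colorDeg j) := fun n =>
    Submodule.smul_mem _ _ (iterate_bracket_mem (b.mem_comp i) (b.mem_comp j) n)
  have hγ : ∀ n : ℕ, (γ.toFun (n • b.colorDeg i + b.colorDeg j) (b.colorDeg i) : F) = c := by
    intro n
    rw [γ.map_add_left, γ.map_nsmul_left, CommutationFactor.self_eq_one hG, one_pow, one_mul]
  have hzsucc : ∀ n, A.bracket (z n) (b.basis i) = z (n + 1) := by
    intro n
    rw [A.bracket_skew (hzmem n) (b.mem_comp i), hγ, hz]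
    simp only [map_smul, pow_succ' _ n, Module.End.mul_apply, mul_smul, neg_smul]
  set y : ℕ → TensorAlgebra F L := fun n => τ (z n) with hy
  have hz0 : z 0 = b.basis j := by simp [hz]
  have hy0 : y 0 = τ (b.basis j) := by rw [← hz0]
  have hy1 : y (0 + 1) = τ (A.bracket (b.basis j) (b.basis i)) := by
    rw [← hz0, hzsucc]
  have key := pow_apply_sub_sum_mem (F := F) (X := LinearMap.mulRight F (τ (b.basis i)))
    (Y := LinearMap.mulLeft F (τ (b.basis i))) (LinearMap.commute_mulLeft_right _ _).symm y c
    (fun m => smallRelations b ([j] ++ List.replicate (m + 1) i)) (fun m t ht => by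
      have := mul_word_mem_smallRelations b ht [i]
      rw [wordBasis_singleton, List.append_assoc, ← List.replicate_succ'] at this
      exact this) (fun m k hk => by
      rw [LinearMap.pow_mulLeft, LinearMap.mulLeft_apply, LinearMap.mulRight_apply,
        LinearMap.mulLeft_apply, ← wordBasis_replicate]
      rcases k with _ | k
      · have := swap_mem_smallRelations b hij (List.replicate (m + 1) i) []
          (w := [j] ++ List.replicate (m + 1 + 1) i)
          (.of_lex (by simp) (.rel hij))
        rw [hy1, hy0, Nat.sub_zero]
        simpa using this
      · have hmem := commutation_mem_shortRelations hG b (hzmem (k + 1)) (b.mem_comp i)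
        rw [hzsucc, hγ] at hmem
        refine shortRelations_le b (n := m + 2) (by simp)
          (word_mul_mem_shortRelations b hmem _ (by simp))) (p - 1)
  rw [Nat.sub_add_cancel hp1.le, sum_antidiagonal_char (F := F) p
    (fun k n => c ^ n • (LinearMap.mulLeft F (τ (b.basis i)) ^ n) (y k))] at key
  have h1 : τ (b.basis j) * τ (A.pmap (b.basis i)) - c ^ p • (τ (A.pmap (b.basis i)) *
      τ (b.basis j)) - y p ∈ smallRelations b ([j] ++ List.replicate p i) := by
    have hpm := A.pmap_mem (hG ▸ Set.mem_univ _) (b.mem_comp i)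
    have := commutation_mem_shortRelations hG b (b.mem_comp j) hpm
    rw [A.bracket_skew (b.mem_comp j) hpm, A.bracket_pmap _ (hG ▸ Set.mem_univ _) (b.mem_comp i),
      γ.map_nsmul_right, Units.val_pow_eq_pow_val, ← hc] at this
    -- `(-c)^p = -c^p` in characteristic `p`, including `p = 2`; this is the sign produced by
    -- skew-symmetry of `[x_j, x_i^{[p]}]`.
    have h : y p = τ (-(c ^ p • ((A.bracket (b.basis i) : Module.End F L) ^ p) (b.basis j))) := by
      simp only [hy, hz, neg_pow c, neg_one_pow_char F p, neg_mul, one_mul, neg_smul]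
    rw [h]
    exact shortRelations_le b (by simp; omega) this
  have h2 := pow_mem_smallRelations b i [] [j] (w := [j] ++ List.replicate p i)
    (.of_lex (by simp) (by
      obtain ⟨q, rfl⟩ : ∃ q, p = q + 1 := ⟨p - 1, by omega⟩
      exact .rel hij))
  convert sub_mem (sub_mem h1 (Submodule.smul_mem _ (c ^ p) h2)) key using 1
  rw [zero_add] at hy1
  rw [hy1]
  simp only [LinearMap.pow_mulRight, LinearMap.pow_mulLeft, LinearMap.mulRight_apply,
    LinearMap.mulLeft_apply, wordBasis_singleton, wordBasis_nil, one_mul, hy0, pow_zero,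
    sub_mul, smul_sub, one_smul, Module.End.one_apply]
  abel

end Ambiguities

end ColorLie

namespace ColorLie

open Module

/-! ### Termination, homogeneity and confluence of the rules. -/

section Confluence

variable {p : ℕ} {F G L Λ I : Type*} [Field F] [AddCommGroup G]
  [AddCommGroup L] [Module F L] {γ : CommutationFactor F G}
  {A : ColorLiePSuperalgebra p F L γ} [AddCommSemigroup Λ] {B : Λ → Submodule F L}

local notation "τ" => TensorAlgebra.ι F

/-- The degree of a word. -/
def AdaptedBasis.wordDeg (b : AdaptedBasis A B I) (w : List I) : WithZero Λ :=
  (w.map fun i => (b.deg i : WithZero Λ)).sum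

theorem AdaptedBasis.wordDeg_append (b : AdaptedBasis A B I) (u v : List I) :
    b.wordDeg (u ++ v) = b.wordDeg u + b.wordDeg v := by
  simp [wordDeg]

theorem exists_coe_eq_nsmul {Λ : Type*} [AddCommSemigroup Λ] {n : ℕ} (hn : n ≠ 0) (l : Λ) :
    ∃ m : Λ, (m : WithZero Λ) = n • (l : WithZero Λ) := by
  induction n with
  | zero => exact absurd rfl hn
  | succ n ih =>
    rcases eq_or_ne n 0 with rfl | h
    · exact ⟨l, by simp⟩
    · obtain ⟨m, hm⟩ := ih h
      exact ⟨m + l, by rw [WithZero.coe_add, hm, succ_nsmul]⟩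

variable [LinearOrder I]

/-- A swap lowers the first letter it changes, while brackets and `p`-th powers contract at least
two letters to one, so words decrease. Degrees are kept because the bracket and the `p`-map respect
the `Λ`-grading. The two facts serve termination and the grading of `u(L)` together. -/
theorem rule_mem_span {κ : Λ →ₙ+ Additive ℤˣ} [hp : Fact p.Prime] (hG : γ.pos = Set.univ)
    (hB : A.IsSemigroupGraded κ B) (b : AdaptedBasis A B I) (u v : List I) {w : List I}
    {f : TensorAlgebra F L} (h : EnvelopingRule b w f) :
    wordBasis b.basis u * f * wordBasis b.basis v ∈
      Submodule.span F (wordBasis b.basis '' {w' | List.Shortlex (· < ·) w' (u ++ w ++ v) ∧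
        b.wordDeg w' = b.wordDeg (u ++ w ++ v)}) := by
  have key : ∀ {w : List I} {l : Λ} {x : L}, x ∈ B l → 1 < w.length → b.wordDeg w = l →
      wordBasis b.basis u * τ x * wordBasis b.basis v ∈
      Submodule.span F (wordBasis b.basis '' {w' | List.Shortlex (· < ·) w' (u ++ w ++ v) ∧
        b.wordDeg w' = b.wordDeg (u ++ w ++ v)}) := by
    intro w l x hx hw hl
    rw [hB.isGrading.eq_span b.basis b.deg b.mem_deg] at hx
    refine Submodule.span_mono (Set.image_mono ?_) (wordBasis_mul_ι_mul_mem b.basis _ hx u v)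
    rintro _ ⟨k, hk, rfl⟩
    have hk' : b.deg k = l := hk
    refine ⟨shortlex_append (.of_length_lt (by simpa using hw)) u v, ?_⟩
    rw [b.wordDeg_append, b.wordDeg_append, b.wordDeg_append, b.wordDeg_append, hl, ← hk']
    simp [AdaptedBasis.wordDeg]
  cases h with
  | @swap i j hij =>
    rw [mul_add, add_mul]
    refine add_mem ?_ (key (hB.bracket_mem (b.mem_deg j) (b.mem_deg i)) (by simp)
      (by simp [AdaptedBasis.wordDeg]))
    rw [mul_smul_comm, smul_mul_assoc]
    refine Submodule.smul_mem _ _ (Submodule.subset_span ⟨u ++ [i, j] ++ v, ⟨?_, ?_⟩, ?_⟩)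
    · exact shortlex_append (s := [i, j]) (t := [j, i]) (.of_lex rfl (.rel hij)) u v
    · simp only [b.wordDeg_append]
      simp [AdaptedBasis.wordDeg, add_comm]
    · simp [wordBasis_apply, mul_assoc]
  | pow i =>
    obtain ⟨m, hm⟩ := exists_coe_eq_nsmul hp.out.ne_zero (b.deg i)
    refine key (hB.pmap_mem (hG ▸ Set.mem_univ _) (b.mem_comp i) (b.mem_deg i) hm)
      (by simpa using hp.out.one_lt) ?_
    simp [AdaptedBasis.wordDeg, hm]

section Local

variable {κ : Λ →ₙ+ Additive ℤˣ} [hp : Fact p.Prime]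

/-- Rules applied at disjoint places commute: the difference is `f d (w' - f') v - (w - f) d f' v`,
and `f`, `f'` consist of words smaller than `w`, `w'`. -/
theorem disjoint_mem (hG : γ.pos = Set.univ) (hB : A.IsSemigroupGraded κ B)
    (b : AdaptedBasis A B I) {w w' : List I} {f f' : TensorAlgebra F L} (h : EnvelopingRule b w f)
    (h' : EnvelopingRule b w' f') (d v : List I) :
    f * wordBasis b.basis (d ++ w' ++ v) - wordBasis b.basis (w ++ d) * f' * wordBasis b.basis v ∈
      smallRelations b (w ++ d ++ w' ++ v) := by
  have hs : ∀ {w : List I} {f : TensorAlgebra F L}, EnvelopingRule b w f → f ∈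
      Submodule.span F (wordBasis b.basis '' {x | List.Shortlex (· < ·) x w}) := by
    intro w f h
    have := rule_mem_span hG hB b [] [] h
    simp only [wordBasis_nil, one_mul, mul_one, List.nil_append, List.append_nil] at this
    exact Submodule.span_mono (Set.image_mono fun x hx => hx.1) this
  have h1 : ∀ t ∈ Submodule.span F (wordBasis b.basis '' {x | List.Shortlex (· < ·) x w}),
      t * (wordBasis b.basis d * (wordBasis b.basis w' - f') * wordBasis b.basis v) ∈
        smallRelations b (w ++ d ++ w' ++ v) := by
    intro t ht
    induction ht using Submodule.span_induction with
    | zero => simp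
    | add x y _ _ hx hy => rw [add_mul]; exact add_mem hx hy
    | smul c x _ hx => rw [smul_mul_assoc]; exact Submodule.smul_mem _ _ hx
    | mem x hx =>
      obtain ⟨x, hx, rfl⟩ := hx
      refine Submodule.subset_span ⟨x ++ d, w', f', v, h', ?_, ?_⟩
      · simpa using shortlex_append_right hx (d ++ w' ++ v)
      · rw [wordBasis_append]
        simp only [mul_assoc]
  have h2 : ∀ t ∈ Submodule.span F (wordBasis b.basis '' {x | List.Shortlex (· < ·) x w'}),
      (wordBasis b.basis w - f) * wordBasis b.basis d * t * wordBasis b.basis v ∈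
        smallRelations b (w ++ d ++ w' ++ v) := by
    intro t ht
    induction ht using Submodule.span_induction with
    | zero => simp
    | add x y _ _ hx hy => rw [mul_add, add_mul]; exact add_mem hx hy
    | smul c x _ hx => rw [mul_smul_comm, smul_mul_assoc]; exact Submodule.smul_mem _ _ hx
    | mem x hx =>
      obtain ⟨x, hx, rfl⟩ := hx
      refine Submodule.subset_span ⟨[], w, f, d ++ x ++ v, h, ?_, ?_⟩
      · simpa using shortlex_append hx (w ++ d) v
      · rw [wordBasis_append, wordBasis_append]
        simp only [mul_assoc, wordBasis_nil, one_mul]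
  convert sub_mem (h1 f (hs h)) (h2 f' (hs h')) using 1
  simp only [wordBasis_append, mul_sub, sub_mul, mul_assoc]
  abel

variable [CharP F p]

/-- The second left-hand side starts after the prefix `d`. Either it is disjoint from the first one,
or they share a nonempty word `c`, and the shapes of the two rules leave only the overlaps resolved
above, the identical swap, and contradictions. -/
theorem overlap_mem (hG : γ.pos = Set.univ) (hB : A.IsSemigroupGraded κ B)
    (b : AdaptedBasis A B I) {w w' : List I} {f f' : TensorAlgebra F L} (h : EnvelopingRule b w f)
    (h' : EnvelopingRule b w' f') (d v v' : List I) (e : w ++ v = d ++ (w' ++ v')) :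
    f * wordBasis b.basis v - wordBasis b.basis d * f' * wordBasis b.basis v' ∈
      smallRelations b (w ++ v) := by
  -- As `p ≥ 2`, a block `x_k^p` shows two equal letters, so it cannot start at the same place as a
  -- swap.
  obtain ⟨q, hq⟩ : ∃ q, p = q + 1 + 1 := ⟨p - 2, by have := hp.out.two_le; omega⟩
  have hdisj : ∀ d', d = w ++ d' → v = d' ++ (w' ++ v') →
      f * wordBasis b.basis v - wordBasis b.basis d * f' * wordBasis b.basis v' ∈
      smallRelations b (w ++ v) := by
    rintro d' rfl rfl
    have := disjoint_mem hG hB b h h' d' v'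
    rw [List.append_assoc d'] at this
    convert this using 2
    simp
  rcases List.append_eq_append_iff.mp e with ⟨d', h1, h2⟩ | ⟨c, hw, hv⟩
  · exact hdisj d' h1 h2
  cases h with
  | @swap i j hij =>
    match d, hw, e with
    | [], hw, e =>
      obtain rfl : [j, i] = c := hw
      cases h' with
      | @swap i' j' hij' =>
        simp only [List.cons_append, List.nil_append, List.cons.injEq] at hv
        obtain ⟨rfl, rfl, rfl⟩ := hv
        simp
      | pow k =>
        simp only [hq, List.replicate_succ, List.cons_append, List.nil_append,
          List.cons.injEq] at hv
        obtain ⟨rfl, rfl, -⟩ := hv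
        exact absurd hij (lt_irrefl _)
    | [x], hw, e =>
      simp only [List.cons_append, List.nil_append, List.cons.injEq] at hw
      obtain ⟨rfl, rfl⟩ := hw
      cases h' with
      | @swap i' j' hij' =>
        simp only [List.cons_append, List.nil_append, List.cons.injEq] at hv
        obtain ⟨rfl, rfl⟩ := hv
        have := mul_word_mem_smallRelations b (swap_swap_mem hG b hij' hij) v'
        change _ ∈ smallRelations b ([j, j', i'] ++ v')
        convert this using 1
        rw [wordBasis_cons, wordBasis_singleton]
        simp only [sub_mul, mul_assoc]
      | pow k =>
        have hv' : i = k ∧ v = List.replicate (p - 1) k ++ v' := by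
          have hr : List.replicate p k = k :: List.replicate (p - 1) k := by
            conv_lhs => rw [show p = (p - 1) + 1 by omega]
            rfl
          rw [hr] at hv
          simp only [List.cons_append, List.nil_append, List.cons.injEq] at hv
          exact ⟨hv.1.symm, hv.2.symm⟩
        obtain ⟨rfl, rfl⟩ := hv'
        have := neg_mem (mul_word_mem_smallRelations b (swap_pow_mem hG b hij) v')
        have hr : [j, i] ++ (List.replicate (p - 1) i ++ v') = [j] ++ List.replicate p i ++ v' := by
          conv_rhs => rw [show p = (p - 1) + 1 by omega]
          simp [List.replicate_succ]
        rw [hr]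
        convert this using 1
        rw [wordBasis_append, wordBasis_singleton, wordBasis_replicate]
        simp only [sub_mul, mul_assoc, neg_sub]
    | x :: y :: d', hw, e =>
      simp only [List.cons_append, List.cons.injEq] at hw
      obtain ⟨rfl, rfl, hw⟩ := hw
      obtain ⟨rfl, rfl⟩ := List.nil_eq_append_iff.mp hw
      exact hdisj [] rfl (by simpa using hv.symm)
  | pow k =>
    obtain ⟨hlen, hd, hc⟩ := List.append_eq_replicate_iff.mp hw.symm
    rcases c with _ | ⟨x, c⟩
    · exact hdisj [] (by simpa using hw.symm) (by simpa using hv.symm)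
    obtain rfl : x = k := (List.eq_replicate_iff.mp hc).2 x (by simp)
    cases h' with
    | @swap i' j' hij' =>
      simp only [List.cons_append, List.nil_append, List.cons.injEq] at hv
      obtain ⟨rfl, hv⟩ := hv
      rcases c with _ | ⟨y, c⟩
      · obtain rfl : v = i' :: v' := by simpa using hv.symm
        have hdl : d.length = p - 1 := by simp at hlen; omega
        rw [hdl] at hd
        subst hd
        have := mul_word_mem_smallRelations b (pow_swap_mem hG b hij') v'
        rw [List.append_assoc] at this
        change _ ∈ smallRelations b (List.replicate p j' ++ ([i'] ++ v'))
        convert this using 1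
        rw [wordBasis_cons, wordBasis_replicate]
        simp only [sub_mul, mul_assoc]
      · obtain rfl : y = j' := (List.eq_replicate_iff.mp hc).2 y (by simp)
        simp only [List.cons_append, List.cons.injEq] at hv
        exact absurd hij' (hv.1 ▸ lt_irrefl _)
    | pow k' =>
      have hk : k' = x := by
        have := congrArg List.head? hv
        simpa [hq, List.replicate_succ] using this
      subst hk
      have hv' : v = List.replicate d.length k' ++ v' := by
        have : List.replicate p k' =
            List.replicate (k' :: c).length k' ++ List.replicate d.length k' := by
          rw [← List.replicate_add]
          congr 1
          omega
        rw [this, ← hc, List.append_assoc] at hv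
        exact (List.append_cancel_left hv).symm
      subst hv'
      have := mul_word_mem_smallRelations b (pow_pow_mem hG b k' d.length) v'
      rw [List.replicate_add, List.append_assoc] at this
      convert this using 1
      rw [hd]
      simp only [wordBasis_append, wordBasis_replicate, sub_mul, mul_assoc, List.length_replicate]

/-- The normal form projection of the tensor algebra onto the span of the irreducible words. -/
theorem exists_normalForm_enveloping [WellFoundedLT I] (hG : γ.pos = Set.univ)
    (hB : A.IsSemigroupGraded κ B) (b : AdaptedBasis A B I) :
    ∃ N : TensorAlgebra F L →ₗ[F] TensorAlgebra F L,
      (∀ w, IsIrreducible (EnvelopingRule b) w → N (wordBasis b.basis w) = wordBasis b.basis w) ∧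
      ∀ t ∈ relationSpan b.basis (EnvelopingRule b) fun _ => True, N t = 0 := by
  refine exists_normalForm (wordBasis b.basis) (EnvelopingRule b)
    (List.Shortlex.wf (wellFounded_lt (α := I))) (fun u w f v h => ?_) ?_ (wordBasis_append _)
  · exact Submodule.span_mono (Set.image_mono fun x hx => hx.1) (rule_mem_span hG hB b u v h)
  have key : ∀ u w f v u' w' f' v', EnvelopingRule b w f → EnvelopingRule b w' f' →
      u ++ w ++ v = u' ++ w' ++ v' → (∃ d, u' = u ++ d ∧ w ++ v = d ++ (w' ++ v')) →
      wordBasis b.basis u * f * wordBasis b.basis v -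
        wordBasis b.basis u' * f' * wordBasis b.basis v' ∈ smallRelations b (u ++ w ++ v) := by
    rintro u w f v _ w' f' v' h h' - ⟨d, rfl, hd⟩
    have := word_mul_mem_smallRelations b (overlap_mem hG hB b h h' d v v' hd) u
    rw [← List.append_assoc] at this
    convert this using 1
    simp only [wordBasis_append, mul_sub, mul_assoc]
  intro u w f v u' w' f' v' h h' e
  have e' := e
  rw [List.append_assoc, List.append_assoc] at e'
  -- Up to sign the situation is symmetric, so the first rule may be taken to start no later than
  -- the second.
  rcases List.append_eq_append_iff.mp e' with ⟨d, h1, h2⟩ | ⟨d, h1, h2⟩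
  · exact key u w f v u' w' f' v' h h' e ⟨d, h1, h2⟩
  · have := neg_mem (key u' w' f' v' u w f v h' h e.symm ⟨d, h1, h2⟩)
    rw [neg_sub, ← e] at this
    exact this

end Local

end Confluence

end ColorLie

namespace ColorLie

/-! ### Jacobson's formula for `(x + y)^p`. -/

section JacobsonFormula

open Finset Polynomial

/-- Neighbouring coefficients in row `p - 1` add up to an inner coefficient of row `p`, which
vanishes. -/
theorem cast_choose_pred_prime {R : Type*} [Ring R] (p : ℕ) [hp : Fact p.Prime] [CharP R p] {k : ℕ}
    (hk : k ≤ p - 1) : ((p - 1).choose k : R) = (-1) ^ k := by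
  induction k with
  | zero => simp
  | succ k ih =>
    have h1 : p.choose (k + 1) = (p - 1).choose k + (p - 1).choose (k + 1) :=
      Nat.choose_eq_choose_pred_add hp.out.pos k.succ_pos
    have h2 : ((p.choose (k + 1) : ℕ) : R) = 0 :=
      (CharP.cast_eq_zero_iff R p _).mpr (hp.out.dvd_choose_self k.succ_ne_zero (by omega))
    rw [h1, Nat.cast_add, ih (by omega)] at h2
    rw [pow_succ, mul_neg_one]
    exact eq_neg_of_add_eq_zero_right h2

/-- The signs of the binomial coefficients cancel those of `(-b)^k`. With left and right
multiplication by `Z` as `a` and `b`, this gives `(ad Z)^{p-1}(x) = ∑ Z^i x Z^{p-1-i}`. -/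
theorem sub_pow_pred_char {R : Type*} [Ring R] (p : ℕ) [hp : Fact p.Prime] [CharP R p] {a b : R}
    (h : Commute a b) :
    (a - b) ^ (p - 1) = ∑ q ∈ antidiagonal (p - 1), a ^ q.1 * b ^ q.2 := by
  rw [sub_eq_neg_add, (h.symm.neg_left).add_pow', ← Nat.sum_antidiagonal_swap]
  refine sum_congr rfl fun q hq => ?_
  rw [HasAntidiagonal.mem_antidiagonal] at hq
  rw [← Nat.cast_smul_eq_nsmul R, Prod.fst_swap, Prod.snd_swap,
    cast_choose_pred_prime p (by omega), neg_pow b, smul_eq_mul, ← mul_assoc, ← mul_assoc, ← pow_add,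
    Even.neg_one_pow ⟨_, rfl⟩, one_mul, (h.pow_pow q.1 q.2).eq]

theorem derivative_pow_noncomm {R : Type*} [Semiring R] (f : R[X]) (n : ℕ) :
    derivative (f ^ (n + 1)) = ∑ q ∈ antidiagonal n, f ^ q.1 * derivative f * f ^ q.2 := by
  induction n with
  | zero => simp
  | succ n ih =>
    rw [pow_succ' f (n + 1), derivative_mul, ih, Nat.sum_antidiagonal_succ, mul_sum]
    simp only [pow_zero, one_mul, pow_succ', mul_assoc]

variable {F L U : Type*} [Field F] [AddCommGroup L] [Module F L] [Ring U] [Algebra F U]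

/-- The coefficients of `ad (t x + y) ^ m (x)` computed in a Lie algebra and in an associative
algebra agree. -/
theorem coeff_ad_pow_apply (ad : L →ₗ[F] Module.End F L) (j : L →ₗ[F] U) (N : Submodule F L)
    {x y : L} (hxN : x ∈ N)
    (hx : ∀ z ∈ N, ad x z ∈ N ∧ j (ad x z) = j x * j z - j z * j x)
    (hy : ∀ z ∈ N, ad y z ∈ N ∧ j (ad y z) = j y * j z - j z * j y) (m n : ℕ) :
    ((X * C (ad x) + C (ad y) : (Module.End F L)[X]) ^ m).coeff n x ∈ N ∧
      j (((X * C (ad x) + C (ad y) : (Module.End F L)[X]) ^ m).coeff n x) =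
      (((LinearMap.mulLeft F (X * C (j x) + C (j y)) -
        LinearMap.mulRight F (X * C (j x) + C (j y)) : Module.End F U[X]) ^ m) (C (j x))).coeff n := by
  induction m generalizing n with
  | zero =>
    rcases n with _ | n
    · simpa using hxN
    · simp [coeff_one]
  | succ m ih =>
    rw [pow_succ', pow_succ', Module.End.mul_apply]
    generalize ((X * C (ad x) + C (ad y) : (Module.End F L)[X]) ^ m) = P at *
    generalize (((LinearMap.mulLeft F (X * C (j x) + C (j y)) -
        LinearMap.mulRight F (X * C (j x) + C (j y)) : Module.End F U[X]) ^ m) (C (j x))) = Q at *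
    rw [LinearMap.sub_apply, LinearMap.mulLeft_apply, LinearMap.mulRight_apply, add_mul, add_mul,
      mul_add, mul_assoc, mul_assoc, ← mul_assoc Q, ← X_mul (p := Q), mul_assoc]
    rcases n with _ | n
    · simp only [coeff_add, coeff_sub, mul_coeff_zero, coeff_X_zero, zero_mul, coeff_C_zero,
        zero_add, Module.End.mul_apply, ← (ih 0).2]
      exact hy _ (ih 0).1
    · simp only [coeff_add, coeff_sub, coeff_X_mul, coeff_C_mul, coeff_mul_C, LinearMap.add_apply,
        Module.End.mul_apply, ← (ih _).2, map_add]
      refine ⟨add_mem (hx _ (ih n).1).1 (hy _ (ih _).1).1, ?_⟩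
      rw [(hx _ (ih n).1).2, (hy _ (ih _).1).2]
      abel

/-- Jacobson's formula for the `p`-th power of a sum. -/
theorem add_pow_char_eq_jacobson (p : ℕ) [hp : Fact p.Prime] [CharP F p]
    (ad : L →ₗ[F] Module.End F L) (j : L →ₗ[F] U) (N : Submodule F L) {x y : L} (hxN : x ∈ N)
    (hx : ∀ z ∈ N, ad x z ∈ N ∧ j (ad x z) = j x * j z - j z * j x)
    (hy : ∀ z ∈ N, ad y z ∈ N ∧ j (ad y z) = j y * j z - j z * j y) :
    (j x + j y) ^ p = j x ^ p + j y ^ p +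
      ∑ i ∈ Icc 1 (p - 1), j (jacobsonTerm p ad i x y) := by
  have hp1 := hp.out.one_lt
  rcases subsingleton_or_nontrivial U with _ | _
  · exact Subsingleton.elim _ _
  set Z : U[X] := X * C (j x) + C (j y) with hZ
  -- The noncommutative Leibniz rule gives `∑ Z^i Z' Z^{p-1-i}`, that is, `(ad Z)^{p-1}(Z')` with
  -- `Z' = j x`.
  have hder : derivative (Z ^ p) = ((LinearMap.mulLeft F Z - LinearMap.mulRight F Z : Module.End F U[X]) ^ (p - 1))
      (C (j x)) := by
    have : CharP (Module.End F U[X]) p := charP_of_injective_algebraMap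
      (FaithfulSMul.algebraMap_injective F (Module.End F U[X])) p
    rw [sub_pow_pred_char p (LinearMap.commute_mulLeft_right Z Z), LinearMap.sum_apply]
    have : Z ^ p = Z ^ (p - 1 + 1) := by rw [Nat.sub_add_cancel hp1.le]
    rw [this, derivative_pow_noncomm]
    refine sum_congr rfl fun q _ => ?_
    rw [LinearMap.pow_mulLeft, LinearMap.pow_mulRight, Module.End.mul_apply,
      LinearMap.mulRight_apply, LinearMap.mulLeft_apply, mul_assoc]
    simp [hZ]
  -- The coefficient of the derivative at `i - 1` is `i` times that of `Z^p` at `i`, and `i` is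
  -- invertible for `0 < i < p`.
  have hcoeff : ∀ i ∈ Icc 1 (p - 1), (Z ^ p).coeff i = j (jacobsonTerm p ad i x y) := by
    intro i hi
    rw [mem_Icc] at hi
    have h := (coeff_ad_pow_apply ad j N hxN hx hy (p - 1) (i - 1)).2
    rw [← hder, coeff_derivative, ← Nat.cast_succ, ← Nat.cast_commute, ← nsmul_eq_mul,
      ← Nat.cast_smul_eq_nsmul F, Nat.succ_eq_add_one, Nat.sub_add_cancel hi.1] at h
    rw [jacobsonTerm, map_smul, h, smul_smul, inv_mul_cancel₀, one_smul]
    rw [Ne, CharP.cast_eq_zero_iff F p]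
    exact fun hd => absurd (Nat.le_of_dvd (by omega) hd) (by omega)
  have hdeg : Z.natDegree ≤ 1 := by
    rw [hZ]
    compute_degree
  have hdegp : (Z ^ p).natDegree < p + 1 := by
    have := natDegree_pow_le_of_le p hdeg
    omega
  have htop : (Z ^ p).coeff p = j x ^ p := by
    have := coeff_pow_of_natDegree_le hdeg (m := p)
    rw [mul_one] at this
    rw [this]
    simp [hZ, coeff_C]
  have hbot : (Z ^ p).coeff 0 = j y ^ p := by
    rw [← constantCoeff_apply, map_pow]
    simp [hZ]
  -- Evaluation over a noncommutative ring is multiplicative at `1`, because `1` is central.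
  have heval : eval 1 (Z ^ p) = (j x + j y) ^ p := by
    have : ∀ f : U[X], eval 1 f = eval₂RingHom' (RingHom.id U) 1 (fun a => Commute.one_right a) f :=
      fun f => rfl
    rw [this, map_pow, ← this]
    simp [hZ]
  have hIcc : Icc 1 (p - 1) = Ico 1 p := by
    ext i
    rw [mem_Icc, mem_Ico]
    omega
  rw [← heval, eval_eq_sum_range' hdegp, sum_range_succ]
  simp only [one_pow, mul_one]
  rw [range_eq_Ico, sum_eq_sum_Ico_succ_bot hp.out.pos, hbot, htop, zero_add, ← hIcc,
    sum_congr rfl hcoeff]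
  abel

end JacobsonFormula

end ColorLie

namespace ColorLie

open Module

/-! ### The Poincaré–Birkhoff–Witt theorem. -/

section PBW

variable {p : ℕ} {F G L Λ I : Type*} [Field F] [AddCommGroup G]
  [AddCommGroup L] [Module F L] {γ : CommutationFactor F G}
  {A : ColorLiePSuperalgebra p F L γ} {B : Λ → Submodule F L} [LinearOrder I]

local notation "τ" => TensorAlgebra.ι F

/-- The defining relations of the enveloping algebra for the elements of a basis of `L`. -/
def BasisRel (b : AdaptedBasis A B I) (s t : TensorAlgebra F L) : Prop :=
  ∃ w, s = wordBasis b.basis w ∧ EnvelopingRule b w t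

theorem algHom_eq_zero_of_mem {U : Type*} [Ring U] [Algebra F U] (b : AdaptedBasis A B I)
    (φ : TensorAlgebra F L →ₐ[F] U)
    (hφ : ∀ w t, EnvelopingRule b w t → φ (wordBasis b.basis w) = φ t) {P : List I → Prop}
    {t : TensorAlgebra F L} (ht : t ∈ relationSpan b.basis (EnvelopingRule b) P) : φ t = 0 := by
  refine (Submodule.span_le (p := LinearMap.ker φ.toLinearMap)).mpr ?_ ht
  rintro _ ⟨u, w, f, v, hR, -, rfl⟩
  simp [hφ w f hR]

theorem mkAlgHom_eq_zero_of_mem (b : AdaptedBasis A B I) {P : List I → Prop}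
    {t : TensorAlgebra F L} (ht : t ∈ relationSpan b.basis (EnvelopingRule b) P) :
    RingQuot.mkAlgHom F (BasisRel b) t = 0 :=
  algHom_eq_zero_of_mem b _ (fun w _ h => RingQuot.mkAlgHom_rel F ⟨w, rfl, h⟩) ht

theorem mul_mul_mem_relationSpan (b : AdaptedBasis A B I) (s s' : TensorAlgebra F L)
    {t : TensorAlgebra F L}
    (ht : t ∈ relationSpan b.basis (EnvelopingRule b) fun _ => True) :
    s * t * s' ∈ relationSpan b.basis (EnvelopingRule b) fun _ => True := by
  have h1 : s * t ∈ relationSpan b.basis (EnvelopingRule b) fun _ => True := by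
    have hs := (wordBasis b.basis).mem_span s
    induction hs using Submodule.span_induction with
    | zero => simp
    | add x y _ _ hx hy => rw [add_mul]; exact add_mem hx hy
    | smul c x _ hx => rw [smul_mul_assoc]; exact Submodule.smul_mem _ _ hx
    | mem x hx =>
      obtain ⟨w, rfl⟩ := hx
      exact word_mul_mem_relationSpan ht w fun _ _ => trivial
  have hs := (wordBasis b.basis).mem_span s'
  induction hs using Submodule.span_induction with
  | zero => simp
  | add x y _ _ hx hy => rw [mul_add]; exact add_mem hx hy
  | smul c x _ hx => rw [mul_smul_comm]; exact Submodule.smul_mem _ _ hx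
  | mem x hx =>
    obtain ⟨w, rfl⟩ := hx
    exact mul_word_mem_relationSpan h1 w fun _ _ => trivial

/-- The relation span is a two-sided ideal, so it absorbs every step generating the congruence of
the quotient. Hence a linear map killing this span is zero on everything that vanishes in the
quotient. -/
theorem sub_mem_relationSpan_of_mkAlgHom_eq (b : AdaptedBasis A B I) {s t : TensorAlgebra F L}
    (h : RingQuot.mkAlgHom F (BasisRel b) s = RingQuot.mkAlgHom F (BasisRel b) t) :
    s - t ∈ relationSpan b.basis (EnvelopingRule b) fun _ => True := by
  have h1 : (⟨Quot.mk _ s⟩ : RingQuot (BasisRel b)) = ⟨Quot.mk _ t⟩ := by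
    simpa [RingQuot.mkAlgHom_def, RingQuot.mkRingHom_def] using h
  have h2 : Relation.EqvGen (RingQuot.Rel (BasisRel b)) s t := by
    rw [RingQuot.mk.injEq] at h1
    exact Quot.eqvGen_exact h1
  clear h h1
  induction h2 with
  | refl x => simp
  | symm x y _ ih =>
    rw [← neg_sub]
    exact neg_mem ih
  | trans x y z _ _ ih ih' => simpa using add_mem ih ih'
  | rel x y hxy =>
    induction hxy with
    | of h =>
      obtain ⟨w, rfl, h⟩ := h
      exact rule_mem_relationSpan h trivial
    | add_left _ ih => simpa using ih
    | @mul_left x y z _ ih =>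
      rw [← sub_mul]
      simpa using mul_mul_mem_relationSpan b 1 z ih
    | @mul_right x y z _ ih =>
      rw [← mul_sub]
      simpa using mul_mul_mem_relationSpan b x 1 ih

theorem mkAlgHom_bracket (hG : γ.pos = Set.univ) (b : AdaptedBasis A B I) {g h : G} {x y : L}
    (hx : x ∈ A.comp g) (hy : y ∈ A.comp h) :
    RingQuot.mkAlgHom F (BasisRel b) (τ x * τ y - (γ.toFun g h : F) • (τ y * τ x)) =
      RingQuot.mkAlgHom F (BasisRel b) (τ (A.bracket x y)) := by
  rw [← sub_eq_zero, ← map_sub]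
  exact mkAlgHom_eq_zero_of_mem b (commutation_mem_shortRelations hG b hx hy)

/-- The rules impose `x^p = x^{[p]}` on basis elements only. Both sides obey the same law for
scalars, and Jacobson's formula gives them the same law for sums. -/
theorem mkAlgHom_pmap [hp : Fact p.Prime] [CharP F p] (hG : γ.pos = Set.univ) (b : AdaptedBasis A B I) {g : G} {x : L}
    (hx : x ∈ A.comp g) :
    RingQuot.mkAlgHom F (BasisRel b) (τ x ^ p) =
      RingQuot.mkAlgHom F (BasisRel b) (τ (A.pmap x)) := by
  have hg : g ∈ γ.pos := hG ▸ Set.mem_univ g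
  set j : L →ₗ[F] RingQuot (BasisRel b) :=
    (RingQuot.mkAlgHom F (BasisRel b)).toLinearMap ∘ₗ τ with hj
  suffices j x ^ p = j (A.pmap x) by simpa [hj] using this
  -- On degrees `k • g` the factor `γ(g, k • g)` is `1`, so the color bracket with `x` becomes an
  -- ordinary commutator, as Jacobson's formula requires.
  have hN : ∀ {x}, x ∈ A.comp g → ∀ z ∈ ⨆ k : ℕ, A.comp (k • g),
      A.bracket x z ∈ ⨆ k : ℕ, A.comp (k • g) ∧
        j (A.bracket x z) = j x * j z - j z * j x := by
    intro x hx z hz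
    induction hz using Submodule.iSup_induction' with
    | mem k z hz =>
      refine ⟨Submodule.mem_iSup_of_mem (k + 1) ?_, ?_⟩
      · rw [succ_nsmul']
        exact A.bracket_mem hx hz
      · have := mkAlgHom_bracket hG b hx hz
        rw [γ.map_nsmul_right, CommutationFactor.self_eq_one hG, one_pow, Units.val_one,
          one_smul] at this
        simpa [hj] using this.symm
    | zero => simp
    | add z z' _ _ hz hz' =>
      rw [map_add, map_add, map_add, hz.2, hz'.2]
      refine ⟨add_mem hz.1 hz'.1, ?_⟩
      rw [mul_add, add_mul]
      abel
  rw [A.isGrading.eq_span b.basis b.colorDeg b.mem_comp] at hx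
  have hle : ∀ {x}, x ∈ Submodule.span F (b.basis '' {w | b.colorDeg w = g}) → x ∈ A.comp g := by
    intro x hx
    rwa [A.isGrading.eq_span b.basis b.colorDeg b.mem_comp]
  induction hx using Submodule.span_induction with
  | mem x hx =>
    obtain ⟨i, -, rfl⟩ := hx
    have := RingQuot.mkAlgHom_rel F (s := BasisRel b)
      ⟨_, (wordBasis_replicate b.basis p i).symm, EnvelopingRule.pow i⟩
    simpa [hj] using this
  | zero =>
    have := A.pmap_smul (0 : F) hg (zero_mem (A.comp g))
    rw [zero_smul, zero_pow hp.out.ne_zero, zero_smul] at this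
    rw [this, map_zero, zero_pow hp.out.ne_zero]
  | add x y hx hy ihx ihy =>
    rw [A.pmap_add hg (hle hx) (hle hy), map_add, map_add, map_add, map_sum, ← ihx, ← ihy]
    refine add_pow_char_eq_jacobson p A.bracket j (⨆ k : ℕ, A.comp (k • g))
      (Submodule.mem_iSup_of_mem 1 (by simpa using hle hx)) (hN (hle hx)) (hN (hle hy))
  | smul c x hx ih =>
    rw [A.pmap_smul c hg (hle hx), map_smul, map_smul, smul_pow, ih]

variable [AddCommSemigroup Λ]

/-- The Poincaré–Birkhoff–Witt theorem: the irreducible words are linearly independent in the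
restricted enveloping algebra. -/
theorem linearIndependent_irreducible [hp : Fact p.Prime] [CharP F p] [WellFoundedLT I] {κ : Λ →ₙ+ Additive ℤˣ}
    (hG : γ.pos = Set.univ) (hB : A.IsSemigroupGraded κ B) (b : AdaptedBasis A B I) :
    LinearIndependent F (fun w : {w // IsIrreducible (EnvelopingRule b) w} =>
      RingQuot.mkAlgHom F A.Rel (wordBasis b.basis w)) := by
  obtain ⟨N, hN, hN0⟩ := exists_normalForm_enveloping hG hB b
  -- All relations of `u(L)` already follow from the rules on the basis, so an element vanishing in
  -- `u(L)` lies in the relation span and is killed by `N`; but `N` fixes the irreducible words.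
  have hrel : ∀ ⦃s t⦄, A.Rel s t →
      RingQuot.mkAlgHom F (BasisRel b) s = RingQuot.mkAlgHom F (BasisRel b) t := by
    intro s t h
    cases h with
    | bracket hx hy => exact mkAlgHom_bracket hG b hx hy
    | pmap _ hx => exact mkAlgHom_pmap hG b hx
  have hW : LinearIndependent F (fun w : {w // IsIrreducible (EnvelopingRule b) w} =>
      wordBasis b.basis w) := (wordBasis b.basis).linearIndependent.comp _ Subtype.val_injective
  refine hW.map (f := (RingQuot.mkAlgHom F A.Rel).toLinearMap) ?_
  rw [Submodule.disjoint_def]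
  intro t ht ht0
  have h1 : RingQuot.mkAlgHom F (BasisRel b) t = RingQuot.mkAlgHom F (BasisRel b) 0 := by
    rw [← RingQuot.liftAlgHom_mkAlgHom_apply F _ hrel t, map_zero]
    have : RingQuot.mkAlgHom F A.Rel t = 0 := ht0
    rw [this, map_zero]
  have h2 : N t = 0 := by
    have := hN0 _ (sub_mem_relationSpan_of_mkAlgHom_eq b h1)
    rwa [sub_zero] at this
  rw [← h2]
  clear h1 h2 ht0
  induction ht using Submodule.span_induction with
  | mem x hx =>
    obtain ⟨w, rfl⟩ := hx
    exact (hN w w.2).symm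
  | zero => simp
  | add x y _ _ hx hy => rw [map_add, ← hx, ← hy]
  | smul c x _ hx => rw [map_smul, ← hx]

theorem mem_span_irreducible_enveloping [hp : Fact p.Prime] [WellFoundedLT I]
    {κ : Λ →ₙ+ Additive ℤˣ}
    (hG : γ.pos = Set.univ) (hB : A.IsSemigroupGraded κ B) (b : AdaptedBasis A B I) (w : List I) :
    RingQuot.mkAlgHom F A.Rel (wordBasis b.basis w) ∈
      Submodule.span F ((fun w => RingQuot.mkAlgHom F A.Rel (wordBasis b.basis w)) ''
        {w' | IsIrreducible (EnvelopingRule b) w' ∧ b.wordDeg w' = b.wordDeg w}) := by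
  refine mem_span_irreducible (wordBasis b.basis) (EnvelopingRule b)
    (List.Shortlex.wf (wellFounded_lt (α := I))) b.wordDeg
    (fun u w f v h => rule_mem_span hG hB b u v h) (RingQuot.mkAlgHom F A.Rel).toLinearMap ?_ w
  intro u w f v h
  have : RingQuot.mkAlgHom F A.Rel (wordBasis b.basis w) = RingQuot.mkAlgHom F A.Rel f := by
    cases h with
    | @swap i j hij =>
      have := RingQuot.mkAlgHom_rel F (ColorLiePSuperalgebra.Rel.bracket (A := A) (b.mem_comp j)
        (b.mem_comp i))
      rw [map_add, ← this, ← map_add, wordBasis_cons, wordBasis_singleton]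
      congr 1
      abel
    | pow i =>
      rw [wordBasis_replicate]
      exact RingQuot.mkAlgHom_rel F (ColorLiePSuperalgebra.Rel.pmap (hG ▸ Set.mem_univ _)
        (b.mem_comp i))
  simp [wordBasis_append, this, mul_assoc]

/-- The basis of the restricted enveloping algebra consisting of the irreducible words. -/
noncomputable def pbwBasis [hp : Fact p.Prime] [CharP F p] [WellFoundedLT I]
    {κ : Λ →ₙ+ Additive ℤˣ}
    (hG : γ.pos = Set.univ) (hB : A.IsSemigroupGraded κ B) (b : AdaptedBasis A B I) :
    Basis {w // IsIrreducible (EnvelopingRule b) w} F A.RestrictedEnveloping :=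
  Basis.mk (linearIndependent_irreducible hG hB b) (by
    rintro z -
    obtain ⟨t, rfl⟩ := RingQuot.mkAlgHom_surjective F A.Rel z
    have ht := (wordBasis b.basis).mem_span t
    induction ht using Submodule.span_induction with
    | zero => simp
    | add x y _ _ hx hy => rw [map_add]; exact add_mem hx hy
    | smul c x _ hx => rw [map_smul]; exact Submodule.smul_mem _ _ hx
    | mem x hx =>
      obtain ⟨w, rfl⟩ := hx
      refine Submodule.span_mono ?_ (mem_span_irreducible_enveloping hG hB b w)
      rintro _ ⟨w', ⟨hw', -⟩, rfl⟩
      exact ⟨⟨w', hw'⟩, rfl⟩)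

theorem pbwBasis_apply [hp : Fact p.Prime] [CharP F p] [WellFoundedLT I] {κ : Λ →ₙ+ Additive ℤˣ}
    (hG : γ.pos = Set.univ) (hB : A.IsSemigroupGraded κ B) (b : AdaptedBasis A B I)
    (w : {w // IsIrreducible (EnvelopingRule b) w}) :
    pbwBasis hG hB b w = RingQuot.mkAlgHom F A.Rel (wordBasis b.basis w) :=
  Basis.mk_apply _ _ w

/-- The homogeneous components of the enveloping algebra are spanned by irreducible words. -/
theorem envelopingComp_eq_span [hp : Fact p.Prime] [CharP F p] [WellFoundedLT I]
    {κ : Λ →ₙ+ Additive ℤˣ}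
    (hG : γ.pos = Set.univ) (hB : A.IsSemigroupGraded κ B) (b : AdaptedBasis A B I)
    (l : WithZero Λ) :
    A.envelopingComp B l =
      Submodule.span F (pbwBasis hG hB b '' {w | b.wordDeg w.1 = l}) := by
  have hword : ∀ w : List I, ((w.map fun i => A.ι (b.basis i)).prod : A.RestrictedEnveloping) =
      RingQuot.mkAlgHom F A.Rel (wordBasis b.basis w) := by
    intro w
    rw [wordBasis_apply, map_list_prod, List.map_map]
    rfl
  apply le_antisymm
  · refine Submodule.span_le.mpr ?_
    rintro _ ⟨w, hw, rfl, rfl⟩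
    -- Expanding each factor in basis elements of its own degree yields words of the right degree;
    -- reduction to irreducible words keeps that degree.
    suffices h : ∀ w : List (Λ × L), (∀ q ∈ w, q.2 ∈ B q.1) →
        (w.map fun q => A.ι q.2).prod ∈
          Submodule.span F ((fun w => RingQuot.mkAlgHom F A.Rel (wordBasis b.basis w)) ''
            {w' | b.wordDeg w' = (w.map fun q => (q.1 : WithZero Λ)).sum}) by
      refine (Submodule.span_le.mpr ?_ : _ ≤ Submodule.span F (pbwBasis hG hB b ''
        {w' | b.wordDeg w'.1 = (w.map fun q => (q.1 : WithZero Λ)).sum})) (h w hw)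
      rintro _ ⟨w', hw', rfl⟩
      refine Submodule.span_mono ?_ (mem_span_irreducible_enveloping hG hB b w')
      rintro _ ⟨w₁, ⟨h1, h2⟩, rfl⟩
      exact ⟨⟨w₁, h1⟩, h2.trans hw', pbwBasis_apply hG hB b _⟩
    clear hw w
    intro w hw
    induction w with
    | nil => exact Submodule.subset_span ⟨[], rfl, by simp⟩
    | cons q w ih =>
      have h1 := ih fun q' hq' => hw q' (List.mem_cons_of_mem _ hq')
      have h2 := hw q List.mem_cons_self
      rw [hB.isGrading.eq_span b.basis b.deg b.mem_deg] at h2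
      simp only [List.map_cons, List.prod_cons, List.sum_cons]
      generalize (w.map fun q => A.ι q.2).prod = y at h1 ⊢
      generalize (w.map fun q => (q.1 : WithZero Λ)).sum = m at h1 ⊢
      generalize q.2 = x at h2 ⊢
      induction h2 using Submodule.span_induction with
      | zero => simp
      | add x x' _ _ hx hx' => rw [map_add, add_mul]; exact add_mem hx hx'
      | smul c x _ hx => rw [map_smul, smul_mul_assoc]; exact Submodule.smul_mem _ _ hx
      | mem x hx =>
        obtain ⟨i, hi, rfl⟩ := hx
        have hi' : b.deg i = q.1 := hi
        induction h1 using Submodule.span_induction with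
        | zero => simp
        | add y y' _ _ hy hy' => rw [mul_add]; exact add_mem hy hy'
        | smul c y _ hy => rw [mul_smul_comm]; exact Submodule.smul_mem _ _ hy
        | mem y hy =>
          obtain ⟨w', hw', rfl⟩ := hy
          have hw'' : b.wordDeg w' = m := hw'
          refine Submodule.subset_span ⟨i :: w', ?_, ?_⟩
          · simp [AdaptedBasis.wordDeg, ← hi', ← hw'']
          · change _ = RingQuot.mkAlgHom F A.Rel (τ (b.basis i)) * _
            rw [← map_mul, ← wordBasis_cons]
  · refine Submodule.span_le.mpr ?_
    rintro _ ⟨w, rfl, rfl⟩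
    refine Submodule.subset_span ⟨w.1.map fun i => (b.deg i, b.basis i), ?_, ?_, ?_⟩
    · intro q hq
      obtain ⟨i, -, rfl⟩ := List.mem_map.mp hq
      exact b.mem_deg i
    · simp [AdaptedBasis.wordDeg, Function.comp_def]
    · rw [pbwBasis_apply, ← hword, List.map_map]
      rfl

end PBW

end ColorLie

namespace ColorLie

open Module

/-! ### Existence of bihomogeneous bases and the parity of degrees. -/

section AdaptedBases

universe uG uL uΛ

variable {p : ℕ} {F : Type*} {G : Type uG} {L : Type uL} {Λ : Type uΛ} [Field F] [AddCommGroup G]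
  [AddCommGroup L] [Module F L] {γ : CommutationFactor F G}
  {A : ColorLiePSuperalgebra p F L γ} {B : Λ → Submodule F L}

theorem AdaptedBasis.finite_deg {I : Type*}
    (b : AdaptedBasis A B I) (l : Λ) [FiniteDimensional F (B l)] : {i | b.deg i = l}.Finite := by
  have h : LinearIndependent F (fun i : {i | b.deg i = l} => (⟨b.basis i, by
    have := b.mem_deg i.1
    rwa [show b.deg i.1 = l from i.2] at this⟩ : B l)) :=
    LinearIndependent.of_comp (B l).subtype
      (b.basis.linearIndependent.comp _ Subtype.val_injective)
  exact h.finite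

variable [AddCommSemigroup Λ] {κ : Λ →ₙ+ Additive ℤˣ}

/-- Two gradings need not have a common refinement; here each `L_g` is by assumption the sum of its
intersections with the `L_l`, and independence follows by splitting off first the color degree and
then the `Λ`-degree. -/
theorem isGrading_inf (hB : A.IsSemigroupGraded κ B) :
    IsGrading fun q : G × Λ => B q.2 ⊓ A.comp q.1 := by
  obtain ⟨hc, hctop⟩ := (isGrading_iff _).mp A.isGrading
  obtain ⟨hb, -⟩ := (isGrading_iff _).mp hB.isGrading
  rw [isGrading_iff]
  constructor
  · rintro ⟨g, l⟩
    rw [Submodule.disjoint_def]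
    rintro y ⟨hy1, hy2⟩ hy
    have hle : (⨆ (q : G × Λ) (_ : q ≠ (g, l)), B q.2 ⊓ A.comp q.1) ≤
        (⨆ (g') (_ : g' ≠ g), A.comp g') ⊔ ⨆ (l') (_ : l' ≠ l), B l' ⊓ A.comp g := by
      refine iSup₂_le ?_
      rintro ⟨g', l'⟩ hne
      by_cases h : g' = g
      · subst h
        have : l' ≠ l := fun h => hne (by rw [h])
        exact le_sup_of_le_right (le_iSup₂_of_le l' this le_rfl)
      · exact le_sup_of_le_left (le_iSup₂_of_le g' h inf_le_right)
    obtain ⟨u, hu, v, hv, rfl⟩ := Submodule.mem_sup.mp (hle hy)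
    have hv1 : v ∈ A.comp g := (iSup₂_le fun _ _ => inf_le_right : _ ≤ A.comp g) hv
    have hv2 : v ∈ ⨆ (l') (_ : l' ≠ l), B l' := (iSup₂_mono fun _ _ => inf_le_left :
      (⨆ (l') (_ : l' ≠ l), B l' ⊓ A.comp g) ≤ _) hv
    have hu0 : u = 0 := by
      refine (Submodule.disjoint_def.mp (hc g)) u ?_ hu
      have := sub_mem hy2 hv1
      rwa [add_sub_cancel_right] at this
    subst hu0
    rw [zero_add] at hy1 ⊢
    exact (Submodule.disjoint_def.mp (hb l)) v hy1 hv2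
  · rw [eq_top_iff, ← hctop]
    refine iSup_le fun g => ?_
    rw [hB.compatible g]
    exact iSup_le fun l => le_iSup (fun q : G × Λ => B q.2 ⊓ A.comp q.1) (g, l.1)

theorem exists_adaptedBasis (hB : A.IsSemigroupGraded κ B) :
    ∃ (I : Type (max uG uL uΛ)) (_ : LinearOrder I) (_ : WellFoundedLT I), Nonempty (AdaptedBasis A B I) := by
  classical
  have h := isGrading_inf hB
  let v : ∀ q : G × Λ, Basis (Basis.ofVectorSpaceIndex F ↥(B q.2 ⊓ A.comp q.1)) F
    ↥(B q.2 ⊓ A.comp q.1) := fun q => Basis.ofVectorSpace F _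
  have h' : DirectSum.IsInternal fun q : G × Λ => B q.2 ⊓ A.comp q.1 := by
    unfold IsGrading at h
    convert h
  refine ⟨_, IsWellOrder.linearOrder WellOrderingRel, ?_, ⟨{
    basis := h'.collectedBasis v
    colorDeg := fun i => i.1.1
    deg := fun i => i.1.2
    mem_comp := fun i => (h'.collectedBasis_mem v i).2
    mem_deg := fun i => (h'.collectedBasis_mem v i).1 }⟩⟩
  exact ⟨WellOrderingRel.isWellOrder.wf⟩

/-- All occurring degrees are positive. -/
theorem AdaptedBasis.parity_eq_one {I : Type*} (hG : γ.pos = Set.univ)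
    (hB : A.IsSemigroupGraded κ B) (b : AdaptedBasis A B I) (i : I) : (κ (b.deg i)).toMul = 1 := by
  by_contra hne
  obtain ⟨hb, -⟩ := (isGrading_iff _).mp hB.isGrading
  have hs : γ.sign (b.colorDeg i) = 1 := if_pos (hG ▸ Set.mem_univ _)
  -- If the degree of a basis element had sign `-1`, its color component would lie in the sum of the
  -- other `L_l`, against independence.
  have hle : A.comp (b.colorDeg i) ≤ ⨆ (l') (_ : l' ≠ b.deg i), B l' := by
    rw [hB.compatible, hs]
    refine iSup_le fun l => le_iSup₂_of_le l.1 ?_ inf_le_left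
    intro h
    exact hne (h ▸ l.2)
  exact b.basis.ne_zero i
    ((Submodule.disjoint_def.mp (hb (b.deg i))) _ (b.mem_deg i) (hle (b.mem_comp i)))

theorem AdaptedBasis.finrank_eq {I : Type*} (hB : A.IsSemigroupGraded κ B)
    (b : AdaptedBasis A B I) (l : Λ) : finrank F (B l) = Nat.card {i | b.deg i = l} := by
  rw [hB.isGrading.eq_span b.basis b.deg b.mem_deg l, finrank_span_image]

end AdaptedBases

/-! ### Irreducible words as bounded exponent functions. -/

section SortedLists

variable {I : Type*} [LinearOrder I]

theorem exists_eq_replicate_append (i : I) (w : List I) (hw : w.Pairwise (· ≤ ·))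
    (hi : ∀ a ∈ w, i ≤ a) : ∃ v, w = List.replicate (w.count i) i ++ v := by
  induction w with
  | nil => exact ⟨[], rfl⟩
  | cons a w ih =>
    rw [List.pairwise_cons] at hw
    by_cases h : a = i
    · subst h
      obtain ⟨v, hv⟩ := ih hw.2 hw.1
      refine ⟨v, ?_⟩
      rw [List.count_cons_self, List.replicate_succ, List.cons_append, ← hv]
    · refine ⟨a :: w, ?_⟩
      have : (a :: w).count i = 0 := by
        rw [List.count_eq_zero]
        intro hmem
        have hia : i < a := lt_of_le_of_ne (hi a (by simp)) (Ne.symm h)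
        rcases List.mem_cons.mp hmem with h' | h'
        · exact h h'.symm
        · exact absurd (hw.1 i h') (not_le.mpr hia)
      rw [this]
      rfl

theorem exists_eq_append_replicate_append (i : I) (w : List I) (hw : w.Pairwise (· ≤ ·)) :
    ∃ u v, w = u ++ List.replicate (w.count i) i ++ v := by
  induction w with
  | nil => exact ⟨[], [], rfl⟩
  | cons a w ih =>
    by_cases h : a = i
    · subst h
      obtain ⟨v, hv⟩ := exists_eq_replicate_append a (a :: w) hw (by
        intro c hc
        rcases List.mem_cons.mp hc with h | h
        · exact h.ge
        · exact (List.pairwise_cons.mp hw).1 c h)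
      exact ⟨[], v, hv⟩
    · obtain ⟨u, v, hv⟩ := ih (List.pairwise_cons.mp hw).2
      refine ⟨a :: u, v, ?_⟩
      rw [List.count_cons_of_ne h, List.cons_append, List.cons_append, ← hv]

variable {p : ℕ} {F G L Λ : Type*} [Field F] [AddCommGroup G]
  [AddCommGroup L] [Module F L] {γ : CommutationFactor F G}
  {A : ColorLiePSuperalgebra p F L γ} {B : Λ → Submodule F L}

/-- Absence of descents between neighbours means sortedness, and in a sorted word equal letters are
adjacent, so excluding blocks `x_i^p` bounds the multiplicities. -/
theorem isIrreducible_iff (b : AdaptedBasis A B I) (w : List I) :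
    IsIrreducible (EnvelopingRule b) w ↔ w.Pairwise (· ≤ ·) ∧ ∀ i, w.count i < p := by
  constructor
  · intro h
    have hs : w.Pairwise (· ≤ ·) := by
      rw [← List.isChain_iff_pairwise]
      induction w with
      | nil => exact List.isChain_nil
      | cons a w ih =>
        have hw := ih fun u w' f v hR e => h (a :: u) w' f v hR (by rw [e]; rfl)
        rcases w with _ | ⟨c, w⟩
        · exact List.isChain_singleton a
        · rw [List.isChain_cons_cons]
          refine ⟨?_, hw⟩
          by_contra hlt
          exact h [] [a, c] _ w (EnvelopingRule.swap (not_le.mp hlt)) rfl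
    refine ⟨hs, fun i => ?_⟩
    by_contra hlt
    obtain ⟨u, v, e⟩ := exists_eq_append_replicate_append i w hs
    refine h u (List.replicate p i) _ (List.replicate (w.count i - p) i ++ v)
      (EnvelopingRule.pow i) (e.trans ?_)
    rw [List.append_assoc, List.append_assoc, ← List.append_assoc (List.replicate p i),
      ← List.replicate_add, Nat.add_sub_cancel' (not_lt.mp hlt)]
  · rintro ⟨hs, hc⟩ u w' f v hR rfl
    cases hR with
    | @swap i j hij =>
      rw [List.append_assoc, List.pairwise_append] at hs
      have := (List.pairwise_cons.mp hs.2.1).1 i (by simp)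
      exact absurd hij (not_lt.mpr this)
    | pow i =>
      have := hc i
      simp at this
      omega

open Classical in
/-- The number of irreducible words of a given degree. -/
theorem card_irreducible [AddCommSemigroup Λ] (hp : 0 < p) (b : AdaptedBasis A B I) (l : WithZero Λ)
    (S : Finset I) (hS : ∀ i, (∃ c, (b.deg i : WithZero Λ) + c = l) → i ∈ S) :
    Nat.card {w | IsIrreducible (EnvelopingRule b) w ∧ b.wordDeg w = l} =
      ((Fintype.piFinset fun _ : S => Finset.range p).filter
        fun x : S → ℕ => ∑ i, x i • (b.deg i : WithZero Λ) = l).card := by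
  have hmem : ∀ w : List I, b.wordDeg w = l → ∀ i ∈ w, i ∈ S := by
    intro w hw i hi
    obtain ⟨u, v, rfl⟩ := List.append_of_mem hi
    refine hS i ⟨b.wordDeg u + b.wordDeg v, ?_⟩
    rw [← hw, b.wordDeg_append]
    simp only [AdaptedBasis.wordDeg, List.map_cons, List.sum_cons]
    rw [add_left_comm]
  have hdeg : ∀ w : List I, (∀ i ∈ w, i ∈ S) →
      b.wordDeg w = ∑ i : S, w.count i.1 • (b.deg i : WithZero Λ) := by
    intro w hw
    rw [AdaptedBasis.wordDeg, Finset.sum_list_map_count,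
      Finset.sum_coe_sort S fun i => w.count i • (b.deg i : WithZero Λ)]
    refine Finset.sum_subset (fun i hi => hw i (List.mem_toFinset.mp hi)) fun i _ hi => ?_
    rw [List.count_eq_zero.mpr fun h => hi (List.mem_toFinset.mpr h), zero_smul]
  let f : {w | IsIrreducible (EnvelopingRule b) w ∧ b.wordDeg w = l} →
      {x // x ∈ (Fintype.piFinset fun _ : S => Finset.range p).filter
        fun x : S → ℕ => ∑ i, x i • (b.deg i : WithZero Λ) = l} := fun w =>
    ⟨fun i => w.1.count i.1, by
      rw [Finset.mem_filter, Fintype.mem_piFinset]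
      exact ⟨fun i => Finset.mem_range.mpr (((isIrreducible_iff b _).mp w.2.1).2 i),
        (hdeg w.1 (hmem w.1 w.2.2)).symm.trans w.2.2⟩⟩
  rw [← Nat.card_eq_finsetCard]
  refine Nat.card_eq_of_bijective f ⟨?_, ?_⟩
  · rintro ⟨w, hw, hwl⟩ ⟨w', hw', hwl'⟩ h
    rw [Subtype.mk.injEq]
    refine List.Perm.eq_of_pairwise' ((isIrreducible_iff b _).mp hw).1
      ((isIrreducible_iff b _).mp hw').1 (List.perm_iff_count.mpr fun i => ?_)
    by_cases hi : i ∈ S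
    · exact congrFun (congrArg Subtype.val h) ⟨i, hi⟩
    · rw [List.count_eq_zero.mpr fun h => hi (hmem w hwl i h),
        List.count_eq_zero.mpr fun h => hi (hmem w' hwl' i h)]
  · rintro ⟨x, hx⟩
    rw [Finset.mem_filter, Fintype.mem_piFinset] at hx
    -- The inverse construction: sort the multiset with the prescribed multiplicities.
    let m : Multiset I := ∑ i : S, Multiset.replicate (x i) i.1
    have hm : ∀ i : S, m.count i.1 = x i := by
      intro i
      rw [Multiset.count_sum']
      simp only [Multiset.count_replicate]
      rw [Finset.sum_eq_single i]
      · simp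
      · intro j _ hj
        rw [if_neg fun h => hj (Subtype.ext h)]
      · simp
    have hmS : ∀ i ∈ m, i ∈ S := by
      intro i hi
      obtain ⟨j, -, hj⟩ := Multiset.mem_sum.mp hi
      rw [Multiset.eq_of_mem_replicate hj]
      exact j.2
    have hcount : ∀ i, (m.sort (· ≤ ·)).count i = m.count i := by
      intro i
      rw [← Multiset.coe_count, Multiset.sort_eq]
    have hS' : ∀ i ∈ m.sort (· ≤ ·), i ∈ S := fun i hi => hmS i (by simpa using hi)
    refine ⟨⟨m.sort (· ≤ ·), (isIrreducible_iff b _).mpr ⟨m.pairwise_sort _, fun i => ?_⟩, ?_⟩, ?_⟩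
    · rw [hcount]
      by_cases hi : i ∈ S
      · rw [hm ⟨i, hi⟩]
        exact Finset.mem_range.mp (hx.1 _)
      · rw [Multiset.count_eq_zero.mpr fun h => hi (hmS i h)]
        exact hp
    · rw [hdeg _ hS', ← hx.2]
      simp only [hcount, hm]
    · simp only [f, hcount, hm]

end SortedLists

end ColorLie

namespace ColorLie

/-! ### Exponential and logarithm of nilpotent elements. -/

section NilpotentExponential

open Finset Polynomial

variable {R : Type*} [CommRing R] [Algebra ℚ R]

/-- The logarithm of `1 + x`, if `x ^ N = 0`. -/
noncomputable def nilLog (N : ℕ) (x : R) : R :=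
  ∑ k ∈ range N, ((-1 : ℚ) ^ k / (k + 1)) • x ^ (k + 1)

theorem derivative_exp {q : R[X]} (hq : IsNilpotent q) :
    derivative (IsNilpotent.exp q) = derivative q * IsNilpotent.exp q := by
  obtain ⟨N, hN⟩ := hq
  have hN' : q ^ (N + 1) = 0 := by rw [pow_succ, hN, zero_mul]
  conv_lhs => rw [IsNilpotent.exp_eq_sum hN', sum_range_succ']
  conv_rhs => rw [IsNilpotent.exp_eq_sum hN]
  rw [mul_sum, map_add, map_sum]
  simp only [pow_zero, derivative_smul, derivative_one, smul_zero, add_zero]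
  refine sum_congr rfl fun k _ => ?_
  rw [derivative_pow_succ, Nat.factorial_succ, mul_smul_comm]
  have : (C ((k : R) + 1) : R[X]) = ((k + 1 : ℕ) : ℚ) • 1 := by
    rw [Nat.cast_smul_eq_nsmul]
    simp
  rw [this, smul_mul_assoc, smul_mul_assoc, smul_smul, one_mul, mul_comm (q ^ k)]
  congr 1
  push_cast
  have : ((k.factorial : ℚ)) ≠ 0 := by positivity
  field_simp

theorem derivative_nilLog (N : ℕ) (q : R[X]) :
    derivative (nilLog N q) = (∑ k ∈ range N, (-q) ^ k) * derivative q := by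
  rw [nilLog, map_sum, sum_mul]
  refine sum_congr rfl fun k _ => ?_
  rw [derivative_smul, derivative_pow_succ]
  have : (C ((k : R) + 1) : R[X]) = ((k + 1 : ℕ) : ℚ) • 1 := by
    rw [Nat.cast_smul_eq_nsmul]
    simp
  rw [this, smul_mul_assoc, smul_mul_assoc, smul_smul, one_mul, neg_pow q, mul_assoc]
  have h2 : (-1 : ℚ) ^ k / (k + 1) * ((k + 1 : ℕ) : ℚ) = (-1) ^ k := by
    push_cast
    field_simp
  rw [h2]
  rcases neg_one_pow_eq_or ℚ k with h | h
  · have : (-1 : R[X]) ^ k = 1 := by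
      rcases Nat.even_or_odd k with h' | h'
      · exact h'.neg_one_pow
      · rw [h'.neg_one_pow] at h; norm_num at h
    rw [h, this, one_smul, one_mul]
  · have : (-1 : R[X]) ^ k = -1 := by
      rcases Nat.even_or_odd k with h' | h'
      · rw [h'.neg_one_pow] at h; norm_num at h
      · exact h'.neg_one_pow
    rw [h, this, neg_smul, one_smul, neg_one_mul]

theorem eq_C_of_derivative_eq_zero_of_algebra {q : R[X]} (h : derivative q = 0) :
    q = C (q.coeff 0) := by
  ext n
  rcases n with _ | n
  · simp
  · have := congrArg (fun f => f.coeff n) h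
    simp only [coeff_derivative, coeff_zero] at this
    have hu : IsUnit ((n : R) + 1) := by
      have h1 : IsUnit ((n : ℚ) + 1) := by
        rw [isUnit_iff_ne_zero]
        positivity
      simpa using h1.map (algebraMap ℚ R)
    rw [coeff_C_succ]
    exact (hu.mul_left_eq_zero).mp this

theorem mul_geom_neg {R : Type*} [CommRing R] {N : ℕ} {x : R} (hx : x ^ N = 0) :
    (1 + x) * ∑ k ∈ range N, (-x) ^ k = 1 := by
  have := mul_neg_geom_sum (-x) N
  rw [neg_pow x N, hx, mul_zero, sub_zero, sub_neg_eq_add] at this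
  exact this

theorem map_nilLog {S : Type*} [CommRing S] [Algebra ℚ S] (f : R →+* S) (N : ℕ) (x : R) :
    f (nilLog N x) = nilLog N (f x) := by
  simp [nilLog, map_rat_smul]

theorem exp_sub_one_pow {x : R} {N : ℕ} (hx : x ^ N = 0) : (IsNilpotent.exp x - 1) ^ N = 0 := by
  have hx' : x ^ (N + 1) = 0 := by rw [pow_succ, hx, zero_mul]
  have : IsNilpotent.exp x - 1 = x * ∑ k ∈ range N, ((k + 1).factorial : ℚ)⁻¹ • x ^ k := by
    rw [IsNilpotent.exp_eq_sum hx', sum_range_succ', mul_sum]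
    simp [pow_succ']
  rw [this, mul_pow, hx, zero_mul]

/-- The logarithm of the exponential. -/
theorem nilLog_exp {x : R} {N : ℕ} (hx : x ^ N = 0) : nilLog N (IsNilpotent.exp x - 1) = x := by
  -- Deform `x` to `xX`: the difference of the two sides has zero derivative and zero constant term,
  -- hence vanishes; then set `X = 1`.
  set y : R[X] := C x * X with hy
  have hyN : y ^ N = 0 := by rw [hy, mul_pow, ← C_pow, hx, C_0, zero_mul]
  have hnil : IsNilpotent y := ⟨N, hyN⟩
  have hder : derivative (nilLog N (IsNilpotent.exp y - 1) - y) = 0 := by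
    have h := mul_geom_neg (exp_sub_one_pow hyN)
    rw [add_sub_cancel] at h
    rw [map_sub, derivative_nilLog, map_sub, derivative_exp hnil, derivative_one, sub_zero,
      mul_comm (derivative y), ← mul_assoc, mul_comm _ (IsNilpotent.exp y), h, one_mul, sub_self]
  have h := eq_C_of_derivative_eq_zero_of_algebra hder
  have h0 : (nilLog N (IsNilpotent.exp y - 1) - y).coeff 0 = 0 := by
    rw [coeff_zero_eq_eval_zero, ← coe_evalRingHom, map_sub, map_nilLog, map_sub,
      IsNilpotent.map_exp hnil]
    simp [hy, nilLog]
  rw [h0, C_0] at h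
  have h1 := congrArg (evalRingHom 1) h
  rw [map_sub, map_nilLog, map_sub, IsNilpotent.map_exp hnil] at h1
  simpa [hy, sub_eq_zero] using h1

theorem nilLog_pow {x : R} {N : ℕ} (hx : x ^ N = 0) : nilLog N x ^ N = 0 := by
  have : nilLog N x = x * ∑ k ∈ range N, ((-1 : ℚ) ^ k / (k + 1)) • x ^ k := by
    rw [nilLog, mul_sum]
    simp [pow_succ']
  rw [this, mul_pow, hx, zero_mul]

/-- The exponential of the logarithm. -/
theorem exp_nilLog {x : R} {N : ℕ} (hx : x ^ N = 0) : IsNilpotent.exp (nilLog N x) = 1 + x := by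
  set y : R[X] := C x * X with hy
  have hyN : y ^ N = 0 := by rw [hy, mul_pow, ← C_pow, hx, C_0, zero_mul]
  have hnil : IsNilpotent (nilLog N y) := ⟨N, nilLog_pow hyN⟩
  -- `V` is the inverse of `1 + y`; the product `exp(ln(1 + y)) V` has zero derivative and constant
  -- term `1`.
  set V : R[X] := ∑ k ∈ range N, (-y) ^ k with hV
  have hVy : (1 + y) * V = 1 := mul_geom_neg hyN
  have hVd : derivative V = - (V * derivative y * V) := by
    have := congrArg derivative hVy
    rw [derivative_mul, map_add, derivative_one, zero_add] at this
    linear_combination V * this - derivative V * hVy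
  have hder : derivative (IsNilpotent.exp (nilLog N y) * V) = 0 := by
    rw [derivative_mul, derivative_exp hnil, derivative_nilLog, ← hV, hVd]
    ring
  have h := eq_C_of_derivative_eq_zero_of_algebra hder
  have h0 : (IsNilpotent.exp (nilLog N y) * V).coeff 0 = 1 := by
    have hV0 : eval 0 V = 1 := by
      have := congrArg (eval 0) hVy
      simpa [hy] using this
    rw [coeff_zero_eq_eval_zero, eval_mul, hV0, mul_one, ← coe_evalRingHom,
      IsNilpotent.map_exp hnil, map_nilLog]
    simp [hy, nilLog]
  rw [h0, C_1] at h
  have h1 : IsNilpotent.exp (nilLog N y) = 1 + y := by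
    linear_combination (1 + y) * h - IsNilpotent.exp (nilLog N y) * hVy
  have h2 := congrArg (evalRingHom 1) h1
  rw [IsNilpotent.map_exp hnil, map_nilLog] at h2
  simpa [hy] using h2

theorem exp_sum {ι : Type*} (s : Finset ι) (f : ι → R) (hf : ∀ i ∈ s, IsNilpotent (f i)) :
    IsNilpotent.exp (∑ i ∈ s, f i) = ∏ i ∈ s, IsNilpotent.exp (f i) := by
  classical
  induction s using Finset.induction_on with
  | empty => simp
  | insert i s hi ih =>
    rw [sum_insert hi, prod_insert hi, IsNilpotent.exp_add_of_commute (Commute.all _ _)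
      (hf i (mem_insert_self _ _)), ih fun j hj => hf j (mem_insert_of_mem hj)]
    exact isNilpotent_sum fun j hj => hf j (mem_insert_of_mem hj)

/-- The contribution of a single basis element to the character of a restricted enveloping
algebra. -/
theorem exp_oneP (p : ℕ) (hp : 0 < p) {y : R} {N : ℕ} (hy : y ^ N = 0) :
    IsNilpotent.exp (∑ m ∈ Icc 1 (p * N), ((oneP p m : ℚ) / m) • y ^ m) =
      ∑ j ∈ range p, y ^ j := by
  have hyp : (-(y ^ p)) ^ N = 0 := by rw [neg_pow, ← pow_mul, mul_comm p, pow_mul, hy,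
    zero_pow hp.ne', mul_zero]
  have hyN : (-y) ^ (p * N) = 0 := by
    rw [neg_pow, mul_comm p, pow_mul y, hy, zero_pow hp.ne', mul_zero]
  have hlog : ∀ (K : ℕ) (z : R), nilLog K (-z) = - ∑ m ∈ Icc 1 K, ((1 : ℚ) / m) • z ^ m := by
    intro K z
    have hI : Icc 1 K = Ico (0 + 1) (K + 1) := by
      ext m
      simp only [mem_Icc, mem_Ico]
      omega
    rw [hI, ← sum_Ico_add' (fun m : ℕ => ((1 : ℚ) / m) • z ^ m), ← range_eq_Ico,
      ← sum_neg_distrib, nilLog]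
    refine sum_congr rfl fun k _ => ?_
    rcases k.even_or_odd with h | h
    · rw [h.neg_one_pow, h.add_one.neg_pow]
      simp
    · rw [h.neg_one_pow, h.add_one.neg_pow, neg_div, neg_smul]
      simp
  -- As `1_p(m)` is `1`, less `p` when `p ∣ m`, the exponent is `ln(1 - y^p) - ln(1 - y)`. The
  -- cutoff `p * N` makes the multiples of `p` match `N` terms of the second logarithm.
  have hsum : nilLog (p * N) (-y) + ∑ m ∈ Icc 1 (p * N), ((oneP p m : ℚ) / m) • y ^ m =
      nilLog N (-(y ^ p)) := by
    have himg : (Icc 1 (p * N)).filter (p ∣ ·) = (Icc 1 N).image (p * ·) := by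
      ext m
      simp only [mem_filter, mem_image, mem_Icc]
      constructor
      · rintro ⟨⟨h1, h2⟩, k, rfl⟩
        exact ⟨k, ⟨Nat.pos_of_mul_pos_left h1, Nat.le_of_mul_le_mul_left h2 hp⟩, rfl⟩
      · rintro ⟨k, ⟨h1, h2⟩, rfl⟩
        exact ⟨⟨Nat.mul_pos hp h1, Nat.mul_le_mul_left p h2⟩, dvd_mul_right p k⟩
    rw [hlog, hlog, ← sum_neg_distrib, ← sum_add_distrib, ← sum_neg_distrib]
    have : ∀ m ∈ Icc 1 (p * N), -(((1 : ℚ) / m) • y ^ m) + ((oneP p m : ℚ) / m) • y ^ m =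
        if p ∣ m then -(((p : ℚ) / m) • y ^ m) else 0 := by
      intro m _
      rw [oneP]
      split_ifs
      · rw [← neg_smul, ← neg_smul, ← add_smul]
        congr 1
        push_cast
        ring
      · simp
    rw [sum_congr rfl this, ← sum_filter, himg,
      sum_image fun a _ b _ h => Nat.eq_of_mul_eq_mul_left hp h]
    refine sum_congr rfl fun k hk => ?_
    have hp' : (p : ℚ) ≠ 0 := by positivity
    rw [pow_mul, Nat.cast_mul, div_mul_eq_div_div, div_self hp']
  have h1 := exp_nilLog hyp
  have hnil : IsNilpotent (∑ m ∈ Icc 1 (p * N), ((oneP p m : ℚ) / m) • y ^ m) := by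
    refine isNilpotent_sum fun m hm => ?_
    rw [mem_Icc] at hm
    refine IsNilpotent.smul ?_ _
    exact IsNilpotent.pow_of_pos ⟨N, hy⟩ (by omega)
  rw [← hsum, IsNilpotent.exp_add_of_commute (Commute.all _ _) ⟨p * N, nilLog_pow hyN⟩ hnil,
    exp_nilLog hyN] at h1
  have h2 := mul_neg_geom_sum y p
  have hu := mul_geom_neg hyN
  -- Both sides times `1 - y` equal `1 - y^p`, and `1 - y` is invertible by the geometric sum.
  linear_combination (∑ k ∈ range (p * N), (- -y) ^ k) * (h1 - h2) +
    (∑ j ∈ range p, y ^ j - IsNilpotent.exp (∑ m ∈ Icc 1 (p * N), ((oneP p m : ℚ) / m) • y ^ m)) * hu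

end NilpotentExponential

end ColorLie

namespace ColorLie

/-! ### The Dirichlet inverse of `1_p`. -/

section Moebius

open Finset ArithmeticFunction

/-- The function `oneP` as an arithmetic function. -/
def arithOneP (p : ℕ) : ArithmeticFunction ℤ := ⟨fun n => if n = 0 then 0 else oneP p n, by simp⟩

/-- The function `moebiusP` as an arithmetic function. -/
def arithMoebiusP (p : ℕ) : ArithmeticFunction ℤ := ⟨moebiusP p, by simp [moebiusP]⟩

/-- The Euler factor relating `oneP` to the constant function `1`. -/
def arithEuler (p : ℕ) : ArithmeticFunction ℤ :=
  ⟨fun n => if n = 0 then 0 else if n = 1 then 1 else if n = p then -p else 0, by simp⟩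

theorem mul_arithEuler {p : ℕ} (hp : p.Prime) (f : ArithmeticFunction ℤ) {n : ℕ} (hn : n ≠ 0) :
    (f * arithEuler p) n = f n - if p ∣ n then p * f (n / p) else 0 := by
  rw [mul_apply, Nat.sum_divisorsAntidiagonal' (f := fun a b => f a * arithEuler p b)]
  split_ifs with h
  · rw [← sum_subset (s₁ := {1, p})]
    · rw [sum_pair hp.one_lt.ne]
      simp [arithEuler, hp.ne_zero, hp.ne_one]
      ring
    · intro k hk
      simp only [mem_insert, mem_singleton] at hk
      rcases hk with rfl | rfl <;> simp [hn, h]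
    · intro k hk hk'
      simp only [mem_insert, mem_singleton, not_or] at hk'
      simp [arithEuler, hk'.1, hk'.2]
  · rw [sum_eq_single 1]
    · simp [arithEuler]
    · intro k hk hk'
      have : k ≠ p := by
        rintro rfl
        exact h (Nat.dvd_of_mem_divisors hk)
      simp [arithEuler, hk', this]
    · intro h1
      exact absurd (by simp [hn]) h1

/-- In Dirichlet series, `1_p` corresponds to `ζ(s) (1 - p^{1-s})`. -/
theorem zeta_mul_arithEuler {p : ℕ} (hp : p.Prime) :
    ((zeta : ArithmeticFunction ℕ) : ArithmeticFunction ℤ) * arithEuler p = arithOneP p := by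
  ext n
  rcases eq_or_ne n 0 with rfl | hn
  · simp
  rw [mul_arithEuler hp _ hn]
  simp only [natCoe_apply, zeta_apply, hn, if_false, arithOneP, coe_mk, oneP]
  by_cases h : p ∣ n
  · have := Nat.div_pos (Nat.le_of_dvd (Nat.pos_of_ne_zero hn) h) hp.pos
    simp [h, this.ne']
  · simp [h]

/-- This says that `μ_p` corresponds to `1 / (ζ(s) (1 - p^{1-s}))`. At `n = p m` with `p ∤ m` the
value is `μ(m)(p - 1) - p μ(m) = -μ(m)`, and at higher powers of `p` the two terms cancel. -/
theorem arithMoebiusP_mul_arithEuler {p : ℕ} (hp : p.Prime) :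
    arithMoebiusP p * arithEuler p = moebius := by
  ext n
  rcases eq_or_ne n 0 with rfl | hn
  · simp
  rw [mul_arithEuler hp _ hn]
  have : Fact p.Prime := ⟨hp⟩
  split_ifs with h
  · obtain ⟨s, m, hm, rfl⟩ := Nat.exists_eq_pow_mul_and_not_dvd hn p hp.ne_one
    have hs : s ≠ 0 := by
      rintro rfl
      simp at h
      exact hm h
    have hm0 : m ≠ 0 := by
      rintro rfl
      simp at hm
    have hv : ∀ s, padicValNat p (p ^ s * m) = s := by
      intro s
      rw [padicValNat.mul (pow_ne_zero _ hp.ne_zero) hm0, padicValNat.prime_pow,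
        padicValNat.eq_zero_of_not_dvd hm, add_zero]
    have hμ : ∀ s, moebiusP p (p ^ (s + 1) * m) = moebius m * ((p : ℤ) ^ (s + 1) - p ^ s) := by
      intro s
      rw [moebiusP, if_pos (Dvd.dvd.mul_right (dvd_pow_self p s.succ_ne_zero) m), hv,
        Nat.mul_div_cancel_left _ (pow_pos hp.pos _)]
      simp
    have hcop : Nat.Coprime p m := (Nat.Prime.coprime_iff_not_dvd hp).mpr hm
    obtain ⟨s, rfl⟩ := Nat.exists_eq_succ_of_ne_zero hs
    have hdiv : p ^ (s + 1) * m / p = p ^ s * m := by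
      rw [pow_succ', mul_assoc, Nat.mul_div_cancel_left _ hp.pos]
    rw [Nat.succ_eq_add_one, hdiv]
    change moebiusP p _ - p * moebiusP p _ = _
    rw [hμ, isMultiplicative_moebius.map_mul_of_coprime (hcop.pow_left _)]
    rcases s with _ | s
    · rw [pow_zero, pow_zero, one_mul m, moebiusP, if_neg hm, zero_add, pow_one, pow_one,
        moebius_apply_prime hp]
      ring
    · rw [hμ, moebius_apply_prime_pow hp (by omega), if_neg (by omega)]
      ring
  · rw [sub_zero]
    change moebiusP p n = _
    rw [moebiusP, if_neg h]

/-- `moebiusP p` is the Dirichlet inverse of `oneP p`. -/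
theorem sum_moebiusP_mul_oneP {p : ℕ} (hp : p.Prime) (n : ℕ) :
    ∑ q ∈ n.divisorsAntidiagonal, moebiusP p q.1 * oneP p q.2 = if n = 1 then 1 else 0 := by
  have h : arithMoebiusP p * arithOneP p = 1 := by
    rw [← zeta_mul_arithEuler hp, mul_comm ((zeta : ArithmeticFunction ℕ) : ArithmeticFunction ℤ), ← mul_assoc,
      arithMoebiusP_mul_arithEuler hp, moebius_mul_coe_zeta]
  have h1 := congrArg (fun f : ArithmeticFunction ℤ => f n) h
  simp only [mul_apply, one_apply] at h1
  rw [← h1]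
  refine sum_congr rfl fun q hq => ?_
  have := (Nat.mem_divisorsAntidiagonal.mp hq)
  have hq2 : q.2 ≠ 0 := by
    intro h0
    rw [h0, mul_zero] at this
    exact this.2 this.1.symm
  simp [arithMoebiusP, arithOneP, hq2]

end Moebius

end ColorLie

namespace ColorLie

/-! ### Consequences of the finiteness condition. -/

section FinitenessCondition

variable {Λ : Type*} [AddCommSemigroup Λ]

/-- The set of the summands of `l`. -/
def summands (l : WithZero Λ) : Set (WithZero Λ) := {a | ∃ c, a + c = l}

theorem self_mem_summands (l : WithZero Λ) : l ∈ summands l := ⟨0, add_zero l⟩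

theorem summands_trans {a b l : WithZero Λ} (h : a ∈ summands l) (h' : b ∈ summands a) :
    b ∈ summands l := by
  obtain ⟨c, rfl⟩ := h
  obtain ⟨d, rfl⟩ := h'
  exact ⟨d + c, by rw [add_assoc]⟩

/-- The sum of a multiset of elements of `Λ`. -/
def msum (s : Multiset Λ) : WithZero Λ := (s.map (WithZero.coe : Λ → WithZero Λ)).sum

theorem msum_add (s t : Multiset Λ) : msum (s + t) = msum s + msum t := by
  simp [msum]

theorem msum_replicate (n : ℕ) (a : Λ) : msum (Multiset.replicate n a) = n • (a : WithZero Λ) := by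
  simp [msum]

theorem exists_msum (a : WithZero Λ) : ∃ s : Multiset Λ, msum s = a := by
  induction a using WithZero.recZeroCoe with
  | zero => exact ⟨0, rfl⟩
  | coe a => exact ⟨{a}, by simp [msum]⟩

theorem eq_zero_of_add_eq_zero {a b : WithZero Λ} (h : a + b = 0) : a = 0 ∧ b = 0 := by
  induction a using WithZero.recZeroCoe with
  | zero => exact ⟨rfl, by simpa using h⟩
  | coe a =>
    induction b using WithZero.recZeroCoe with
    | zero => simp at h
    | coe b => exact absurd h (by rw [← WithZero.coe_add]; exact WithZero.coe_ne_zero)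

theorem eq_zero_of_nsmul_eq_zero {n : ℕ} (hn : n ≠ 0) {a : WithZero Λ} (h : n • a = 0) : a = 0 := by
  obtain ⟨m, rfl⟩ := Nat.exists_eq_succ_of_ne_zero hn
  rw [Nat.succ_eq_add_one, succ_nsmul] at h
  exact (eq_zero_of_add_eq_zero h).2

theorem card_eq_zero_of_msum_eq_zero {s : Multiset Λ} (h : msum s = 0) : s = 0 := by
  induction s using Multiset.induction_on with
  | empty => rfl
  | cons a s _ =>
    rw [msum, Multiset.map_cons, Multiset.sum_cons] at h
    exact absurd (eq_zero_of_add_eq_zero h).1 WithZero.coe_ne_zero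

theorem finite_msum (hΛ : FinitenessCondition Λ) (l : WithZero Λ) :
    {s : Multiset Λ | msum s = l}.Finite := by
  induction l using WithZero.recZeroCoe with
  | zero =>
    refine (Set.finite_singleton (0 : Multiset Λ)).subset fun s hs => ?_
    exact card_eq_zero_of_msum_eq_zero hs
  | coe l => exact hΛ l

theorem finite_summands (hΛ : FinitenessCondition Λ) (l : WithZero Λ) : (summands l).Finite := by
  have h : (⋃ t ∈ {t : Multiset Λ | msum t = l}, msum '' {s | s ≤ t}).Finite :=
    (finite_msum hΛ l).biUnion fun t _ =>
      ((t.powerset.finite_toSet).subset fun s hs => Multiset.mem_powerset.mpr hs).image msum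
  refine h.subset ?_
  rintro a ⟨c, hc⟩
  obtain ⟨s, rfl⟩ := exists_msum a
  obtain ⟨t, rfl⟩ := exists_msum c
  rw [← msum_add] at hc
  exact Set.mem_biUnion hc ⟨s, Multiset.le_add_right s t, rfl⟩

/-- A multiset summing to a summand of `l` extends to one summing to `l`, and there are finitely
many of those. This one bound cuts off powers and dilations of series without constant term at all
summands of `l`. -/
theorem exists_card_le (hΛ : FinitenessCondition Λ) (l : WithZero Λ) :
    ∃ N : ℕ, ∀ s : Multiset Λ, msum s ∈ summands l → s.card ≤ N := by
  obtain ⟨N, hN⟩ := ((finite_msum hΛ l).image Multiset.card).bddAbove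
  refine ⟨N, fun s ⟨c, hc⟩ => ?_⟩
  obtain ⟨t, rfl⟩ := exists_msum c
  rw [← msum_add] at hc
  have := hN ⟨s + t, hc, rfl⟩
  rw [Multiset.card_add] at this
  omega

theorem finite_pairs (hΛ : FinitenessCondition Λ) (l : WithZero Λ) :
    {q : WithZero Λ × WithZero Λ | q.1 + q.2 = l}.Finite := by
  refine ((finite_summands hΛ l).prod (finite_summands hΛ l)).subset ?_
  rintro ⟨a, b⟩ h
  exact ⟨⟨b, h⟩, ⟨a, by rw [add_comm]; exact h⟩⟩

end FinitenessCondition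

/-! ### Truncating series to a quotient of the monoid algebra. -/

section Truncation

theorem finsum_one_le {K : ℕ} (g : ℕ → ℚ) (h : ∀ m, K < m → g m = 0) :
    ∑ᶠ (m : ℕ) (_ : 1 ≤ m), g m = ∑ m ∈ Finset.Icc 1 K, g m := by
  rw [← finsum_mem_finset_eq_sum]
  refine finsum_congr fun m => ?_
  rw [finsum_eq_if, finsum_eq_if]
  simp only [Finset.mem_Icc]
  by_cases h1 : 1 ≤ m
  · by_cases h2 : m ≤ K
    · rw [if_pos h1, if_pos ⟨h1, h2⟩]
    · rw [if_pos h1, if_neg fun h' => h2 h'.2, h m (not_le.mp h2)]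
  · rw [if_neg h1, if_neg fun h' => h1 h'.1]

variable {Λ : Type*} [AddCommSemigroup Λ]

theorem mulSeries_eq_sum (f g : WithZero Λ → ℚ) (l : WithZero Λ)
    (s : Finset (WithZero Λ × WithZero Λ)) (hs : ∀ {q}, q ∈ s ↔ q.1 + q.2 = l) :
    mulSeries f g l = ∑ q ∈ s, f q.1 * g q.2 := by
  rw [← finsum_mem_finset_eq_sum]
  simp only [mulSeries, hs]

/-- The ideal of the elements of the monoid algebra with no coefficients at summands of `l`. -/
def truncIdeal (hΛ : FinitenessCondition Λ) (l : WithZero Λ) :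
    Ideal (AddMonoidAlgebra ℚ (WithZero Λ)) where
  carrier := {x | ∀ a ∈ summands l, x.coeff a = 0}
  zero_mem' := fun _ _ => rfl
  add_mem' := fun {x y} hx hy a ha => by
    rw [AddMonoidAlgebra.coeff_add, Finsupp.add_apply, hx a ha, hy a ha, add_zero]
  smul_mem' := fun y x hx a ha => by
    rw [smul_eq_mul, AddMonoidAlgebra.coeff_mul_antidiag y x a (finite_pairs hΛ a).toFinset
      (by simp)]
    refine Finset.sum_eq_zero fun q hq => ?_
    have hq' : q.1 + q.2 = a := by simpa using hq
    rw [hx q.2 (summands_trans ha ⟨q.1, by rw [add_comm]; exact hq'⟩), mul_zero]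

theorem mem_truncIdeal (hΛ : FinitenessCondition Λ) (l : WithZero Λ)
    (x : AddMonoidAlgebra ℚ (WithZero Λ)) :
    x ∈ truncIdeal hΛ l ↔ ∀ a ∈ summands l, x.coeff a = 0 := Iff.rfl

/-- The algebra of series truncated at the summands of `l`. -/
abbrev TruncAlgebra (hΛ : FinitenessCondition Λ) (l : WithZero Λ) : Type _ :=
  AddMonoidAlgebra ℚ (WithZero Λ) ⧸ truncIdeal hΛ l

/-- The polynomial part of a series. -/
noncomputable def polyPart (hΛ : FinitenessCondition Λ) (l : WithZero Λ) :
    (WithZero Λ → ℚ) →ₗ[ℚ] AddMonoidAlgebra ℚ (WithZero Λ) where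
  toFun f := ∑ a ∈ (finite_summands hΛ l).toFinset, AddMonoidAlgebra.single a (f a)
  map_add' f g := by
    simp [← Finset.sum_add_distrib]
  map_smul' c f := by
    simp [Finset.smul_sum]

theorem coeff_polyPart (hΛ : FinitenessCondition Λ) (l : WithZero Λ) (f : WithZero Λ → ℚ)
    {a : WithZero Λ} (ha : a ∈ summands l) : (polyPart hΛ l f).coeff a = f a := by
  classical
  change (∑ b ∈ (finite_summands hΛ l).toFinset, AddMonoidAlgebra.single b (f b)).coeff a = f a
  rw [AddMonoidAlgebra.coeff_sum, Finsupp.finsetSum_apply, Finset.sum_eq_single a]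
  · simp
  · intro b _ hb
    simp [hb]
  · intro h
    exact absurd ((finite_summands hΛ l).mem_toFinset.mpr ha) h

/-- The truncation of a series. -/
noncomputable def trunc (hΛ : FinitenessCondition Λ) (l : WithZero Λ) :
    (WithZero Λ → ℚ) →ₗ[ℚ] TruncAlgebra hΛ l :=
  (Ideal.Quotient.mkₐ ℚ (truncIdeal hΛ l)).toLinearMap ∘ₗ polyPart hΛ l

theorem trunc_eq_mk (hΛ : FinitenessCondition Λ) (l : WithZero Λ) (f : WithZero Λ → ℚ)
    (x : AddMonoidAlgebra ℚ (WithZero Λ)) :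
    trunc hΛ l f = Ideal.Quotient.mk (truncIdeal hΛ l) x ↔ ∀ a ∈ summands l, f a = x.coeff a := by
  change Ideal.Quotient.mk _ (polyPart hΛ l f) = _ ↔ _
  rw [Ideal.Quotient.eq, mem_truncIdeal]
  refine forall₂_congr fun a ha => ?_
  rw [AddMonoidAlgebra.coeff_sub, Finsupp.sub_apply, coeff_polyPart hΛ l f ha, sub_eq_zero]

theorem trunc_eq_trunc (hΛ : FinitenessCondition Λ) (l : WithZero Λ) (f g : WithZero Λ → ℚ) :
    trunc hΛ l f = trunc hΛ l g ↔ ∀ a ∈ summands l, f a = g a := by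
  refine (trunc_eq_mk hΛ l f (polyPart hΛ l g)).trans (forall₂_congr fun a ha => ?_)
  rw [coeff_polyPart hΛ l g ha]

/-- A coefficient of the product at a summand of `l` only involves summands of that summand, which
are again summands of `l`. -/
theorem trunc_mulSeries (hΛ : FinitenessCondition Λ) (l : WithZero Λ) (f g : WithZero Λ → ℚ) :
    trunc hΛ l (mulSeries f g) = trunc hΛ l f * trunc hΛ l g := by
  refine (trunc_eq_mk hΛ l _ (polyPart hΛ l f * polyPart hΛ l g)).mpr fun a ha => ?_
  have hs : ∀ {q}, q ∈ (finite_pairs hΛ a).toFinset ↔ q.1 + q.2 = a := by simp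
  rw [AddMonoidAlgebra.coeff_mul_antidiag _ _ a _ hs, mulSeries_eq_sum f g a _ hs]
  refine Finset.sum_congr rfl fun q hq => ?_
  have hq' := hs.mp hq
  rw [coeff_polyPart hΛ l f (summands_trans ha ⟨q.2, hq'⟩),
    coeff_polyPart hΛ l g (summands_trans ha ⟨q.1, by rw [add_comm]; exact hq'⟩)]

theorem trunc_oneSeries (hΛ : FinitenessCondition Λ) (l : WithZero Λ) :
    trunc hΛ l oneSeries = 1 := by
  classical
  refine (trunc_eq_mk hΛ l _ 1).mpr fun a _ => ?_
  rw [AddMonoidAlgebra.one_def, AddMonoidAlgebra.coeff_single, Finsupp.single_apply]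
  induction a using WithZero.recZeroCoe with
  | zero => simp [oneSeries]
  | coe a => simp [oneSeries, WithZero.coe_ne_zero.symm]

theorem trunc_powSeries (hΛ : FinitenessCondition Λ) (l : WithZero Λ) (f : WithZero Λ → ℚ) (k : ℕ) :
    trunc hΛ l (powSeries f k) = trunc hΛ l f ^ k := by
  induction k with
  | zero => rw [powSeries, trunc_oneSeries, pow_zero]
  | succ k ih => rw [powSeries, trunc_mulSeries, ih, pow_succ]

/-- Without constant term each of the `k` factors contributes exactly one element of `Λ`. -/
theorem exists_msum_of_powSeries_ne_zero {f : WithZero Λ → ℚ} (hf : f 0 = 0) {k : ℕ}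
    {l : WithZero Λ} (h : powSeries f k l ≠ 0) : ∃ s : Multiset Λ, s.card = k ∧ msum s = l := by
  induction k generalizing l with
  | zero =>
    refine ⟨0, rfl, ?_⟩
    induction l using WithZero.recZeroCoe with
    | zero => rfl
    | coe l => exact absurd rfl h
  | succ k ih =>
    change (∑ᶠ q ∈ {q : WithZero Λ × WithZero Λ | q.1 + q.2 = l}, _) ≠ 0 at h
    obtain ⟨q, hq1, hq2⟩ := exists_ne_zero_of_finsum_mem_ne_zero h
    replace hq1 : q.1 + q.2 = l := hq1
    obtain ⟨s, hs, hs'⟩ := ih (left_ne_zero_of_mul hq2)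
    obtain ⟨a, ha⟩ := WithZero.ne_zero_iff_exists.mp
      (fun h0 : q.2 = 0 => right_ne_zero_of_mul hq2 (by rw [h0, hf]))
    refine ⟨s + {a}, by simp [hs], ?_⟩
    rw [msum_add, hs', ← hq1, ← ha]
    simp [msum]

variable {hΛ : FinitenessCondition Λ} {l : WithZero Λ} {N : ℕ}

theorem powSeries_eq_zero (hN : ∀ s : Multiset Λ, msum s ∈ summands l → s.card ≤ N)
    {f : WithZero Λ → ℚ} (hf : f 0 = 0) {k : ℕ} (hk : N < k) {a : WithZero Λ}
    (ha : a ∈ summands l) : powSeries f k a = 0 := by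
  by_contra h
  obtain ⟨s, rfl, rfl⟩ := exists_msum_of_powSeries_ne_zero hf h
  exact absurd (hN s ha) (not_le.mpr hk)

theorem trunc_pow_eq_zero (hN : ∀ s : Multiset Λ, msum s ∈ summands l → s.card ≤ N)
    {f : WithZero Λ → ℚ} (hf : f 0 = 0) : trunc hΛ l f ^ (N + 1) = 0 := by
  rw [← trunc_powSeries, ← map_zero (trunc hΛ l), trunc_eq_trunc]
  exact fun a ha => powSeries_eq_zero hN hf N.lt_succ_self ha

theorem trunc_expSeries (hN : ∀ s : Multiset Λ, msum s ∈ summands l → s.card ≤ N)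
    {f : WithZero Λ → ℚ} (hf : f 0 = 0) :
    trunc hΛ l (expSeries f) = IsNilpotent.exp (trunc hΛ l f) := by
  rw [IsNilpotent.exp_eq_sum (trunc_pow_eq_zero hN hf)]
  simp only [← trunc_powSeries, ← map_smul, ← map_sum]
  rw [trunc_eq_trunc]
  intro a ha
  rw [expSeries, finsum_eq_sum_of_support_subset (s := Finset.range (N + 1))]
  · simp [Finset.sum_apply, div_eq_inv_mul]
  · intro k hk
    by_contra hk'
    simp only [Finset.coe_range, Set.mem_Iio, not_lt] at hk'
    exact hk (by simp [powSeries_eq_zero hN hf hk' ha])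

theorem trunc_lnSeries (hN : ∀ s : Multiset Λ, msum s ∈ summands l → s.card ≤ N)
    {f : WithZero Λ → ℚ} (hf : f 0 = 1) :
    trunc hΛ l (lnSeries f) = nilLog (N + 1) (trunc hΛ l f - 1) := by
  have hf' : (fun a => f a - oneSeries a) 0 = 0 := by simp [oneSeries, hf]
  rw [nilLog, ← trunc_oneSeries hΛ l, ← map_sub]
  have : f - oneSeries = fun a => f a - oneSeries a := rfl
  rw [this]
  simp only [← trunc_powSeries, ← map_smul, ← map_sum]
  rw [trunc_eq_trunc]
  intro a ha
  rw [lnSeries, finsum_one_le (K := N + 1) _ fun k hk => by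
    rw [powSeries_eq_zero hN hf' (by omega) ha, mul_zero, zero_div]]
  have hI : Finset.Icc 1 (N + 1) = Finset.Ico (0 + 1) (N + 1 + 1) := by
    ext m
    simp only [Finset.mem_Icc, Finset.mem_Ico]
    omega
  rw [hI, ← Finset.sum_Ico_add' (fun k : ℕ =>
    (-1 : ℚ) ^ (k + 1) * powSeries (fun a => f a - oneSeries a) k a / (k : ℚ)),
    ← Finset.range_eq_Ico, Finset.sum_apply]
  refine Finset.sum_congr rfl fun k _ => ?_
  simp only [Pi.smul_apply, smul_eq_mul]
  push_cast
  ring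

end Truncation

end ColorLie

namespace ColorLie

/-! ### Dilations as ring homomorphisms. -/

section Dilation

variable {Λ : Type*} [AddCommSemigroup Λ] {κ : Λ →ₙ+ Additive ℤˣ}

@[simp]
theorem signOf_zero : signOf κ 0 = 1 := rfl

theorem signOf_add (a b : WithZero Λ) : signOf κ (a + b) = signOf κ a * signOf κ b := by
  induction a using WithZero.recZeroCoe with
  | zero => simp
  | coe a =>
    induction b using WithZero.recZeroCoe with
    | zero => simp
    | coe b =>
      change (((κ (a + b)).toMul : ℤ) : ℚ) = (((κ a).toMul : ℤ) : ℚ) * (((κ b).toMul : ℤ) : ℚ)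
      rw [map_add, toMul_add, Units.val_mul, Int.cast_mul]

theorem signOf_nsmul (n : ℕ) (a : WithZero Λ) : signOf κ (n • a) = signOf κ a ^ n := by
  induction n with
  | zero => simp
  | succ n ih => rw [succ_nsmul, signOf_add, ih, pow_succ]

/-- The series with support in the elements of positive sign. -/
def PositiveSupport (κ : Λ →ₙ+ Additive ℤˣ) (f : WithZero Λ → ℚ) : Prop :=
  ∀ a, f a ≠ 0 → signOf κ a = 1

/-- For a series supported in positive degrees every sign that matters is `1`, so the twist
disappears. -/
theorem dilation_eq_finsum {f : WithZero Λ → ℚ} (hf : PositiveSupport κ f) (n : ℕ)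
    (a : WithZero Λ) : dilation κ n f a = ∑ᶠ (b : WithZero Λ) (_ : n • b = a), f b := by
  have h1 : ∀ b : WithZero Λ, signOf κ b * f b = f b := by
    intro b
    by_cases h : f b = 0
    · rw [h, mul_zero]
    · rw [hf b h, one_mul]
  simp only [dilation, h1]
  by_cases h : ∃ b, n • b = a ∧ f b ≠ 0
  · obtain ⟨b, rfl, hb⟩ := h
    rw [signOf_nsmul, hf b hb, one_pow, one_mul]
  · classical
    push Not at h
    have h2 : ∀ b : WithZero Λ, (∑ᶠ (_ : n • b = a), f b) = 0 := by
      intro b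
      rw [finsum_eq_if]
      split_ifs with hb
      · exact h b hb
      · rfl
    simp only [h2, finsum_zero, mul_zero]

theorem mem_summands_nsmul {n : ℕ} (hn : n ≠ 0) (b : WithZero Λ) : b ∈ summands (n • b) := by
  obtain ⟨m, rfl⟩ := Nat.exists_eq_succ_of_ne_zero hn
  exact ⟨m • b, by rw [Nat.succ_eq_add_one, succ_nsmul']⟩

theorem dilation_apply_zero {f : WithZero Λ → ℚ} (hf : PositiveSupport κ f) {n : ℕ} (hn : n ≠ 0) :
    dilation κ n f 0 = f 0 := by
  rw [dilation_eq_finsum hf]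
  have : ∀ b : WithZero Λ, n • b = 0 ↔ b ∈ ({0} : Finset (WithZero Λ)) := by
    intro b
    rw [Finset.mem_singleton]
    refine ⟨eq_zero_of_nsmul_eq_zero hn, ?_⟩
    rintro rfl
    rw [smul_zero]
  simp only [this]
  rw [finsum_mem_finset_eq_sum, Finset.sum_singleton]

theorem dilation_one {f : WithZero Λ → ℚ} (hf : PositiveSupport κ f) : dilation κ 1 f = f := by
  funext a
  rw [dilation_eq_finsum hf]
  have : ∀ b : WithZero Λ, 1 • b = a ↔ b ∈ ({a} : Finset (WithZero Λ)) := by simp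
  simp only [this]
  rw [finsum_mem_finset_eq_sum, Finset.sum_singleton]

theorem dilation_eq_zero {l : WithZero Λ} {N : ℕ}
    (hN : ∀ s : Multiset Λ, msum s ∈ summands l → s.card ≤ N) {f : WithZero Λ → ℚ}
    (hf : PositiveSupport κ f) (hf0 : f 0 = 0) {n : ℕ} (hn : N < n) {a : WithZero Λ}
    (ha : a ∈ summands l) : dilation κ n f a = 0 := by
  rw [dilation_eq_finsum hf]
  by_contra h
  change (∑ᶠ b ∈ {b : WithZero Λ | n • b = a}, f b) ≠ 0 at h
  obtain ⟨b, rfl, hb⟩ := exists_ne_zero_of_finsum_mem_ne_zero h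
  obtain ⟨b, rfl⟩ := WithZero.ne_zero_iff_exists.mp (fun h0 : b = 0 => hb (by rw [h0, hf0]))
  rw [← msum_replicate] at ha
  have := hN _ ha
  rw [Multiset.card_replicate] at this
  omega

/-- The dilation of the truncated algebra. -/
noncomputable def dilHom (hΛ : FinitenessCondition Λ) (l : WithZero Λ) {n : ℕ} (hn : n ≠ 0) :
    TruncAlgebra hΛ l →+* TruncAlgebra hΛ l :=
  Ideal.quotientMap (truncIdeal hΛ l)
    (AddMonoidAlgebra.mapDomainRingHom ℚ (nsmulAddMonoidHom (α := WithZero Λ) n)) (by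
      classical
      intro x hx a ha
      change (Finsupp.mapDomain (fun b => n • b) x.coeff) a = 0
      rw [Finsupp.mapDomain, Finsupp.sum_apply]
      refine Finset.sum_eq_zero fun b _ => ?_
      change Finsupp.single (n • b) (x.coeff b) a = 0
      rw [Finsupp.single_apply]
      split_ifs with hb
      · subst hb
        exact hx b (summands_trans ha (mem_summands_nsmul hn b))
      · rfl)

theorem dilHom_mk (hΛ : FinitenessCondition Λ) (l : WithZero Λ) {n : ℕ} (hn : n ≠ 0)
    (x : AddMonoidAlgebra ℚ (WithZero Λ)) :
    dilHom hΛ l hn (Ideal.Quotient.mk _ x) = Ideal.Quotient.mk _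
      (AddMonoidAlgebra.mapDomainRingHom ℚ (nsmulAddMonoidHom (α := WithZero Λ) n) x) :=
  Ideal.quotientMap_mk

theorem dilHom_dilHom (hΛ : FinitenessCondition Λ) (l : WithZero Λ) {n m : ℕ} (hn : n ≠ 0)
    (hm : m ≠ 0) (x : TruncAlgebra hΛ l) :
    dilHom hΛ l hn (dilHom hΛ l hm x) = dilHom hΛ l (mul_ne_zero hn hm) x := by
  obtain ⟨x, rfl⟩ := Ideal.Quotient.mk_surjective x
  have h : nsmulAddMonoidHom (α := WithZero Λ) (n * m) =
      (nsmulAddMonoidHom n).comp (nsmulAddMonoidHom m) := by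
    ext a
    simp [mul_smul]
  rw [dilHom_mk, dilHom_mk, dilHom_mk, h, AddMonoidAlgebra.mapDomainRingHom_comp]
  rfl

/-- Realizing the dilation by a ring homomorphism lets it pass through the exponential. -/
theorem trunc_dilation (hΛ : FinitenessCondition Λ) (l : WithZero Λ) {n : ℕ} (hn : n ≠ 0)
    {f : WithZero Λ → ℚ} (hf : PositiveSupport κ f) :
    trunc hΛ l (dilation κ n f) = dilHom hΛ l hn (trunc hΛ l f) := by
  classical
  have h : trunc hΛ l f = Ideal.Quotient.mk (truncIdeal hΛ l)
    (∑ b ∈ (finite_summands hΛ l).toFinset, AddMonoidAlgebra.single b (f b)) := rfl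
  rw [h, dilHom_mk, trunc_eq_mk]
  intro a ha
  have hs : {b : WithZero Λ | n • b = a} =
      ↑((finite_summands hΛ l).toFinset.filter fun b => n • b = a) := by
    ext b
    rw [Finset.mem_coe, Finset.mem_filter, Set.Finite.mem_toFinset]
    refine ⟨fun hb => ⟨?_, hb⟩, fun hb => hb.2⟩
    have hb' : n • b = a := hb
    exact summands_trans ha (hb' ▸ mem_summands_nsmul hn b)
  rw [dilation_eq_finsum hf, map_sum, AddMonoidAlgebra.coeff_sum, Finsupp.finsetSum_apply]
  change (∑ᶠ b ∈ {b : WithZero Λ | n • b = a}, f b) = _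
  rw [hs, finsum_mem_coe_finset, Finset.sum_filter]
  refine Finset.sum_congr rfl fun b _ => ?_
  simp [Finsupp.single_apply]

end Dilation

/-! ### The transforms `ℰ_p` and `ℒ_p`. -/

section Characters

variable {Λ : Type*} [AddCommSemigroup Λ] {κ : Λ →ₙ+ Additive ℤˣ} {p : ℕ}

open Finset

theorem expSeries_apply_zero (hΛ : FinitenessCondition Λ) {f : WithZero Λ → ℚ} (hf : f 0 = 0) :
    expSeries f 0 = 1 := by
  obtain ⟨N, hN⟩ := exists_card_le hΛ 0
  have h0 : IsNilpotent (trunc hΛ 0 f) := ⟨_, trunc_pow_eq_zero hN hf⟩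
  have h : trunc hΛ 0 f = trunc hΛ 0 0 := by
    rw [trunc_eq_trunc]
    rintro a ⟨c, hc⟩
    rw [(eq_zero_of_add_eq_zero hc).1, hf]
    rfl
  have h1 : trunc hΛ 0 (expSeries f) = trunc hΛ 0 oneSeries := by
    rw [trunc_expSeries hN hf, h, map_zero, IsNilpotent.exp_zero, trunc_oneSeries]
  exact (trunc_eq_trunc hΛ 0 _ _).mp h1 0 (self_mem_summands 0)

/-- The cutoff `K` may exceed `N`, which allows it to be matched with the cutoff of `exp_oneP`. -/
theorem trunc_Ep (hΛ : FinitenessCondition Λ) {l : WithZero Λ} {N K : ℕ} (hK : N ≤ K)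
    (hN : ∀ s : Multiset Λ, msum s ∈ summands l → s.card ≤ N) {f : WithZero Λ → ℚ}
    (hf : PositiveSupport κ f) (hf0 : f 0 = 0) :
    IsNilpotent (∑ m ∈ Icc 1 K, ((oneP p m : ℚ) / m) • trunc hΛ l (dilation κ m f)) ∧
    trunc hΛ l (Ep p κ f) =
      IsNilpotent.exp (∑ m ∈ Icc 1 K, ((oneP p m : ℚ) / m) • trunc hΛ l (dilation κ m f)) := by
  have h0 : (fun l => ∑ᶠ (m : ℕ) (_ : 1 ≤ m), (oneP p m : ℚ) / (m : ℚ) * dilation κ m f l) 0 =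
      0 := by
    have : ∀ m : ℕ, (∑ᶠ (_ : 1 ≤ m), (oneP p m : ℚ) / (m : ℚ) * dilation κ m f 0) = 0 := by
      intro m
      rw [finsum_eq_if]
      split_ifs with hm
      · rw [dilation_apply_zero hf (by omega), hf0, mul_zero]
      · rfl
    simp only [this, finsum_zero]
  have h1 : trunc hΛ l (fun l => ∑ᶠ (m : ℕ) (_ : 1 ≤ m),
      (oneP p m : ℚ) / (m : ℚ) * dilation κ m f l) =
      ∑ m ∈ Icc 1 K, ((oneP p m : ℚ) / m) • trunc hΛ l (dilation κ m f) := by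
    simp only [← map_smul, ← map_sum]
    rw [trunc_eq_trunc]
    intro a ha
    rw [finsum_one_le (K := K) _ fun m hm => by
      rw [dilation_eq_zero hN hf hf0 (by omega) ha, mul_zero]]
    simp [Finset.sum_apply]
  rw [← h1]
  exact ⟨⟨_, trunc_pow_eq_zero hN h0⟩, trunc_expSeries hN h0⟩

theorem sum_Icc_mul (K : ℕ) (g : ℕ → ℕ → ℚ) (hg : ∀ n m, K < n * m → g n m = 0) :
    ∑ n ∈ Icc 1 K, ∑ m ∈ Icc 1 K, g n m =
      ∑ k ∈ Icc 1 K, ∑ q ∈ k.divisorsAntidiagonal, g q.1 q.2 := by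
  rw [← sum_product', ← sum_filter_of_ne (p := fun q : ℕ × ℕ => q.1 * q.2 ≤ K)
    (fun q _ hq => not_lt.mp fun h => hq (hg _ _ h)), sum_sigma']
  refine sum_bij' (fun q _ => ⟨q.1 * q.2, q⟩) (fun x _ => x.2) ?_ ?_ ?_ ?_ ?_
  · intro q hq
    simp only [mem_filter, mem_product, mem_Icc] at hq
    simp only [mem_sigma, mem_Icc, Nat.mem_divisorsAntidiagonal]
    have := Nat.mul_pos hq.1.1.1 hq.1.2.1
    exact ⟨⟨this, hq.2⟩, trivial, this.ne'⟩
  · rintro ⟨k, n, m⟩ hx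
    simp only [mem_sigma, mem_Icc, Nat.mem_divisorsAntidiagonal] at hx
    obtain ⟨⟨-, hk⟩, rfl, h0⟩ := hx
    have hn := Nat.pos_of_ne_zero (left_ne_zero_of_mul h0)
    have hm := Nat.pos_of_ne_zero (right_ne_zero_of_mul h0)
    simp only [mem_filter, mem_product, mem_Icc]
    exact ⟨⟨⟨hn, (Nat.le_mul_of_pos_right n hm).trans hk⟩, hm,
      (Nat.le_mul_of_pos_left m hn).trans hk⟩, hk⟩
  · intro q _
    rfl
  · rintro ⟨k, n, m⟩ hx
    simp only [mem_sigma, Nat.mem_divisorsAntidiagonal] at hx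
    obtain ⟨-, rfl, -⟩ := hx
    rfl
  · intro q _
    rfl

/-- `Lp` inverts `Ep`. -/
theorem Lp_Ep (hΛ : FinitenessCondition Λ) (hp : p.Prime) {f : WithZero Λ → ℚ}
    (hf : PositiveSupport κ f) (hf0 : f 0 = 0) (hE : PositiveSupport κ (Ep p κ f)) :
    Lp p κ (Ep p κ f) = f := by
  funext l
  obtain ⟨N, hN⟩ := exists_card_le hΛ l
  have hE0 : Ep p κ f 0 = 1 := by
    refine expSeries_apply_zero hΛ ?_
    have : ∀ m : ℕ, (∑ᶠ (_ : 1 ≤ m), (oneP p m : ℚ) / (m : ℚ) * dilation κ m f 0) = 0 := by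
      intro m
      rw [finsum_eq_if]
      split_ifs with hm
      · rw [dilation_apply_zero hf (by omega), hf0, mul_zero]
      · rfl
    simp only [this, finsum_zero]
  -- The dilated exponential is the exponential of the dilated exponent, and the logarithm undoes
  -- it.
  have hln : ∀ n, n ≠ 0 → lnSeries (dilation κ n (Ep p κ f)) l =
      ∑ m ∈ Icc 1 N, (oneP p m : ℚ) / m * dilation κ (n * m) f l := by
    intro n hn
    have h1 : trunc hΛ l (lnSeries (dilation κ n (Ep p κ f))) =
        ∑ m ∈ Icc 1 N, ((oneP p m : ℚ) / m) • trunc hΛ l (dilation κ (n * m) f) := by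
      obtain ⟨hnil, hexp⟩ := trunc_Ep (κ := κ) (p := p) hΛ le_rfl hN hf hf0
      have hx : trunc hΛ l (dilation κ n (Ep p κ f)) = IsNilpotent.exp
          (∑ m ∈ Icc 1 N, ((oneP p m : ℚ) / m) • trunc hΛ l (dilation κ (n * m) f)) := by
        rw [trunc_dilation hΛ l hn hE, hexp, IsNilpotent.map_exp hnil, map_sum]
        congr 1
        refine sum_congr rfl fun m hm => ?_
        have hm0 : m ≠ 0 := by
          rw [mem_Icc] at hm
          omega
        rw [map_rat_smul, trunc_dilation hΛ l hm0 hf, dilHom_dilHom,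
          trunc_dilation hΛ l (mul_ne_zero hn hm0) hf]
      rw [trunc_lnSeries hN (by rw [dilation_apply_zero hE hn, hE0]), hx]
      refine nilLog_exp ?_
      simp only [← map_smul, ← map_sum]
      refine trunc_pow_eq_zero hN ?_
      rw [Finset.sum_apply]
      refine sum_eq_zero fun m hm => ?_
      rw [mem_Icc] at hm
      rw [Pi.smul_apply, dilation_apply_zero hf (mul_ne_zero hn (by omega)), hf0, smul_zero]
    simp only [← map_smul, ← map_sum] at h1
    rw [(trunc_eq_trunc hΛ l _ _).mp h1 l (self_mem_summands l)]
    simp [Finset.sum_apply]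
  have hzero : ∀ k, N < k → dilation κ k f l = 0 := fun k hk =>
    dilation_eq_zero hN hf hf0 hk (self_mem_summands l)
  have hLp : Lp p κ (Ep p κ f) l = ∑ n ∈ Icc 1 N, (moebiusP p n : ℚ) / n *
      ∑ m ∈ Icc 1 N, (oneP p m : ℚ) / m * dilation κ (n * m) f l := by
    rw [Lp, finsum_one_le (K := N)]
    · refine sum_congr rfl fun n hn => ?_
      rw [mem_Icc] at hn
      rw [hln n (by omega)]
    · intro n hn
      rw [hln n (by omega), sum_eq_zero, mul_zero]
      intro m hm
      rw [mem_Icc] at hm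
      rw [hzero _ (hn.trans_le (Nat.le_mul_of_pos_right n hm.1)), mul_zero]
  rw [hLp]
  simp only [mul_sum]
  rw [sum_Icc_mul N (fun n m => (moebiusP p n : ℚ) / n * ((oneP p m : ℚ) / m *
    dilation κ (n * m) f l)) fun n m h => by rw [hzero _ h, mul_zero, mul_zero]]
  have hk : ∀ k ∈ Icc 1 N, ∑ q ∈ k.divisorsAntidiagonal, (moebiusP p q.1 : ℚ) / q.1 *
      ((oneP p q.2 : ℚ) / q.2 * dilation κ (q.1 * q.2) f l) =
      if k = 1 then dilation κ 1 f l else 0 := by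
    intro k hk
    have h1 : ∀ q ∈ k.divisorsAntidiagonal, (moebiusP p q.1 : ℚ) / q.1 *
      ((oneP p q.2 : ℚ) / q.2 * dilation κ (q.1 * q.2) f l) =
      ((moebiusP p q.1 * oneP p q.2 : ℤ) : ℚ) * (dilation κ k f l / k) := by
      intro q hq
      rw [← (Nat.mem_divisorsAntidiagonal.mp hq).1]
      push_cast
      ring
    rw [sum_congr rfl h1, ← sum_mul, ← Int.cast_sum, sum_moebiusP_mul_oneP hp]
    split_ifs with h
    · subst h
      simp
    · simp
  rw [sum_congr rfl hk, sum_ite_eq', dilation_one hf]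
  split_ifs with h
  · rfl
  -- With `N = 0` the sum is empty, and `f l = f^{[1]} l` vanishes as well.
  · have hN0 : N = 0 := by
      rw [mem_Icc] at h
      omega
    have := hzero 1 (by omega)
    rw [dilation_one hf] at this
    exact this.symm

open Classical in
/-- The coefficients of `Ep p κ f`, if `f` is the character of a space with a given basis. -/
theorem Ep_apply_eq_card (hΛ : FinitenessCondition Λ) (hp : 0 < p) {I : Type*} (deg : I → Λ)
    {f : WithZero Λ → ℚ} (hf : PositiveSupport κ f) (hf0 : f 0 = 0) (l : WithZero Λ) (S : Finset I)
    (hS : ∀ a ∈ summands l, f a = (S.filter fun i => (deg i : WithZero Λ) = a).card) :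
    Ep p κ f l = ((Fintype.piFinset fun _ : S => range p).filter
        fun x : S → ℕ => ∑ i, x i • (deg i : WithZero Λ) = l).card := by
  obtain ⟨N, hN⟩ := exists_card_le hΛ l
  let e : Λ → TruncAlgebra hΛ l := fun a =>
    Ideal.Quotient.mk (truncIdeal hΛ l) (AddMonoidAlgebra.single (a : WithZero Λ) 1)
  have hpow : ∀ (a : Λ) (n : ℕ), e a ^ n =
      Ideal.Quotient.mk (truncIdeal hΛ l) (AddMonoidAlgebra.single (n • (a : WithZero Λ)) 1) := by
    intro a n
    rw [← map_pow, AddMonoidAlgebra.single_pow, one_pow]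
  have hnil : ∀ a, e a ^ (N + 1) = 0 := by
    intro a
    rw [hpow, Ideal.Quotient.eq_zero_iff_mem, mem_truncIdeal]
    intro b hb
    rw [AddMonoidAlgebra.coeff_single, Finsupp.single_apply, if_neg]
    rintro rfl
    rw [← msum_replicate] at hb
    have := hN _ hb
    rw [Multiset.card_replicate] at this
    omega
  have htr : trunc hΛ l f = ∑ i : S, e (deg i) := by
    rw [← map_sum, trunc_eq_mk]
    intro a ha
    rw [hS a ha, AddMonoidAlgebra.coeff_sum, Finsupp.finsetSum_apply,
      Finset.sum_coe_sort S fun i => (AddMonoidAlgebra.single (deg i : WithZero Λ) (1 : ℚ)).coeff a]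
    simp [Finsupp.single_apply]
  have hdil : ∀ m ∈ Icc 1 (p * (N + 1)), ((oneP p m : ℚ) / m) • trunc hΛ l (dilation κ m f) =
      ∑ i : S, ((oneP p m : ℚ) / m) • e (deg i) ^ m := by
    intro m hm
    have hm0 : m ≠ 0 := by
      rw [mem_Icc] at hm
      omega
    rw [trunc_dilation hΛ l hm0 hf, htr, map_sum, smul_sum]
    refine sum_congr rfl fun i _ => ?_
    rw [hpow, dilHom_mk]
    simp
  obtain ⟨-, hexp⟩ := trunc_Ep (κ := κ) (p := p) hΛ (K := p * (N + 1))
    (by nlinarith) hN hf hf0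
  rw [sum_congr rfl hdil, sum_comm, exp_sum _ _ fun i _ => ?_] at hexp
  · simp only [exp_oneP p hp (hnil _)] at hexp
    -- Expanding `∏ (1 + e^{λ_i} + ⋯ + e^{(p-1)λ_i})` gives one term for each exponent function with
    -- values below `p`.
    rw [Finset.prod_univ_sum] at hexp
    have hprod : ∀ x : S → ℕ, ∏ i : S, e (deg i) ^ x i = Ideal.Quotient.mk (truncIdeal hΛ l)
        (AddMonoidAlgebra.single (∑ i : S, x i • (deg i : WithZero Λ)) 1) := by
      intro x
      simp only [hpow]
      rw [← map_prod, AddMonoidAlgebra.prod_single, prod_const_one]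
    simp only [hprod] at hexp
    rw [← map_sum, trunc_eq_mk] at hexp
    rw [hexp l (self_mem_summands l), AddMonoidAlgebra.coeff_sum, Finsupp.finsetSum_apply]
    simp only [AddMonoidAlgebra.coeff_single, Finsupp.single_apply, sum_boole]
  · refine isNilpotent_sum fun m hm => ?_
    rw [mem_Icc] at hm
    exact IsNilpotent.smul (IsNilpotent.pow_of_pos ⟨_, hnil _⟩ (by omega)) _

end Characters

end ColorLie

namespace ColorLie

open Module

/-! ### Characters of `L` and `u(L)`. -/

section Conclusion

variable {p : ℕ} {F G L Λ I : Type*} [Field F] [AddCommGroup G] [AddCommGroup L] [Module F L]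
  {γ : CommutationFactor F G} {A : ColorLiePSuperalgebra p F L γ} {B : Λ → Submodule F L}
  [AddCommSemigroup Λ] {κ : Λ →ₙ+ Additive ℤˣ}

theorem AdaptedBasis.finite_summands_deg (hΛ : FinitenessCondition Λ)
    (hfin : ∀ l, FiniteDimensional F (B l)) (b : AdaptedBasis A B I) (l : WithZero Λ) :
    {i | (b.deg i : WithZero Λ) ∈ summands l}.Finite := by
  have h : {i | (b.deg i : WithZero Λ) ∈ summands l} =
      ⋃ a ∈ summands l, {i | (b.deg i : WithZero Λ) = a} := by
    ext i
    simp
  rw [h]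
  refine (finite_summands hΛ l).biUnion fun a _ => ?_
  induction a using WithZero.recZeroCoe with
  | zero => simp
  | coe a => simpa using b.finite_deg a

/-- The letters of such a word lie in a finite set, since their degrees are summands of `l`, and its
length is bounded by the finiteness condition. -/
theorem AdaptedBasis.finite_wordDeg (hΛ : FinitenessCondition Λ)
    (hfin : ∀ l, FiniteDimensional F (B l)) (b : AdaptedBasis A B I) (l : WithZero Λ) :
    {w | b.wordDeg w = l}.Finite := by
  obtain ⟨N, hN⟩ := exists_card_le hΛ l
  have hS := b.finite_summands_deg hΛ hfin l
  have := hS.to_subtype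
  refine ((List.finite_length_le {i | (b.deg i : WithZero Λ) ∈ summands l} N).image
    (List.map Subtype.val)).subset fun w hw => ?_
  have hw' : b.wordDeg w = l := hw
  have hmem : ∀ i ∈ w, i ∈ {i | (b.deg i : WithZero Λ) ∈ summands l} := by
    intro i hi
    obtain ⟨u, v, rfl⟩ := List.append_of_mem hi
    refine ⟨b.wordDeg u + b.wordDeg v, ?_⟩
    rw [← hw', b.wordDeg_append]
    simp only [AdaptedBasis.wordDeg, List.map_cons, List.sum_cons]
    rw [add_left_comm]
  have hlen : w.length ≤ N := by
    have h := hN (w.map b.deg : List Λ) (by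
      have : msum (w.map b.deg : List Λ) = l := by
        rw [← hw', msum, Multiset.map_coe, Multiset.sum_coe, List.map_map]
        rfl
      rw [this]
      exact self_mem_summands l)
    simpa using h
  lift w to List {i | (b.deg i : WithZero Λ) ∈ summands l} using hmem
  exact ⟨w, (List.length_map Subtype.val).symm.trans_le hlen, rfl⟩

theorem AdaptedBasis.signOf_wordDeg (hG : γ.pos = Set.univ) (hB : A.IsSemigroupGraded κ B)
    (b : AdaptedBasis A B I) (w : List I) : signOf κ (b.wordDeg w) = 1 := by
  induction w with
  | nil => rfl
  | cons i w ih =>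
    have h : b.wordDeg (i :: w) = (b.deg i : WithZero Λ) + b.wordDeg w := rfl
    rw [h, signOf_add, ih, mul_one]
    change (((κ (b.deg i)).toMul : ℤ) : ℚ) = 1
    rw [b.parity_eq_one hG hB]
    simp

theorem positiveSupport_characterNoConst (hG : γ.pos = Set.univ) (hB : A.IsSemigroupGraded κ B)
    (b : AdaptedBasis A B I) : PositiveSupport κ (characterNoConst B) := by
  intro a ha
  induction a using WithZero.recZeroCoe with
  | zero => rfl
  | coe a =>
    change (finrank F (B a) : ℚ) ≠ 0 at ha
    rw [b.finrank_eq hB, Nat.cast_ne_zero, Nat.card_ne_zero] at ha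
    obtain ⟨⟨i, hi⟩⟩ := ha.1
    have h := b.signOf_wordDeg hG hB [i]
    have hi' : b.deg i = a := hi
    simpa [AdaptedBasis.wordDeg, hi'] using h

variable [hp : Fact p.Prime] [CharP F p] [LinearOrder I] [WellFoundedLT I]

theorem isGrading_envelopingComp (hG : γ.pos = Set.univ) (hB : A.IsSemigroupGraded κ B)
    (b : AdaptedBasis A B I) : IsGrading (A.envelopingComp B) := by
  rw [funext (envelopingComp_eq_span hG hB b)]
  exact isGrading_span (pbwBasis hG hB b) fun w => b.wordDeg w.1

theorem finiteDimensional_envelopingComp (hΛ : FinitenessCondition Λ)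
    (hfin : ∀ l, FiniteDimensional F (B l)) (hG : γ.pos = Set.univ)
    (hB : A.IsSemigroupGraded κ B) (b : AdaptedBasis A B I) (l : WithZero Λ) :
    FiniteDimensional F (A.envelopingComp B l) := by
  rw [envelopingComp_eq_span hG hB b l]
  refine FiniteDimensional.span_of_finite F (Set.Finite.image _ ?_)
  exact (b.finite_wordDeg hΛ hfin l).preimage Subtype.val_injective.injOn

theorem finrank_envelopingComp (hG : γ.pos = Set.univ)
    (hB : A.IsSemigroupGraded κ B) (b : AdaptedBasis A B I) (l : WithZero Λ) :
    finrank F (A.envelopingComp B l) =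
      Nat.card {w | IsIrreducible (EnvelopingRule b) w ∧ b.wordDeg w = l} := by
  rw [envelopingComp_eq_span hG hB b l, finrank_span_image]
  exact Nat.card_congr (Equiv.subtypeSubtypeEquivSubtypeInter _ fun w => b.wordDeg w = l)

theorem positiveSupport_character_envelopingComp (hG : γ.pos = Set.univ)
    (hB : A.IsSemigroupGraded κ B) (b : AdaptedBasis A B I) :
    PositiveSupport κ (character (A.envelopingComp B)) := by
  intro a ha
  rw [character, finrank_envelopingComp hG hB b, Nat.cast_ne_zero, Nat.card_ne_zero] at ha
  obtain ⟨⟨w, -, rfl⟩⟩ := ha.1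
  exact b.signOf_wordDeg hG hB w

/-- Both coefficients at `l` count exponent functions with values below `p` and total degree `l` on
the finite set of basis elements whose degree is a summand of `l`. -/
theorem character_envelopingComp (hΛ : FinitenessCondition Λ)
    (hfin : ∀ l, FiniteDimensional F (B l)) (hG : γ.pos = Set.univ)
    (hB : A.IsSemigroupGraded κ B) (b : AdaptedBasis A B I) :
    character (A.envelopingComp B) = Ep p κ (characterNoConst B) := by
  classical
  funext l
  have hS := b.finite_summands_deg hΛ hfin l
  rw [character, finrank_envelopingComp hG hB b,
    card_irreducible hp.out.pos b l hS.toFinset fun i hi => hS.mem_toFinset.mpr hi,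
    Ep_apply_eq_card hΛ hp.out.pos b.deg (positiveSupport_characterNoConst hG hB b) rfl l
      hS.toFinset]
  · congr!
  intro a ha
  rw [← Nat.card_eq_finsetCard]
  induction a using WithZero.recZeroCoe with
  | zero =>
    change (0 : ℚ) = _
    simp
  | coe a =>
    change (finrank F (B a) : ℚ) = _
    rw [b.finrank_eq hB]
    congr 1
    refine Nat.card_congr (Equiv.subtypeEquivRight fun i => ?_)
    rw [Finset.mem_filter, hS.mem_toFinset, WithZero.coe_inj]
    refine ⟨fun hi => ⟨?_, hi⟩, fun hi => hi.2⟩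
    have hi' : b.deg i = a := hi
    change (b.deg i : WithZero Λ) ∈ summands l
    rw [hi']
    exact ha

end Conclusion

end ColorLie

theorem theorem2p5p5 {F G Λ L : Type*} [Field F] (p : ℕ) [Fact p.Prime] [CharP F p]
    [AddCommGroup G] (γ : ColorLie.CommutationFactor F G) (hG : γ.pos = Set.univ)
    [AddCommSemigroup Λ] [Countable Λ] (hΛ : ColorLie.FinitenessCondition Λ)
    (κ : Λ →ₙ+ Additive ℤˣ) [AddCommGroup L] [Module F L]
    (A : ColorLie.ColorLiePSuperalgebra p F L γ) (B : Λ → Submodule F L)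
    (hB : A.IsSemigroupGraded κ B) (hfin : ∀ l, FiniteDimensional F (B l)) :
    ColorLie.IsGrading (A.envelopingComp B) ∧
    (∀ l, FiniteDimensional F (A.envelopingComp B l)) ∧
    ColorLie.character (A.envelopingComp B) =
      ColorLie.Ep p κ (ColorLie.characterNoConst B) ∧
    ColorLie.characterNoConst B =
      ColorLie.Lp p κ (ColorLie.character (A.envelopingComp B)) := by
  obtain ⟨I, _, _, ⟨b⟩⟩ := ColorLie.exists_adaptedBasis hB
  have hE := ColorLie.character_envelopingComp hΛ hfin hG hB b
  refine ⟨ColorLie.isGrading_envelopingComp hG hB b,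
    ColorLie.finiteDimensional_envelopingComp hΛ hfin hG hB b, hE, ?_⟩
  have hpos := ColorLie.positiveSupport_character_envelopingComp hG hB b
  rw [hE] at hpos ⊢
  exact (ColorLie.Lp_Ep hΛ Fact.out (ColorLie.positiveSupport_characterNoConst hG hB b) rfl
    hpos).symm
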